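/- **Setting.** Let $d\ge 2$, let $\overline\Omega\subset\mathbb R^d$ be a compact connected polytope with interior $\Omega\neq\emptyset$, and let $\partial\Omega=\partial\Omega_t\cup\partial\Omega_R\cup\partial\Omega_D$ be a partition into three disjoint sets. A generalised face is the intersection of an open $(d-1)$-dimensional face of $\overline\Omega$ with one of the three sets; $PC(\partial\Omega)$ is the space of bounded functions on $\partial\Omega$ that are continuous on each generalised face, with the supremum norm. For $x\in\partial\Omega$ let $K(x)$ be the set of $p\in\mathbb R^d$ with $x+\lambda p\in\overline\Omega$ for all sufficiently small $\lambda\ge0$. Let $A$ be a compact metric space, $T>0$, and let $\alpha\mapsto(a^\alpha,b^\alpha,c^\alpha,f^\alpha)\in C(\overline\Omega)\times C(\overline\Omega,\mathbb R^d)\times C(\overline\Omega)^2$ and $\alpha\mapsto(b^\alpha_{\partial\Omega},c^\alpha_{\partial\Omega},g^\alpha)\in PC(\partial\Omega,\mathbb R^d)\times PC(\partial\Omega)^2$ be continuous, $g\in C(\partial\Omega)$, $v_T\in C(\overline\Omega)$, with $a^\alpha,c^\alpha,c^\alpha_{\partial\Omega},g^\alpha,g,v_T\ge0$, $v_T=g$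 on $\partial\Omega_D$ and $b^\alpha_{\partial\Omega}(x)\in K(x)$. Put $L^\alpha w=-a^\alpha\Delta w-b^\alpha\cdot\nabla w+c^\alpha w$ and $L^\alpha_{\partial\Omega}w=-b^\alpha_{\partial\Omega}\cdot\nabla w+c^\alpha_{\partial\Omega}w$. **Discretisation.** For $i\in\mathbb N$ let $\mathcal T_i$ be conforming simplicial meshes of $\overline\Omega$, shape-regular uniformly in $i$, with mesh size tending to $0$ and such that every open boundary face of the mesh lies in exactly one generalised face. Let $V_i$ be the continuous piecewise affine functions, $y$ the nodes, $\phi_y$ the hat functions, $\hat\phi_y=\phi_y/\|\phi_y\|_{L^1(\Omega)}$. Let $h_i=T/n_i$ with $n_i\in\mathbb N_{>0}$, $h_i\to0$, $s^k=kh_i$ and $S_i=\{s^0,\dots,s^{n_i}\}$. Let explicit coefficients $\bar a_i^\alpha,\bar b_i^\alpha,\bar c_i^\alpha$, implicit coefficients $\bar{\bar a}_i^\alpha,\bar{\bar b}_i^\alpha,\bar{\bar c}_i^\alpha$ and $f_i^\alpha$ be given in $C(\overline\Omega)$, and boundary coefficients $\bar b_{\partial,i}^\alpha,\bar c_{\partial,i}^\alpha,\bar{\bar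 b}_{\partial,i}^\alpha,\bar{\bar c}_{\partial,i}^\alpha,g_i^\alpha$ in $PC(\partial\Omega)$, all depending continuously on $\alpha$. For $w\in V_i$ and a node $y$ let $$(\mathsf E_i^\alpha w)_y=\begin{cases}\bar a_i^\alpha(y)\langle\nabla w,\nabla\hat\phi_y\rangle+\langle-\bar b_i^\alpha\cdot\nabla w+\bar c_i^\alpha w,\hat\phi_y\rangle& y\in\Omega,\\ \partial_{-\bar b_{\partial,i}^\alpha(y)}w(y)+\bar c_{\partial,i}^\alpha(y)w(y)& y\in\partial\Omega_t\cup\partial\Omega_R,\\ 0& y\in\partial\Omega_D,\end{cases}$$ where $\langle\cdot,\cdot\rangle$ is the $L^2(\Omega)$ inner product and $\partial_{-p}w(y)=\lim_{\lambda\downarrow0}(w(y)-w(y+\lambda p))/\lambda$. Let $\mathsf I_i^\alpha$ be defined in the same way with the implicit coefficients, except that $(\mathsf I_i^\alpha w)_y=w(y)$ for $y\in\partial\Omega_D$, and let $(\mathsf F_i^\alpha)_y$ be $\langle f_i^\alpha,\hat\phi_y\rangle$, $g_i^\alpha(y)$, $g(y)$ for $y$ in $\Omega$, $\partial\Omega_t\cup\partial\Omega_R$,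 $\partial\Omega_D$. Let $(d_iv(s^k))_y=(v(s^{k+1},y)-v(s^k,y))/h_i$ for $y\in\Omega\cup\partial\Omega_t$ and $0$ for the other nodes. A numerical solution $v_i:S_i\to V_i$ is one for which $v_i(T,\cdot)$ is the nodal interpolant of $v_T$ and, for $k=n_i-1,\dots,0$ and every node, $$-d_iv_i(s^k,\cdot)+\sup_{\alpha\in A}\bigl(\mathsf E_i^\alpha v_i(s^{k+1},\cdot)+\mathsf I_i^\alpha v_i(s^k,\cdot)-\mathsf F_i^\alpha\bigr)=0 .$$ **Assumptions.** 1. As $i\to\infty$, uniformly in $\alpha$: $a^\alpha-(\bar a_i^\alpha(y)+\bar{\bar a}_i^\alpha(y))\to0$ uniformly on $\operatorname{supp}\hat\phi_y$ and over the nodes $y\notin\partial\Omega_D$; $\bar b_i^\alpha+\bar{\bar b}_i^\alpha\to b^\alpha$, $\bar c_i^\alpha+\bar{\bar c}_i^\alpha\to c^\alpha$, $f_i^\alpha\to f^\alpha$ uniformly on $\overline\Omega$; $\bar b_{\partial,i}^\alpha+\bar{\bar b}_{\partial,i}^\alpha\to b_{\partial\Omega}^\alpha$, $\bar c_{\partial,i}^\alpha+\bar{\bar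 c}_{\partial,i}^\alpha\to c_{\partial\Omega}^\alpha$, $g_i^\alpha\to g^\alpha$ uniformly on $\partial\Omega$. On $\partial\Omega_R$: $\bar a_i^\alpha=\bar c_i^\alpha=\bar c_{\partial,i}^\alpha=0$, $\bar b_i^\alpha=\bar b_{\partial,i}^\alpha=0$, $\bar{\bar c}_{\partial,i}^\alpha>0$. The functions $\bar c_i^\alpha,\bar{\bar c}_i^\alpha,\bar c_{\partial,i}^\alpha,\bar{\bar c}_{\partial,i}^\alpha,f_i^\alpha,g_i^\alpha$ are non-negative; $\bar b_{\partial,i}^\alpha(y),\bar{\bar b}_{\partial,i}^\alpha(y)\in K(y)$ at the nodes $y\in\partial\Omega_t\cup\partial\Omega_R$; and $\bar b_{\partial,i}^\alpha,\bar{\bar b}_{\partial,i}^\alpha$ are bounded on $\partial\Omega_t$ uniformly in $i$ and $\alpha$. 2. For each $i$ there is $\theta\in(0,\pi/2)$ with $\nabla\phi_y\cdot\nabla\phi_z\le-\sin\theta\,|\nabla\phi_y|\,|\nabla\phi_z|$ on every element, for all nodes $y\ne z$; and for every $\alpha$ and interior node $y$ there are numbers $0\le\bar\nu\le\bar a_i^\alpha(y)$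 and $0\le\bar{\bar\nu}\le\bar{\bar a}_i^\alpha(y)$ such that on every element $K$ with vertex $y$ $$|\bar b_i^\alpha|_K+\operatorname{diam}(K)\|\bar c_i^\alpha\|_{L^\infty(K)}\le\bar\nu\sin\theta\,|\nabla\hat\phi_y|_K\operatorname{vol}(K),\qquad |\bar{\bar b}_i^\alpha|_K+\operatorname{diam}(K)\|\bar{\bar c}_i^\alpha\|_{L^\infty(K)}\le\bar{\bar\nu}\sin\theta\,|\nabla\hat\phi_y|_K\operatorname{vol}(K),$$ where $|u|_K=(\sum_j\|u_j\|_{L^\infty(K)}^2)^{1/2}$. The time steps are small enough that the explicit part is monotone: $h_i(\mathsf E_i^\alpha\phi_y)_y\le1$ for all $i$, $\alpha$ and nodes $y\in\Omega\cup\partial\Omega_t$. 3. There are linear maps $P_i$ from $C^\infty(\mathbb R^d)$ to $V_i$ with $\langle\nabla P_iw,\nabla\hat\phi_y\rangle=\langle\nabla w,\nabla\hat\phi_y\rangle$ for all interior nodes $y$, $\|P_iw\|_{W^{1,\infty}(\Omega)}\le C\|w\|_{W^{1,\infty}(\Omega)}$ with $C$ independent of $i$ and $w$, and $\|P_iw-w\|_{W^{1,\infty}(\Omega)}\to0$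 for each $w$. 4. There are $\alpha\in A$, $\varepsilon>0$ and $w\in C^2(\mathbb R\times\mathbb R^d)$ such that $-\partial_tw+L^\alpha w-f^\alpha\ge\varepsilon$ on $[0,T)\times\Omega$, $-\partial_tw+L^\alpha_{\partial\Omega}w-g^\alpha\ge\varepsilon$ on $[0,T)\times\partial\Omega_t$, $L^\alpha_{\partial\Omega}w-g^\alpha\ge\varepsilon$ on $[0,T)\times\partial\Omega_R$, $w-g\ge\varepsilon$ on $[0,T)\times\partial\Omega_D$ and $w-v_T\ge\varepsilon$ on $\{T\}\times\overline\Omega$. **Theorem.** Under these assumptions the numerical solutions $v_i$ are bounded uniformly in $i$: there is a finite constant $C>0$ such that $$\|v_i\|_{L^\infty(S_i\times\overline\Omega)}\le C\qquad\text{for all } i\in\mathbb N.$$ -/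

import Mathlib

open Set Filter Topology MeasureTheory
open scoped ENNReal

noncomputable section

namespace BellmanFEM

/-- The Euclidean space `ℝ^d`. -/
abbrev Sp (d : ℕ) : Type := EuclideanSpace ℝ (Fin d)

/-! ### The domain and the boundary regions -/

/-- The points of the boundary of `D` near which the boundary is a piece of a hyperplane. -/
def flatBoundary {d : ℕ} (D : Set (Sp d)) : Set (Sp d) :=
  {x | x ∈ frontier D ∧ ∃ n : Sp d, n ≠ 0 ∧ ∀ᶠ y in 𝓝 x, (y ∈ frontier D ↔ inner ℝ n (y - x) = 0)}

/-- The open `(d-1)`-dimensional faces of `D`: the connected components of the flat part of the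
boundary. -/
def openFaces {d : ℕ} (D : Set (Sp d)) : Set (Set (Sp d)) :=
  {ω | ∃ x ∈ flatBoundary D, ω = connectedComponentIn (flatBoundary D) x}

/-- The tangent cone `K(x)`: directions in which a line segment issuing from `x` stays in `D`. -/
def tangentDirections {d : ℕ} (D : Set (Sp d)) (x : Sp d) : Set (Sp d) :=
  {p | ∃ Λ : ℝ, 0 < Λ ∧ ∀ r ∈ Icc (0 : ℝ) Λ, x + r • p ∈ D}

/-- A bounded connected closed domain `cl = Ω̄` with interior `Ω`, whose boundary is split into the
Robin part with time derivative `bdT`, the Robin part without time derivative `bdR` and the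
Dirichlet part `bdD`. (That `Ω̄` is a polytope is expressed by the meshes, which triangulate it.) -/
structure MixedDomain (d : ℕ) where
  cl : Set (Sp d)
  bdT : Set (Sp d)
  bdR : Set (Sp d)
  bdD : Set (Sp d)
  isCompact_cl : IsCompact cl
  isConnected_cl : IsConnected cl
  nonempty_interior : (interior cl).Nonempty
  disjoint_TR : Disjoint bdT bdR
  disjoint_TD : Disjoint bdT bdD
  disjoint_RD : Disjoint bdR bdD
  union_eq : bdT ∪ bdR ∪ bdD = frontier cl

/-- The generalised faces: intersections of an open face with one of the boundary regions. -/
def MixedDomain.genFaces {d : ℕ} (G : MixedDomain d) : Set (Set (Sp d)) :=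
  {ω | ∃ ω' ∈ openFaces G.cl, ω = ω' ∩ G.bdD ∨ ω = ω' ∩ G.bdR ∨ ω = ω' ∩ G.bdT}

/-- `α ↦ u α` is a continuous map from `A` into `C(Ω̄, F)`. Since `A` and `Ω̄` are compact, this is
joint continuity, and the family `u α` is then equicontinuous. -/
def MixedDomain.CFamily {d : ℕ} (G : MixedDomain d) {A F : Type*} [TopologicalSpace A]
    [TopologicalSpace F] (u : A → Sp d → F) : Prop :=
  ContinuousOn (fun p : A × Sp d => u p.1 p.2) (univ ×ˢ G.cl)

/-- `α ↦ u α` is a continuous map from `A` into the piecewise continuous functions `PC(∂Ω, F)`: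
bounded functions on `∂Ω` which are continuous on each generalised face, with the supremum norm. -/
structure MixedDomain.PCFamily {d : ℕ} (G : MixedDomain d) {A F : Type*} [TopologicalSpace A]
    [NormedAddCommGroup F] (u : A → Sp d → F) : Prop where
  bounded : ∀ α, ∃ B : ℝ, ∀ x ∈ frontier G.cl, ‖u α x‖ ≤ B
  continuousOn : ∀ α, ∀ ω ∈ G.genFaces, ContinuousOn (u α) ω
  continuous_control : ∀ α, TendstoUniformlyOn u (u α) (𝓝 α) (frontier G.cl)

/-! ### The Bellman problem -/

/-- The data of the final time boundary value problem
`-∂ₜv + sup (Lᵅv - fᵅ) = 0` in `[0,T) × Ω`, `-∂ₜv + sup (Lᵅ_∂ v - gᵅ) = 0` on `[0,T) × bdT`,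
`sup (Lᵅ_∂ v - gᵅ) = 0` on `[0,T) × bdR`, `v = g` on `[0,T) × bdD`, `v(T) = v_T`, where
`Lᵅv = -aᵅ Δv - bᵅ·∇v + cᵅ v` and `Lᵅ_∂ v = -bBᵅ·∇v + cBᵅ v` (and `gᵅ` is `gB α`). -/
structure BellmanProblem (d : ℕ) (A : Type*) [TopologicalSpace A] extends MixedDomain d where
  T : ℝ
  a : A → Sp d → ℝ
  b : A → Sp d → Sp d
  c : A → Sp d → ℝ
  f : A → Sp d → ℝ
  bB : A → Sp d → Sp d
  cB : A → Sp d → ℝ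
  gB : A → Sp d → ℝ
  g : Sp d → ℝ
  vT : Sp d → ℝ
  T_pos : 0 < T
  a_cont : toMixedDomain.CFamily a
  b_cont : toMixedDomain.CFamily b
  c_cont : toMixedDomain.CFamily c
  f_cont : toMixedDomain.CFamily f
  bB_pc : toMixedDomain.PCFamily bB
  cB_pc : toMixedDomain.PCFamily cB
  gB_pc : toMixedDomain.PCFamily gB
  g_cont : ContinuousOn g (frontier cl)
  vT_cont : ContinuousOn vT cl
  a_nonneg : ∀ α, ∀ x ∈ cl, 0 ≤ a α x
  c_nonneg : ∀ α, ∀ x ∈ cl, 0 ≤ c α x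
  cB_nonneg : ∀ α, ∀ x ∈ frontier cl, 0 ≤ cB α x
  gB_nonneg : ∀ α, ∀ x ∈ frontier cl, 0 ≤ gB α x
  g_nonneg : ∀ x ∈ frontier cl, 0 ≤ g x
  vT_nonneg : ∀ x ∈ cl, 0 ≤ vT x
  vT_eq_g : ∀ x ∈ bdD, vT x = g x
  bB_cone : ∀ α, ∀ x ∈ frontier cl, bB α x ∈ tangentDirections cl x

open Classical in
/-- The operator `Fᵅ(t, x, q, p, r, s)` of the linear problem with fixed control `α`; the arguments
`q, p, r, s` stand for `Δw`, `∇w`, `∂ₜw` and `w`. -/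
def BellmanProblem.linOp {d : ℕ} {A : Type*} [TopologicalSpace A] (pb : BellmanProblem d A)
    (α : A) (t : ℝ) (x : Sp d) (q : ℝ) (p : Sp d) (r s : ℝ) : ℝ :=
  if t = pb.T then s - pb.vT x
  else if x ∈ pb.bdD then s - pb.g x
  else if x ∈ pb.bdR then (-inner ℝ (pb.bB α x) p + pb.cB α x * s) - pb.gB α x
  else if x ∈ pb.bdT then -r + (-inner ℝ (pb.bB α x) p + pb.cB α x * s) - pb.gB α x
  else -r + (-(pb.a α x * q) - inner ℝ (pb.b α x) p + pb.c α x * s) - pb.f α x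

/-- For some control `α` the linear problem has a strict supersolution `w ∈ C²(ℝ × ℝ^d)`. -/
def BellmanProblem.HasStrictSupersolution {d : ℕ} {A : Type*} [TopologicalSpace A]
    (pb : BellmanProblem d A) : Prop :=
  ∃ (α : A) (w : ℝ × Sp d → ℝ) (ε : ℝ), ContDiff ℝ 2 w ∧ 0 < ε ∧
    ∀ t ∈ Icc (0 : ℝ) pb.T, ∀ x ∈ pb.cl,
      ε ≤ pb.linOp α t x (Laplacian.laplacian (fun y => w (t, y)) x)
        (gradient (fun y => w (t, y)) x) (deriv (fun τ => w (τ, x)) t) (w (t, x))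

/-! ### Simplicial meshes and P1 finite elements -/

/-- A (conforming, simplicial) mesh. Elements are the convex hulls of the faces with `d + 1`
vertices, nodes are the vertices. -/
abbrev Mesh (d : ℕ) : Type := Geometry.SimplicialComplex ℝ (Sp d)

/-- The elements, given by their vertex sets. -/
def elements {d : ℕ} (K : Mesh d) : Set (Finset (Sp d)) := {s | s ∈ K.faces ∧ s.card = d + 1}

/-- The closed simplex spanned by `s`. -/
def simplex {d : ℕ} (s : Finset (Sp d)) : Set (Sp d) := convexHull ℝ (s : Set (Sp d))

/-- The largest diameter of an element. -/
def meshSize {d : ℕ} (K : Mesh d) : ℝ := sSup ((fun s => Metric.diam (simplex s)) '' elements K)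

/-- `K` is a finite mesh of `Ω̄` consisting of `d`-simplices and their faces. -/
structure IsMeshOf {d : ℕ} (K : Mesh d) (D : Set (Sp d)) : Prop where
  finite : K.faces.Finite
  space_eq : K.space = D
  pure : ∀ s ∈ K.faces, ∃ t ∈ elements K, s ⊆ t

/-- The boundary mesh is subordinate to the generalised faces: each open boundary face of the mesh
lies in exactly one generalised face. -/
def IsSubordinate {d : ℕ} (K : Mesh d) (G : MixedDomain d) : Prop :=
  ∀ s ∈ K.faces, s.card = d → simplex s ⊆ frontier G.cl →
    ∃! ω, ω ∈ G.genFaces ∧ intrinsicInterior ℝ (simplex s) ⊆ ω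

/-- The P1 finite element space: functions on `Ω̄` (extended by `0` to `ℝ^d`) which are affine on
each closed simplex of the mesh. -/
def P1 {d : ℕ} (K : Mesh d) : Submodule ℝ (Sp d → ℝ) where
  carrier := {v | (∀ s ∈ K.faces, ∃ L : Sp d →ᵃ[ℝ] ℝ, EqOn v L (simplex s)) ∧
    ∀ x, x ∉ K.space → v x = 0}
  zero_mem' := ⟨fun _ _ => ⟨0, fun _ _ => rfl⟩, fun _ _ => rfl⟩
  add_mem' := by
    rintro u v ⟨hu, hu'⟩ ⟨hv, hv'⟩
    refine ⟨fun s hs => ?_, fun x hx => by simp [hu' x hx, hv' x hx]⟩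
    obtain ⟨L, hL⟩ := hu s hs
    obtain ⟨M, hM⟩ := hv s hs
    exact ⟨L + M, fun x hx => by simp [hL hx, hM hx]⟩
  smul_mem' := by
    rintro r v ⟨hv, hv'⟩
    refine ⟨fun s hs => ?_, fun x hx => by simp [hv' x hx]⟩
    obtain ⟨M, hM⟩ := hv s hs
    exact ⟨r • M, fun x hx => by simp [hM hx]⟩

/-- `w` are the barycentric coordinates of `x` in the simplex with vertex set `s`, extended by `0`
to the other points. -/
def IsBarycentric {d : ℕ} (s : Finset (Sp d)) (x : Sp d) (w : Sp d → ℝ) : Prop :=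
  (∀ y ∈ s, 0 ≤ w y) ∧ (∀ y, y ∉ s → w y = 0) ∧ ∑ y ∈ s, w y = 1 ∧ ∑ y ∈ s, w y • y = x

open Classical in
/-- The hat function of the node `y`: the P1 function which is `1` at `y` and `0` at the other
nodes. Its value at `x` is the barycentric coordinate of `x` belonging to `y`, in any simplex of the
mesh that contains `x`. -/
def hat {d : ℕ} (K : Mesh d) (y x : Sp d) : ℝ :=
  if h : ∃ w : Sp d → ℝ, ∃ s ∈ K.faces, IsBarycentric s x w then h.choose y else 0

/-- The hat function normalised in `L¹(Ω)`. -/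
def nhat {d : ℕ} (K : Mesh d) (y x : Sp d) : ℝ := hat K y x / ∫ z in K.space, |hat K y z|

/-- Strict acuteness with angle `θ` (gradients of hat functions are constant inside elements). -/
def StrictlyAcute {d : ℕ} (K : Mesh d) (θ : ℝ) : Prop :=
  ∀ y ∈ K.vertices, ∀ z ∈ K.vertices, y ≠ z → ∀ s ∈ elements K, ∀ x ∈ interior (simplex s),
    inner ℝ (gradient (hat K y) x) (gradient (hat K z) x) ≤
      -Real.sin θ * ‖gradient (hat K y) x‖ * ‖gradient (hat K z) x‖

/-- The supremum of `|u|` over `S`. -/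
def supOn {d : ℕ} (S : Set (Sp d)) (u : Sp d → ℝ) : ℝ := ⨆ x : S, |u x|

/-- `|u|_S = (∑ⱼ ‖uⱼ‖²_{L^∞(S)})^{1/2}`. -/
def vecSupOn {d : ℕ} (S : Set (Sp d)) (u : Sp d → Sp d) : ℝ :=
  √(∑ j : Fin d, supOn S (fun x => u x j) ^ 2)

/-- The one-sided directional derivative
`∂_{-p} w (y) = lim_{r ↓ 0} (w y - w (y + r p)) / r`. -/
def diniDeriv {d : ℕ} (p : Sp d) (w : Sp d → ℝ) (y : Sp d) : ℝ :=
  limUnder (𝓝[>] (0 : ℝ)) (fun r : ℝ => (w y - w (y + r • p)) / r)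

/-- The norm of `W^{1,∞}(Ω)`, for functions that are differentiable almost everywhere in `Ω` and
Lipschitz continuous there. -/
def w1infNorm {d : ℕ} (D : Set (Sp d)) (w : Sp d → ℝ) : ℝ≥0∞ :=
  eLpNorm w ∞ (volume.restrict D) + eLpNorm (gradient w) ∞ (volume.restrict D)

/-- `C^∞(ℝ^d)`. -/
def smoothFunctions (d : ℕ) : Submodule ℝ (Sp d → ℝ) where
  carrier := {w | ContDiff ℝ ((⊤ : ℕ∞) : WithTop ℕ∞) w}
  zero_mem' := by
    simp only [Set.mem_ofPred_eq]
    exact contDiff_const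
  add_mem' := by
    intro u v hu hv
    simp only [Set.mem_ofPred_eq] at hu hv ⊢
    exact hu.add hv
  smul_mem' := by
    intro r v hv
    simp only [Set.mem_ofPred_eq] at hv ⊢
    exact contDiff_const.smul hv

/-! ### The numerical scheme -/

/-- A sequence of meshes, time grids and coefficients of the IMEX scheme. The suffix `E` marks
coefficients of the explicit part, `I` of the implicit part; `bBE, cBE, bBI, cBI` belong to the
boundary operators, `fh` and `gh` approximate `fᵅ` and `gᵅ`. -/
structure Discretisation {d : ℕ} {A : Type*} [TopologicalSpace A] (pb : BellmanProblem d A) where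
  mesh : ℕ → Mesh d
  /-- the number `T / h_i` of time steps -/
  n : ℕ → ℕ
  aE : ℕ → A → Sp d → ℝ
  aI : ℕ → A → Sp d → ℝ
  bE : ℕ → A → Sp d → Sp d
  bI : ℕ → A → Sp d → Sp d
  cE : ℕ → A → Sp d → ℝ
  cI : ℕ → A → Sp d → ℝ
  fh : ℕ → A → Sp d → ℝ
  bBE : ℕ → A → Sp d → Sp d
  bBI : ℕ → A → Sp d → Sp d
  cBE : ℕ → A → Sp d → ℝ
  cBI : ℕ → A → Sp d → ℝ
  gh : ℕ → A → Sp d → ℝ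
  isMesh : ∀ i, IsMeshOf (mesh i) pb.cl
  subordinate : ∀ i, IsSubordinate (mesh i) pb.toMixedDomain
  shapeRegular : ∃ σ : ℝ, 0 < σ ∧ ∀ i, ∀ s ∈ elements (mesh i),
    ∃ x, Metric.ball x (σ * Metric.diam (simplex s)) ⊆ simplex s
  meshSize_tendsto : Tendsto (fun i => meshSize (mesh i)) atTop (𝓝 0)
  n_pos : ∀ i, 0 < n i
  timeStep_tendsto : Tendsto (fun i => pb.T / n i) atTop (𝓝 0)

namespace Discretisation

variable {d : ℕ} {A : Type*} [TopologicalSpace A] {pb : BellmanProblem d A}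

/-- The time step size `h_i`; the time steps are `k h_i`, `0 ≤ k ≤ n i`. -/
def h (S : Discretisation pb) (i : ℕ) : ℝ := pb.T / S.n i

/-- The integral over `Ω`. -/
def integ (_S : Discretisation pb) (u : Sp d → ℝ) : ℝ := ∫ x in pb.cl, u x

/-- The discretisation at the interior node `y` of `w ↦ -a Δw - b·∇w + c w`, namely
`a(y) ⟨∇w, ∇φ̂⟩ + ⟨-b·∇w + c w, φ̂⟩`. -/
def interiorOp (S : Discretisation pb) (i : ℕ) (a : Sp d → ℝ) (b : Sp d → Sp d) (c : Sp d → ℝ)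
    (w : Sp d → ℝ) (y : Sp d) : ℝ :=
  a y * S.integ (fun x => inner ℝ (gradient w x) (gradient (nhat (S.mesh i) y) x)) +
    S.integ (fun x => (-inner ℝ (b x) (gradient w x) + c x * w x) * nhat (S.mesh i) y x)

open Classical in
/-- The explicit operator, at the node `y`. -/
def opE (S : Discretisation pb) (i : ℕ) (α : A) (w : Sp d → ℝ) (y : Sp d) : ℝ :=
  if y ∈ interior pb.cl then S.interiorOp i (S.aE i α) (S.bE i α) (S.cE i α) w y
  else if y ∈ pb.bdD then 0
  else diniDeriv (S.bBE i α y) w y + S.cBE i α y * w y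

open Classical in
/-- The implicit operator, at the node `y`. -/
def opI (S : Discretisation pb) (i : ℕ) (α : A) (w : Sp d → ℝ) (y : Sp d) : ℝ :=
  if y ∈ interior pb.cl then S.interiorOp i (S.aI i α) (S.bI i α) (S.cI i α) w y
  else if y ∈ pb.bdD then w y
  else diniDeriv (S.bBI i α y) w y + S.cBI i α y * w y

open Classical in
/-- The right-hand side, at the node `y`. -/
def rhs (S : Discretisation pb) (i : ℕ) (α : A) (y : Sp d) : ℝ :=
  if y ∈ interior pb.cl then S.integ (fun x => S.fh i α x * nhat (S.mesh i) y x)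
  else if y ∈ pb.bdD then pb.g y
  else S.gh i α y

open Classical in
/-- The discrete time derivative `d_i v` at time step `k` and node `y`; it is `0` on the Robin
boundary without time derivative and on the Dirichlet boundary. -/
def timeDiff (S : Discretisation pb) (i : ℕ) (v : ℕ → Sp d → ℝ) (k : ℕ) (y : Sp d) : ℝ :=
  if y ∈ interior pb.cl ∪ pb.bdT then (v (k + 1) y - v k y) / S.h i else 0

/-- `v k = v_i(k h_i, ·)`, `0 ≤ k ≤ n i`, is a numerical solution at refinement level `i`: each
`v k` is a P1 function, `v (n i)` interpolates `v_T`, and at each earlier time step and at each node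
`-d_i v + sup_α (E^α v(k+1) + I^α v(k) - F^α) = 0`. -/
structure IsNumericalSolution (S : Discretisation pb) (i : ℕ) (v : ℕ → Sp d → ℝ) : Prop where
  mem : ∀ k ≤ S.n i, v k ∈ P1 (S.mesh i)
  final : ∀ y ∈ (S.mesh i).vertices, v (S.n i) y = pb.vT y
  step : ∀ k < S.n i, ∀ y ∈ (S.mesh i).vertices,
    IsLUB (range fun α : A => S.opE i α (v (k + 1)) y + S.opI i α (v k) y - S.rhs i α y)
      (S.timeDiff i v k y)

/-- The assumptions on the coefficients of the scheme: regularity in space and in the control,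
sign conditions, admissible directions of the boundary drifts, full implicitness on `bdR`, and
consistency with the coefficients of the Bellman problem. -/
structure ConsistentCoefficients (S : Discretisation pb) : Prop where
  aE_cont : ∀ i, pb.CFamily (S.aE i)
  aI_cont : ∀ i, pb.CFamily (S.aI i)
  bE_cont : ∀ i, pb.CFamily (S.bE i)
  bI_cont : ∀ i, pb.CFamily (S.bI i)
  cE_cont : ∀ i, pb.CFamily (S.cE i)
  cI_cont : ∀ i, pb.CFamily (S.cI i)
  fh_cont : ∀ i, pb.CFamily (S.fh i)
  bBE_pc : ∀ i, pb.PCFamily (S.bBE i)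
  bBI_pc : ∀ i, pb.PCFamily (S.bBI i)
  cBE_pc : ∀ i, pb.PCFamily (S.cBE i)
  cBI_pc : ∀ i, pb.PCFamily (S.cBI i)
  gh_pc : ∀ i, pb.PCFamily (S.gh i)
  cE_nonneg : ∀ i α, ∀ x ∈ pb.cl, 0 ≤ S.cE i α x
  cI_nonneg : ∀ i α, ∀ x ∈ pb.cl, 0 ≤ S.cI i α x
  fh_nonneg : ∀ i α, ∀ x ∈ pb.cl, 0 ≤ S.fh i α x
  cBE_nonneg : ∀ i α, ∀ x ∈ frontier pb.cl, 0 ≤ S.cBE i α x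
  cBI_nonneg : ∀ i α, ∀ x ∈ frontier pb.cl, 0 ≤ S.cBI i α x
  gh_nonneg : ∀ i α, ∀ x ∈ frontier pb.cl, 0 ≤ S.gh i α x
  /-- the one-sided derivatives in the scheme are taken along segments inside `Ω̄` -/
  cone : ∀ i α, ∀ y ∈ (S.mesh i).vertices, y ∈ pb.bdT ∪ pb.bdR →
    S.bBE i α y ∈ tangentDirections pb.cl y ∧ S.bBI i α y ∈ tangentDirections pb.cl y
  /-- the two parts of the boundary drift are bounded independently of `i` and `α` -/
  bB_bounded : ∃ B : ℝ, ∀ i α, ∀ x ∈ pb.bdT, ‖S.bBE i α x‖ ≤ B ∧ ‖S.bBI i α x‖ ≤ B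
  implicit_R : ∀ i α, ∀ x ∈ pb.bdR, S.aE i α x = 0 ∧ S.bE i α x = 0 ∧ S.cE i α x = 0 ∧
    S.bBE i α x = 0 ∧ S.cBE i α x = 0 ∧ 0 < S.cBI i α x
  consistent_a : ∀ ε > 0, ∀ᶠ i in atTop, ∀ α, ∀ y ∈ (S.mesh i).vertices, y ∉ pb.bdD →
    ∀ x ∈ tsupport (nhat (S.mesh i) y), |pb.a α x - (S.aE i α y + S.aI i α y)| ≤ ε
  consistent_interior : ∀ ε > 0, ∀ᶠ i in atTop, ∀ α, ∀ x ∈ pb.cl,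
    ‖pb.b α x - (S.bE i α x + S.bI i α x)‖ ≤ ε ∧ |pb.c α x - (S.cE i α x + S.cI i α x)| ≤ ε ∧
      |pb.f α x - S.fh i α x| ≤ ε
  consistent_boundary : ∀ ε > 0, ∀ᶠ i in atTop, ∀ α, ∀ x ∈ frontier pb.cl,
    ‖pb.bB α x - (S.bBE i α x + S.bBI i α x)‖ ≤ ε ∧
      |pb.cB α x - (S.cBE i α x + S.cBI i α x)| ≤ ε ∧ |pb.gB α x - S.gh i α x| ≤ ε

/-- The mesh is strictly acute and the second-order coefficients at interior nodes dominate
artificial diffusion coefficients `νE`, `νI` that balance the lower order terms. -/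
def ArtificialDiffusion (S : Discretisation pb) : Prop :=
  ∀ i, ∃ θ ∈ Ioo (0 : ℝ) (Real.pi / 2), StrictlyAcute (S.mesh i) θ ∧
    ∀ α, ∀ y ∈ (S.mesh i).vertices, y ∈ interior pb.cl →
      ∃ νE νI : ℝ, 0 ≤ νE ∧ 0 ≤ νI ∧ νE ≤ S.aE i α y ∧ νI ≤ S.aI i α y ∧
        ∀ s ∈ elements (S.mesh i), y ∈ s → ∀ x ∈ interior (simplex s),
          vecSupOn (simplex s) (S.bE i α) +
              Metric.diam (simplex s) * supOn (simplex s) (S.cE i α) ≤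
            νE * Real.sin θ * ‖gradient (nhat (S.mesh i) y) x‖ * volume.real (simplex s) ∧
          vecSupOn (simplex s) (S.bI i α) +
              Metric.diam (simplex s) * supOn (simplex s) (S.cI i α) ≤
            νI * Real.sin θ * ‖gradient (nhat (S.mesh i) y) x‖ * volume.real (simplex s)

/-- The time step restriction: the diagonal entries of `h_i E^α - Id` on `Ω ∪ bdT` are
non-positive. -/
def TimeStepRestriction (S : Discretisation pb) : Prop :=
  ∀ i α, ∀ y ∈ (S.mesh i).vertices, y ∈ interior pb.cl ∪ pb.bdT →
    S.h i * S.opE i α (hat (S.mesh i) y) y ≤ 1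

/-- Existence of elliptic projections `P_i` onto the finite element spaces which are stable and
convergent in `W^{1,∞}(Ω)`. -/
def HasEllipticProjections (S : Discretisation pb) : Prop :=
  ∃ P : ∀ i, smoothFunctions d →ₗ[ℝ] P1 (S.mesh i),
    (∀ i (w : smoothFunctions d), ∀ y ∈ (S.mesh i).vertices, y ∈ interior pb.cl →
      S.integ (fun x => inner ℝ (gradient (P i w : Sp d → ℝ) x)
          (gradient (nhat (S.mesh i) y) x)) =
        S.integ (fun x => inner ℝ (gradient (w : Sp d → ℝ) x)
          (gradient (nhat (S.mesh i) y) x))) ∧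
    (∃ C : NNReal, ∀ i (w : smoothFunctions d),
      w1infNorm pb.cl (P i w : Sp d → ℝ) ≤ C * w1infNorm pb.cl (w : Sp d → ℝ)) ∧
    ∀ w : smoothFunctions d,
      Tendsto (fun i => w1infNorm pb.cl ((P i w : Sp d → ℝ) - (w : Sp d → ℝ))) atTop (𝓝 0)

end Discretisation

end BellmanFEM

end

namespace BellmanFEM

variable {d : ℕ} {K : Mesh d} {s t : Finset (Sp d)} {x y z : Sp d} {D : Set (Sp d)}
  {w w' : Sp d → ℝ} {u v : Sp d → ℝ}

/-! ### Barycentric coordinates and hat functions -/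

/-! The scheme is monotone, and this yields both bounds by discrete minimum principles. Acuteness of
the mesh makes the gradients of different hat functions point away from each other, and the
artificial diffusion is strong enough to dominate the drift and reaction terms on every element
(`elementOp_nonpos`). Hence a finite element function that is nonnegative at the nodes and vanishes
at a node is mapped to a nonpositive value there (`MonotoneCoefficients.nonpos`). At boundary nodes
the one-sided derivatives have the same property. Together with the time step restriction and the
nonnegativity of the data, this gives `v_i ≥ 0` by backward induction in time
(`IsNumericalSolution.nonneg`).

For the upper bound only the single control `α` of the strict supersolution `w` is needed, since the
supremum over controls dominates the expression for `α`. The elliptic projections act on smooth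
functions of space alone, so time is frozen: near a time `τ`, the function `w` is replaced by `u +
(t - τ) r`, where `u` and `r` are mollifications of `w(τ, ·)` and `∂ₜw(τ, ·)`. Their projections `U`
and `R` give the barrier `U + (t - τ) R + C`, whose discrete time derivative is exactly `R`. Because
the zeroth order coefficients are nonnegative, adding `C ≥ 0` only helps, so `C` may be taken large
enough to dominate Dirichlet data and bounds already obtained at later times.

Consistency rests on Green's formula for hat functions of interior nodes
(`integral_inner_gradient_nhat`): it turns the discrete operator applied to a projection into a
local average of the differential operator. The explicit part sees the barrier one time step later,
which produces the extra term `h_i E_i R`. It tends to zero in the interior because the time step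
restriction also controls the drift, `h_i |b| ≤ 2 diam` (`h_mul_norm_bE_le`), and on `bdT` because
the explicit boundary drift is bounded. So the strict inequality survives for `|t - τ| ≤ Δ` with a
`Δ > 0` independent of `i` and `C` (`exists_barrier`), and an upper bound known from some time `t ≤
τ + Δ` onwards extends back to `τ - Δ` (`exists_boundedAfter_step`).

Finally, let `τ` be the infimum of the times after which an upper bound holds for all large `i`. If
no such bound held on all of `[0, T]`, the step at this `τ` would contradict the infimum
(`boundedAfter_zero`). The finitely many remaining levels are bounded one by one. -/

theorem exists_isBarycentric (hx : x ∈ simplex s) : ∃ w, IsBarycentric s x w := by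
  classical
  obtain ⟨w, h0, h1, h2⟩ := Finset.mem_convexHull'.1 hx
  refine ⟨fun y => if y ∈ s then w y else 0, fun y hy => by simpa [hy] using h0 y hy,
    fun y hy => by simp [hy], ?_, ?_⟩
  · rw [← h1]; exact Finset.sum_congr rfl fun y hy => by simp [hy]
  · rw [← h2]; exact Finset.sum_congr rfl fun y hy => by simp [hy]

theorem IsBarycentric.mem_simplex (h : IsBarycentric s x w) : x ∈ simplex s :=
  Finset.mem_convexHull'.2 ⟨w, h.1, h.2.2.1, h.2.2.2⟩

theorem IsBarycentric.mono (h : IsBarycentric s x w) (hst : s ⊆ t) : IsBarycentric t x w := by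
  refine ⟨fun y _ => ?_, fun y hy => h.2.1 y fun h' => hy (hst h'), ?_, ?_⟩
  · by_cases hy : y ∈ s
    · exact h.1 y hy
    · exact (h.2.1 y hy).ge
  · rw [← h.2.2.1]
    exact (Finset.sum_subset hst fun y _ hy => h.2.1 y hy).symm
  · rw [← h.2.2.2]
    exact (Finset.sum_subset hst fun y _ hy => by simp [h.2.1 y hy]).symm

theorem IsBarycentric.nonneg (h : IsBarycentric s x w) (y : Sp d) : 0 ≤ w y := by
  by_cases hy : y ∈ s
  · exact h.1 y hy
  · exact (h.2.1 y hy).ge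

theorem IsBarycentric.unique (hs : AffineIndependent ℝ ((↑) : s → Sp d))
    (h : IsBarycentric s x w) (h' : IsBarycentric s x w') : w = w' := by
  have key := affineIndependent_iff.1 hs Finset.univ (fun y => w y - w' y)
    (by rw [Finset.sum_coe_sort s (fun y => w y - w' y), Finset.sum_sub_distrib, h.2.2.1,
          h'.2.2.1, sub_self])
    (by rw [Finset.sum_coe_sort s (fun y => (w y - w' y) • y)]
        simp only [sub_smul, Finset.sum_sub_distrib, h.2.2.2, h'.2.2.2, sub_self])
  funext y
  by_cases hy : y ∈ s
  · exact sub_eq_zero.1 (key ⟨y, hy⟩ (Finset.mem_univ _))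
  · rw [h.2.1 y hy, h'.2.1 y hy]

/-- Barycentric coordinates do not depend on the face that is used to compute them. -/
theorem IsBarycentric.unique_of_faces (hs : s ∈ K.faces) (ht : t ∈ K.faces)
    (h : IsBarycentric s x w) (h' : IsBarycentric t x w') : w = w' := by
  classical
  -- Conformity of the mesh: a common point lies in the hull of the common vertices, and coordinates
  -- there extend by zero to both faces.
  have hx : x ∈ simplex (s ∩ t) := by
    have := K.inter_subset_convexHull hs ht ⟨h.mem_simplex, h'.mem_simplex⟩
    rwa [← Finset.coe_inter] at this
  obtain ⟨w'', hw''⟩ := exists_isBarycentric hx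
  rw [h.unique (K.indep hs) (hw''.mono Finset.inter_subset_left),
    h'.unique (K.indep ht) (hw''.mono Finset.inter_subset_right)]

/-- Uniqueness of barycentric coordinates across faces makes the arbitrary choice in `hat` harmless;
every later computation with hat functions goes through this. -/
theorem hat_eq_of_isBarycentric (hs : s ∈ K.faces) (h : IsBarycentric s x w) (y : Sp d) :
    hat K y x = w y := by
  have hex : ∃ w : Sp d → ℝ, ∃ s ∈ K.faces, IsBarycentric s x w := ⟨w, s, hs, h⟩
  obtain ⟨t, ht, h'⟩ := hex.choose_spec
  rw [hat, dif_pos hex, IsBarycentric.unique_of_faces ht hs h' h]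

theorem hat_eq_zero_of_notMem_space (hx : x ∉ K.space) (y : Sp d) : hat K y x = 0 := by
  rw [hat, dif_neg]
  rintro ⟨w, s, hs, h⟩
  exact hx (K.convexHull_subset_space hs h.mem_simplex)

theorem isBarycentric_hat (hs : s ∈ K.faces) (hx : x ∈ simplex s) :
    IsBarycentric s x (fun y => hat K y x) := by
  obtain ⟨w, hw⟩ := exists_isBarycentric hx
  simpa only [hat_eq_of_isBarycentric hs hw] using hw

theorem hat_nonneg (K : Mesh d) (y x : Sp d) : 0 ≤ hat K y x := by
  by_cases hx : x ∈ K.space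
  · obtain ⟨s, hs, hxs⟩ := K.mem_space_iff.1 hx
    exact (isBarycentric_hat hs hxs).nonneg y
  · exact (hat_eq_zero_of_notMem_space hx y).ge

theorem hat_eq_zero_of_notMem (hs : s ∈ K.faces) (hx : x ∈ simplex s) (hy : y ∉ s) :
    hat K y x = 0 :=
  (isBarycentric_hat hs hx).2.1 y hy

theorem mem_simplex_of_mem (hy : y ∈ s) : y ∈ simplex s := subset_convexHull ℝ _ hy

theorem hat_self (hs : s ∈ K.faces) (hy : y ∈ s) : hat K y y = 1 := by
  have hv : {y} ∈ K.faces := K.down_closed hs (Finset.singleton_subset_iff.2 hy) (by simp)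
  simpa using (isBarycentric_hat hv (mem_simplex_of_mem (Finset.mem_singleton_self y))).2.2.1

theorem hat_of_ne (hs : s ∈ K.faces) (hz : z ∈ s) (hyz : y ≠ z) : hat K y z = 0 := by
  have hv : {z} ∈ K.faces := K.down_closed hs (Finset.singleton_subset_iff.2 hz) (by simp)
  exact hat_eq_zero_of_notMem hv (mem_simplex_of_mem (Finset.mem_singleton_self z)) (by simpa)

theorem mem_vertices_of_mem (hs : s ∈ K.faces) (hy : y ∈ s) : y ∈ K.vertices :=
  K.down_closed hs (Finset.singleton_subset_iff.2 hy) (by simp)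

theorem hat_self_of_mem_vertices (hy : y ∈ K.vertices) : hat K y y = 1 :=
  hat_self (s := {y}) hy (Finset.mem_singleton_self y)

/-! ### Elements -/

/-- The vertices of an element form an affine basis. -/
noncomputable def elementBasis (hs : s ∈ elements K) : AffineBasis s ℝ (Sp d) :=
  ⟨(↑), K.indep hs.1, by
    rw [(K.indep hs.1).affineSpan_eq_top_iff_card_eq_finrank_add_one]
    simp [hs.2]⟩

theorem elementBasis_apply (hs : s ∈ elements K) (z : s) : elementBasis hs z = z := rfl

theorem range_elementBasis (hs : s ∈ elements K) : range (elementBasis hs) = (s : Set (Sp d)) := by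
  ext z; simp [elementBasis_apply]

theorem simplex_eq_coord_nonneg (hs : s ∈ elements K) :
    simplex s = {x | ∀ z, 0 ≤ (elementBasis hs).coord z x} := by
  rw [simplex, ← range_elementBasis hs, AffineBasis.convexHull_eq_nonneg_coord]

theorem interior_simplex_eq_coord_pos (hs : s ∈ elements K) :
    interior (simplex s) = {x | ∀ z, 0 < (elementBasis hs).coord z x} := by
  rw [simplex, ← range_elementBasis hs, AffineBasis.interior_convexHull]

/-- The extension of the affine coordinate by zero to non-vertices is barycentric on the closed
element. This exhibits the hat function as affine there and gives strict positivity in the interior.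
-/
theorem hat_eq_coord (hs : s ∈ elements K) (hx : x ∈ simplex s) (hy : y ∈ s) :
    hat K y x = (elementBasis hs).coord ⟨y, hy⟩ x := by
  classical
  have h : IsBarycentric s x fun z => if h : z ∈ s then (elementBasis hs).coord ⟨z, h⟩ x else 0 := by
    rw [simplex_eq_coord_nonneg hs] at hx
    refine ⟨fun z hz => by simpa [hz] using hx ⟨z, hz⟩, fun z hz => by simp [hz], ?_, ?_⟩
    · rw [← Finset.sum_coe_sort, ← (elementBasis hs).sum_coord_apply_eq_one x]
      simp
    · rw [← Finset.sum_coe_sort s fun z => (if h : z ∈ s then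
        (elementBasis hs).coord ⟨z, h⟩ x else 0) • z]
      conv_rhs => rw [← (elementBasis hs).linear_combination_coord_eq_self x]
      simp [elementBasis_apply]
  rw [hat_eq_of_isBarycentric hs.1 h y, dif_pos hy]

theorem hat_pos_of_mem_interior (hs : s ∈ elements K) (hx : x ∈ interior (simplex s))
    (hy : y ∈ s) : 0 < hat K y x := by
  rw [hat_eq_coord hs (interior_subset hx) hy]
  rw [interior_simplex_eq_coord_pos hs] at hx
  exact hx _

theorem convex_simplex (s : Finset (Sp d)) : Convex ℝ (simplex s) := convex_convexHull ℝ _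

theorem isCompact_simplex (s : Finset (Sp d)) : IsCompact (simplex s) :=
  s.finite_toSet.isCompact_convexHull (𝕜 := ℝ)

theorem centroid_mem_interior (hs : s ∈ elements K) :
    Finset.univ.centroid ℝ (elementBasis hs) ∈ interior (simplex s) := by
  rw [simplex, ← range_elementBasis hs]
  exact (elementBasis hs).centroid_mem_interior_convexHull

theorem interior_simplex_nonempty (hs : s ∈ elements K) : (interior (simplex s)).Nonempty :=
  ⟨_, centroid_mem_interior hs⟩

theorem closure_interior_simplex (hs : s ∈ elements K) :
    closure (interior (simplex s)) = simplex s := by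
  rw [(convex_simplex s).closure_interior_eq_closure_of_nonempty_interior
    (interior_simplex_nonempty hs), (isCompact_simplex s).isClosed.closure_eq]

/-- Interiors of different elements do not meet. -/
theorem disjoint_interior_simplex (hs : s ∈ elements K) (ht : t ∈ elements K) (hst : s ≠ t) :
    Disjoint (interior (simplex s)) (interior (simplex t)) := by
  classical
  rw [Set.disjoint_left]
  intro x hxs hxt
  apply hst
  apply Finset.eq_of_subset_of_card_le
  · intro y hy
    by_contra hyt
    have := hat_pos_of_mem_interior hs hxs hy
    rw [hat_eq_zero_of_notMem ht.1 (interior_subset hxt) hyt] at this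
    exact lt_irrefl _ this
  · rw [hs.2, ht.2]

theorem IsMeshOf.exists_element (hK : IsMeshOf K D) (hx : x ∈ D) :
    ∃ s ∈ elements K, x ∈ simplex s := by
  rw [← hK.space_eq, K.mem_space_iff] at hx
  obtain ⟨s, hs, hxs⟩ := hx
  obtain ⟨t, ht, hst⟩ := hK.pure s hs
  exact ⟨t, ht, convexHull_mono (Finset.coe_subset.2 hst) hxs⟩

theorem IsMeshOf.exists_element_of_mem_vertices (hK : IsMeshOf K D) (hy : y ∈ K.vertices) :
    ∃ s ∈ elements K, y ∈ s := by
  obtain ⟨t, ht, hst⟩ := hK.pure {y} hy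
  exact ⟨t, ht, hst (Finset.mem_singleton_self y)⟩

theorem IsMeshOf.simplex_subset (hK : IsMeshOf K D) (hs : s ∈ elements K) : simplex s ⊆ D := by
  rw [← hK.space_eq]; exact K.convexHull_subset_space hs.1

theorem IsMeshOf.finite_elements (hK : IsMeshOf K D) : (elements K).Finite :=
  hK.finite.subset fun _ h => h.1

theorem IsMeshOf.finite_vertices (hK : IsMeshOf K D) : K.vertices.Finite := by
  rw [K.vertices_eq]
  exact hK.finite.biUnion fun s _ => s.finite_toSet

theorem IsMeshOf.vertices_subset (hK : IsMeshOf K D) : K.vertices ⊆ D := by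
  rw [← hK.space_eq]; exact K.vertices_subset_space

theorem diam_simplex_le_meshSize (hK : IsMeshOf K D) (hs : s ∈ elements K) :
    Metric.diam (simplex s) ≤ meshSize K :=
  le_csSup (hK.finite_elements.image _).bddAbove (mem_image_of_mem _ hs)

theorem dist_le_meshSize (hK : IsMeshOf K D) (hs : s ∈ elements K) (hx : x ∈ simplex s)
    (hy : y ∈ simplex s) : dist x y ≤ meshSize K :=
  (Metric.dist_le_diam_of_mem (isCompact_simplex s).isBounded hx hy).trans
    (diam_simplex_le_meshSize hK hs)

/-! ### Finite element functions -/

/-- By purity every face lies in an element, on which the hat function is either an affine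
coordinate or identically zero. -/
theorem hat_mem_P1 (hK : IsMeshOf K D) (y : Sp d) : hat K y ∈ P1 K := by
  refine ⟨fun s hs => ?_, fun x hx => hat_eq_zero_of_notMem_space hx y⟩
  obtain ⟨t, ht, hst⟩ := hK.pure s hs
  have hsub : simplex s ⊆ simplex t := convexHull_mono (Finset.coe_subset.2 hst)
  by_cases hy : y ∈ t
  · exact ⟨(elementBasis ht).coord ⟨y, hy⟩, fun x hx => hat_eq_coord ht (hsub hx) hy⟩
  · exact ⟨0, fun x hx => hat_eq_zero_of_notMem ht.1 (hsub hx) hy⟩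

theorem nhat_eq_smul (K : Mesh d) (y : Sp d) :
    nhat K y = (∫ z in K.space, |hat K y z|)⁻¹ • hat K y := by
  funext x; simp [nhat, div_eq_inv_mul]

theorem nhat_mem_P1 (hK : IsMeshOf K D) (y : Sp d) : nhat K y ∈ P1 K := by
  rw [nhat_eq_smul]; exact (P1 K).smul_mem _ (hat_mem_P1 hK y)

theorem nhat_nonneg (K : Mesh d) (y x : Sp d) : 0 ≤ nhat K y x :=
  div_nonneg (hat_nonneg K y x) (integral_nonneg fun _ => abs_nonneg _)

open Classical in
/-- The constant function `1` as a finite element function. -/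
noncomputable def unit (K : Mesh d) : Sp d → ℝ := fun x => if x ∈ K.space then 1 else 0

theorem unit_mem_P1 (K : Mesh d) : unit K ∈ P1 K :=
  ⟨fun s hs => ⟨AffineMap.const ℝ _ 1, fun x hx => by
    simp [unit, K.convexHull_subset_space hs hx]⟩, fun x hx => by simp [unit, hx]⟩

theorem IsMeshOf.unit_apply (hK : IsMeshOf K D) (hx : x ∈ D) : unit K x = 1 := by
  simp [unit, hK.space_eq, hx]

/-- Affine maps commute with convex combinations; the constant part `L 0` is distributed over the
vertices because the weights sum to one. -/
theorem P1.eq_sum (hv : v ∈ P1 K) (hs : s ∈ K.faces) (hx : IsBarycentric s x w) :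
    v x = ∑ z ∈ s, w z * v z := by
  obtain ⟨L, hL⟩ := hv.1 s hs
  have hLx : ∀ p, L p = L.linear p + L 0 := fun p => by
    conv_lhs => rw [L.decomp]
    rfl
  rw [hL hx.mem_simplex, hLx, ← hx.2.2.2, map_sum]
  have h0 : L 0 = ∑ z ∈ s, w z * L 0 := by rw [← Finset.sum_mul, hx.2.2.1, one_mul]
  rw [h0, ← Finset.sum_add_distrib]
  refine Finset.sum_congr rfl fun z hz => ?_
  rw [hL (mem_simplex_of_mem hz), hLx z, map_smul, smul_eq_mul, mul_add]

/-- A bound at the nodes is a bound everywhere. -/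
theorem P1.abs_le (hK : IsMeshOf K D) (hv : v ∈ P1 K) {C : ℝ}
    (h : ∀ y ∈ K.vertices, |v y| ≤ C) (hx : x ∈ D) : |v x| ≤ C := by
  obtain ⟨s, hs, hxs⟩ := hK.exists_element hx
  have hb := isBarycentric_hat hs.1 hxs
  rw [P1.eq_sum hv hs.1 hb]
  calc |∑ z ∈ s, hat K z x * v z| ≤ ∑ z ∈ s, |hat K z x * v z| := Finset.abs_sum_le_sum_abs _ _
    _ ≤ ∑ z ∈ s, hat K z x * C := by
      refine Finset.sum_le_sum fun z hz => ?_
      rw [abs_mul, abs_of_nonneg (hat_nonneg K z x)]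
      exact mul_le_mul_of_nonneg_left (h z (mem_vertices_of_mem hs.1 hz)) (hat_nonneg K z x)
    _ = C := by rw [← Finset.sum_mul, hb.2.2.1, one_mul]

theorem P1.nonneg (hK : IsMeshOf K D) (hv : v ∈ P1 K)
    (h : ∀ y ∈ K.vertices, 0 ≤ v y) (hx : x ∈ D) : 0 ≤ v x := by
  obtain ⟨s, hs, hxs⟩ := hK.exists_element hx
  rw [P1.eq_sum hv hs.1 (isBarycentric_hat hs.1 hxs)]
  exact Finset.sum_nonneg fun z hz =>
    mul_nonneg (hat_nonneg K z x) (h z (mem_vertices_of_mem hs.1 hz))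

open Classical in
/-- The gradient of a finite element function on the element `s`. -/
noncomputable def grd (K : Mesh d) (s : Finset (Sp d)) (v : Sp d → ℝ) : Sp d :=
  if hs : s ∈ elements K then gradient v (Finset.univ.centroid ℝ (elementBasis hs)) else 0

/-- One vector is both the gradient at interior points and the slope between any two points of the
closed element. The second property also covers vertices and boundary points, where `gradient`
carries no information. -/
theorem exists_gradient (hv : v ∈ P1 K) (hs : s ∈ elements K) : ∃ g : Sp d,
    (∀ x ∈ simplex s, ∀ x' ∈ simplex s, v x - v x' = inner ℝ g (x - x')) ∧
      ∀ x ∈ interior (simplex s), HasGradientAt v g x := by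
  obtain ⟨L, hL⟩ := hv.1 s hs.1
  refine ⟨(InnerProductSpace.toDual ℝ (Sp d)).symm (LinearMap.toContinuousLinearMap L.linear),
    fun x hx x' hx' => ?_, fun x hx => ?_⟩
  · rw [hL hx, hL hx', InnerProductSpace.toDual_symm_apply]
    simpa using (L.linearMap_vsub x x').symm
  · rw [hasGradientAt_iff_hasFDerivAt, LinearIsometryEquiv.apply_symm_apply]
    have hL' : HasFDerivAt L (LinearMap.toContinuousLinearMap L.linear) x := by
      have : (L : Sp d → ℝ) = fun p => LinearMap.toContinuousLinearMap L.linear p + L 0 := by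
        conv_lhs => rw [L.decomp]
        rfl
      rw [this]
      exact (LinearMap.toContinuousLinearMap L.linear).hasFDerivAt.add_const _
    exact hL'.congr_of_eventuallyEq
      (Filter.eventuallyEq_of_mem (mem_interior_iff_mem_nhds.1 hx) hL)

theorem P1.sub_eq_inner (hv : v ∈ P1 K) (hs : s ∈ elements K) {x x' : Sp d}
    (hx : x ∈ simplex s) (hx' : x' ∈ simplex s) : v x - v x' = inner ℝ (grd K s v) (x - x') := by
  obtain ⟨g, h1, h2⟩ := exists_gradient hv hs
  rw [grd, dif_pos hs, (h2 _ (centroid_mem_interior hs)).gradient, h1 x hx x' hx']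

theorem P1.hasGradientAt (hv : v ∈ P1 K) (hs : s ∈ elements K)
    (hx : x ∈ interior (simplex s)) : HasGradientAt v (grd K s v) x := by
  obtain ⟨g, h1, h2⟩ := exists_gradient hv hs
  rw [grd, dif_pos hs, (h2 _ (centroid_mem_interior hs)).gradient]
  exact h2 x hx

theorem P1.gradient_eq (hv : v ∈ P1 K) (hs : s ∈ elements K)
    (hx : x ∈ interior (simplex s)) : gradient v x = grd K s v :=
  (P1.hasGradientAt hv hs hx).gradient

theorem P1.continuousOn_simplex (hv : v ∈ P1 K) (hs : s ∈ elements K) :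
    ContinuousOn v (simplex s) := by
  obtain ⟨L, hL⟩ := hv.1 s hs.1
  exact (L.continuous_of_finiteDimensional.continuousOn).congr hL

theorem grd_add (hu : u ∈ P1 K) (hv : v ∈ P1 K) (hs : s ∈ elements K) :
    grd K s (u + v) = grd K s u + grd K s v := by
  obtain ⟨x, hx⟩ := interior_simplex_nonempty hs
  have h : HasGradientAt (u + v) (grd K s u + grd K s v) x := by
    have := (P1.hasGradientAt hu hs hx).hasFDerivAt.add (P1.hasGradientAt hv hs hx).hasFDerivAt
    rwa [← map_add] at this
  rw [← P1.gradient_eq ((P1 K).add_mem hu hv) hs hx, h.gradient]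

theorem grd_smul (hv : v ∈ P1 K) (hs : s ∈ elements K) (c : ℝ) :
    grd K s (c • v) = c • grd K s v := by
  obtain ⟨x, hx⟩ := interior_simplex_nonempty hs
  have h : HasGradientAt (c • v) (c • grd K s v) x := by
    have := (P1.hasGradientAt hv hs hx).hasFDerivAt.const_smul c
    rw [hasGradientAt_iff_hasFDerivAt, map_smul]
    exact this
  rw [← P1.gradient_eq ((P1 K).smul_mem c hv) hs hx, h.gradient]

theorem grd_eq_zero_of_eqOn (hv : v ∈ P1 K) (hs : s ∈ elements K) {c : ℝ}
    (h : ∀ x ∈ simplex s, v x = c) : grd K s v = 0 := by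
  have hx := centroid_mem_interior hs
  rw [← P1.gradient_eq hv hs hx]
  have : v =ᶠ[𝓝 _] fun _ => c :=
    Filter.eventuallyEq_of_mem (mem_interior_iff_mem_nhds.1 hx) h
  rw [this.gradient_eq, gradient_fun_const]

theorem grd_unit (hK : IsMeshOf K D) (hs : s ∈ elements K) : grd K s (unit K) = 0 :=
  grd_eq_zero_of_eqOn (unit_mem_P1 K) hs fun _ hx => hK.unit_apply (hK.simplex_subset hs hx)

theorem grd_sum {ι : Type*} (I : Finset ι) (f : ι → Sp d → ℝ) (hf : ∀ i ∈ I, f i ∈ P1 K)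
    (hs : s ∈ elements K) : grd K s (∑ i ∈ I, f i) = ∑ i ∈ I, grd K s (f i) := by
  classical
  induction I using Finset.induction_on with
  | empty =>
    simpa using grd_eq_zero_of_eqOn (P1 K).zero_mem hs (c := 0) fun _ _ => rfl
  | insert a I ha ih =>
    rw [Finset.sum_insert ha, Finset.sum_insert ha, grd_add (hf a (by simp))
      ((P1 K).sum_mem fun i hi => hf i (by simp [hi])) hs, ih fun i hi => hf i (by simp [hi])]

theorem grd_congr (hu : u ∈ P1 K) (hv : v ∈ P1 K) (hs : s ∈ elements K)
    (h : EqOn u v (simplex s)) : grd K s u = grd K s v := by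
  have h' : u = v + (u - v) := by abel
  have h0 : grd K s (u - v) = 0 := grd_eq_zero_of_eqOn ((P1 K).sub_mem hu hv) hs (c := 0)
    fun x hx => by simp [h hx]
  rw [h', grd_add hv ((P1 K).sub_mem hu hv) hs, h0, add_zero]

theorem grd_eq_sum (hK : IsMeshOf K D) (hv : v ∈ P1 K) (hs : s ∈ elements K) :
    grd K s v = ∑ z ∈ s, v z • grd K s (hat K z) := by
  have hm : ∑ z ∈ s, v z • hat K z ∈ P1 K :=
    (P1 K).sum_mem fun z _ => (P1 K).smul_mem _ (hat_mem_P1 hK z)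
  rw [grd_congr hv hm hs, grd_sum _ _ (fun z _ => (P1 K).smul_mem _ (hat_mem_P1 hK z)) hs]
  · exact Finset.sum_congr rfl fun z _ => grd_smul (hat_mem_P1 hK z) hs _
  · intro x hx
    rw [P1.eq_sum hv hs.1 (isBarycentric_hat hs.1 hx), Finset.sum_apply]
    exact Finset.sum_congr rfl fun z _ => by simp [mul_comm]

/-- The hat functions form a partition of unity, and the constant function has zero gradient. -/
theorem sum_grd_hat (hK : IsMeshOf K D) (hs : s ∈ elements K) :
    ∑ z ∈ s, grd K s (hat K z) = 0 := by
  rw [← grd_unit hK hs, grd_eq_sum hK (unit_mem_P1 K) hs]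
  exact Finset.sum_congr rfl fun z hz => by
    rw [hK.unit_apply (hK.simplex_subset hs (mem_simplex_of_mem hz)), one_smul]

theorem grd_hat_eq_zero (hK : IsMeshOf K D) (hs : s ∈ elements K) (hy : y ∉ s) :
    grd K s (hat K y) = 0 :=
  grd_eq_zero_of_eqOn (hat_mem_P1 hK y) hs fun _ hx => hat_eq_zero_of_notMem hs.1 hx hy

theorem grd_nhat (hK : IsMeshOf K D) (hs : s ∈ elements K) (y : Sp d) :
    grd K s (nhat K y) = (∫ z in K.space, |hat K y z|)⁻¹ • grd K s (hat K y) := by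
  rw [nhat_eq_smul, grd_smul (hat_mem_P1 hK y) hs]

/-- The hat function of a vertex of an element with at least two vertices is steep. -/
theorem one_le_norm_grd_hat_mul_diam (hK : IsMeshOf K D) (hd : 1 ≤ d) (hs : s ∈ elements K)
    (hy : y ∈ s) : 1 ≤ ‖grd K s (hat K y)‖ * Metric.diam (simplex s) := by
  obtain ⟨z, hz, hzy⟩ : ∃ z ∈ s, z ≠ y := Finset.exists_mem_ne (by rw [hs.2]; lia) y
  have h := P1.sub_eq_inner (hat_mem_P1 hK y) hs (mem_simplex_of_mem hy) (mem_simplex_of_mem hz)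
  rw [hat_self hs.1 hy, hat_of_ne hs.1 hz hzy.symm, sub_zero] at h
  rw [h]
  refine (real_inner_le_norm _ _).trans (mul_le_mul_of_nonneg_left ?_ (norm_nonneg _))
  rw [← dist_eq_norm]
  exact Metric.dist_le_diam_of_mem (isCompact_simplex s).isBounded (mem_simplex_of_mem hy)
    (mem_simplex_of_mem hz)

end BellmanFEM

namespace BellmanFEM

variable {d : ℕ} {K : Mesh d} {s t : Finset (Sp d)} {x y z : Sp d} {D : Set (Sp d)}
  {u v w : Sp d → ℝ}

/-! ### Piecewise continuous functions and their integrals -/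

/-- Functions whose restriction to the interior of each element extends continuously to the
element. -/
def PwCont (K : Mesh d) {F : Type*} [TopologicalSpace F] (ψ : Sp d → F) : Prop :=
  ∀ s ∈ elements K, ∃ ψ' : Sp d → F, ContinuousOn ψ' (simplex s) ∧ EqOn ψ ψ' (interior (simplex s))

section PwCont

variable {F G H : Type*} [TopologicalSpace F] [TopologicalSpace G] [TopologicalSpace H]

theorem PwCont.of_continuousOn (hK : IsMeshOf K D) {ψ : Sp d → F} (h : ContinuousOn ψ D) :
    PwCont K ψ := fun _ hs => ⟨ψ, h.mono (hK.simplex_subset hs), fun _ _ => rfl⟩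

theorem PwCont.of_mem_P1 (hv : v ∈ P1 K) : PwCont K v :=
  fun _ hs => ⟨v, P1.continuousOn_simplex hv hs, fun _ _ => rfl⟩

theorem PwCont.gradient (hv : v ∈ P1 K) : PwCont K (gradient v) :=
  fun s hs => ⟨fun _ => grd K s v, continuousOn_const, fun _ hx => P1.gradient_eq hv hs hx⟩

theorem PwCont.comp₂ {ψ : Sp d → F} {χ : Sp d → G} (hψ : PwCont K ψ) (hχ : PwCont K χ)
    {op : F → G → H} (hop : Continuous fun p : F × G => op p.1 p.2) :
    PwCont K fun x => op (ψ x) (χ x) := by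
  intro s hs
  obtain ⟨ψ', h1, h2⟩ := hψ s hs
  obtain ⟨χ', h3, h4⟩ := hχ s hs
  exact ⟨fun x => op (ψ' x) (χ' x), hop.comp_continuousOn (h1.prodMk h3),
    fun x hx => by simp only [h2 hx, h4 hx]⟩

theorem PwCont.add {ψ χ : Sp d → ℝ} (hψ : PwCont K ψ) (hχ : PwCont K χ) :
    PwCont K fun x => ψ x + χ x := hψ.comp₂ hχ continuous_add

theorem PwCont.sub {ψ χ : Sp d → ℝ} (hψ : PwCont K ψ) (hχ : PwCont K χ) :
    PwCont K fun x => ψ x - χ x := hψ.comp₂ hχ continuous_sub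

theorem PwCont.mul {ψ χ : Sp d → ℝ} (hψ : PwCont K ψ) (hχ : PwCont K χ) :
    PwCont K fun x => ψ x * χ x := hψ.comp₂ hχ continuous_mul

theorem PwCont.inner {ψ χ : Sp d → Sp d} (hψ : PwCont K ψ) (hχ : PwCont K χ) :
    PwCont K fun x => inner ℝ (ψ x) (χ x) :=
  hψ.comp₂ hχ (op := fun a b => Inner.inner ℝ a b) continuous_inner

theorem PwCont.const (c : F) : PwCont K fun _ : Sp d => c :=
  fun _ _ => ⟨fun _ => c, continuousOn_const, fun _ _ => rfl⟩

theorem PwCont.neg {ψ : Sp d → ℝ} (hψ : PwCont K ψ) : PwCont K fun x => -ψ x :=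
  hψ.comp₂ (PwCont.const (0 : ℝ)) (op := fun a _ => -a) (by fun_prop)

end PwCont

theorem PwCont.integrableOn_interior {ψ : Sp d → ℝ} (hψ : PwCont K ψ) (hs : s ∈ elements K) :
    IntegrableOn ψ (interior (simplex s)) := by
  obtain ⟨ψ', h1, h2⟩ := hψ s hs
  exact ((h1.integrableOn_compact (isCompact_simplex s)).mono_set interior_subset).congr_fun
    h2.symm isOpen_interior.measurableSet

theorem interior_simplex_ae_eq (s : Finset (Sp d)) :
    interior (simplex s) =ᵐ[volume] simplex s :=
  interior_ae_eq_of_null_frontier ((convex_simplex s).addHaar_frontier volume)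

theorem volume_real_interior_simplex (s : Finset (Sp d)) :
    volume.real (interior (simplex s)) = volume.real (simplex s) :=
  measureReal_congr (interior_simplex_ae_eq s)

theorem volume_real_simplex_pos (hs : s ∈ elements K) : 0 < volume.real (simplex s) := by
  rw [← volume_real_interior_simplex]
  exact ENNReal.toReal_pos (isOpen_interior.measure_pos _ (interior_simplex_nonempty hs)).ne'
    ((measure_mono interior_subset).trans_lt (isCompact_simplex s).measure_lt_top).ne

/-- Up to a null set, a meshed domain is the union of the interiors of the elements. -/
theorem IsMeshOf.ae_eq_biUnion (hK : IsMeshOf K D) :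
    (⋃ s ∈ hK.finite_elements.toFinset, interior (simplex s)) =ᵐ[volume] D := by
  have hD : D = ⋃ s ∈ hK.finite_elements.toFinset, simplex s := by
    ext x
    simp only [Set.Finite.mem_toFinset, mem_iUnion, exists_prop]
    exact ⟨fun hx => hK.exists_element hx, fun ⟨s, hs, hx⟩ => hK.simplex_subset hs hx⟩
  have h := Finset.eventuallyEq_iUnion hK.finite_elements.toFinset
    fun s _ => interior_simplex_ae_eq s
  rwa [← hD] at h

/-- Frontiers of simplices are null sets, so the values on the mesh skeleton, where `gradient` of a
finite element function may be a default value, are irrelevant to integrals. -/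
theorem PwCont.integrableOn {ψ : Sp d → ℝ} (hK : IsMeshOf K D) (hψ : PwCont K ψ) :
    IntegrableOn ψ D := by
  rw [← integrableOn_congr_set_ae hK.ae_eq_biUnion, integrableOn_finset_iUnion]
  exact fun s hs => hψ.integrableOn_interior (hK.finite_elements.mem_toFinset.1 hs)

theorem PwCont.integral_eq_sum {ψ : Sp d → ℝ} (hK : IsMeshOf K D) (hψ : PwCont K ψ) :
    ∫ x in D, ψ x = ∑ s ∈ hK.finite_elements.toFinset, ∫ x in interior (simplex s), ψ x := by
  rw [← setIntegral_congr_set hK.ae_eq_biUnion, integral_biUnion_finset]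
  · exact fun s _ => isOpen_interior.measurableSet
  · intro s hs t ht hst
    exact disjoint_interior_simplex (hK.finite_elements.mem_toFinset.1 hs)
      (hK.finite_elements.mem_toFinset.1 ht) hst
  · exact fun s hs => hψ.integrableOn_interior (hK.finite_elements.mem_toFinset.1 hs)

/-! ### The normalised hat functions -/

theorem integral_hat_pos (hK : IsMeshOf K D) (hy : y ∈ K.vertices) : 0 < ∫ x in D, hat K y x := by
  obtain ⟨s, hs, hys⟩ := hK.exists_element_of_mem_vertices hy
  have hp : PwCont K (hat K y) := PwCont.of_mem_P1 (hat_mem_P1 hK y)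
  rw [hp.integral_eq_sum hK]
  refine Finset.sum_pos' (fun t _ => integral_nonneg fun x => hat_nonneg K y x)
    ⟨s, hK.finite_elements.mem_toFinset.2 hs, ?_⟩
  rw [setIntegral_pos_iff_support_of_nonneg_ae
    (Eventually.of_forall fun x => hat_nonneg K y x) (hp.integrableOn_interior hs)]
  refine (isOpen_interior.measure_pos volume (interior_simplex_nonempty hs)).trans_le
    (measure_mono fun x hx => ⟨(hat_pos_of_mem_interior hs hx hys).ne', hx⟩)

theorem integral_abs_hat (hK : IsMeshOf K D) (y : Sp d) :
    ∫ z in K.space, |hat K y z| = ∫ x in D, hat K y x := by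
  rw [hK.space_eq]
  simp only [abs_of_nonneg (hat_nonneg K y _)]

theorem integral_abs_hat_pos (hK : IsMeshOf K D) (hy : y ∈ K.vertices) :
    0 < ∫ z in K.space, |hat K y z| := by
  rw [integral_abs_hat hK]; exact integral_hat_pos hK hy

theorem integral_nhat (hK : IsMeshOf K D) (hy : y ∈ K.vertices) : ∫ x in D, nhat K y x = 1 := by
  simp only [nhat, integral_abs_hat hK]
  rw [integral_div, div_self (integral_hat_pos hK hy).ne']

theorem nhat_eq_zero_of_notMem (hs : s ∈ K.faces) (hx : x ∈ simplex s) (hy : y ∉ s) :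
    nhat K y x = 0 := by
  rw [nhat, hat_eq_zero_of_notMem hs hx hy, zero_div]

theorem pwCont_nhat (hK : IsMeshOf K D) (y : Sp d) : PwCont K (nhat K y) :=
  PwCont.of_mem_P1 (nhat_mem_P1 hK y)

theorem setIntegral_nhat_le_one (hK : IsMeshOf K D) (hy : y ∈ K.vertices) (hs : s ∈ elements K) :
    ∫ x in interior (simplex s), nhat K y x ≤ 1 := by
  rw [← integral_nhat hK hy]
  exact setIntegral_mono_set ((pwCont_nhat hK y).integrableOn hK)
    (Eventually.of_forall fun x => nhat_nonneg K y x)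
    (interior_subset.trans (hK.simplex_subset hs)).eventuallyLE

/-- Averages against `nhat K y` respect bounds on the elements around `y`. -/
theorem le_integral_mul_nhat (hK : IsMeshOf K D) (hy : y ∈ K.vertices) {ψ : Sp d → ℝ}
    (hψ : PwCont K ψ) {c : ℝ}
    (h : ∀ s ∈ elements K, y ∈ s → ∀ x ∈ interior (simplex s), c ≤ ψ x) :
    c ≤ ∫ x in D, ψ x * nhat K y x := by
  have hn := pwCont_nhat hK y
  calc c = ∫ x in D, c * nhat K y x := by rw [integral_const_mul, integral_nhat hK hy, mul_one]
    _ ≤ ∫ x in D, ψ x * nhat K y x := by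
      rw [((PwCont.const c).mul hn).integral_eq_sum hK, (hψ.mul hn).integral_eq_sum hK]
      refine Finset.sum_le_sum fun s hs => ?_
      have hs := hK.finite_elements.mem_toFinset.1 hs
      refine setIntegral_mono_on (((PwCont.const c).mul hn).integrableOn_interior hs)
        ((hψ.mul hn).integrableOn_interior hs) isOpen_interior.measurableSet fun x hx => ?_
      by_cases hys : y ∈ s
      · exact mul_le_mul_of_nonneg_right (h s hs hys x hx) (nhat_nonneg K y x)
      · simp [nhat_eq_zero_of_notMem hs.1 (interior_subset hx) hys]

theorem abs_integral_mul_nhat_le (hK : IsMeshOf K D) (hy : y ∈ K.vertices) {ψ : Sp d → ℝ}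
    (hψ : PwCont K ψ) {c : ℝ}
    (h : ∀ s ∈ elements K, y ∈ s → ∀ x ∈ interior (simplex s), |ψ x| ≤ c) :
    |∫ x in D, ψ x * nhat K y x| ≤ c := by
  have h1 := le_integral_mul_nhat hK hy hψ (c := -c)
    fun s hs hys x hx => (abs_le.1 (h s hs hys x hx)).1
  have h2 := le_integral_mul_nhat hK hy hψ.neg (c := -c)
    fun s hs hys x hx => neg_le_neg (abs_le.1 (h s hs hys x hx)).2
  simp only [neg_mul] at h2
  rw [integral_neg] at h2
  exact abs_le.2 ⟨h1, by linarith⟩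

/-! ### The discrete interior operator as a sum over elements -/

/-- The weak form of `w ↦ -a Δw - b·∇w + c w`, tested with `nhat K y`. -/
noncomputable def weakOp (K : Mesh d) (D : Set (Sp d)) (a : ℝ) (b : Sp d → Sp d) (c : Sp d → ℝ)
    (w : Sp d → ℝ) (y : Sp d) : ℝ :=
  a * (∫ x in D, inner ℝ (gradient w x) (gradient (nhat K y) x)) +
    ∫ x in D, (-inner ℝ (b x) (gradient w x) + c x * w x) * nhat K y x

/-- The contribution of the element `s` to `weakOp`. -/
noncomputable def elementOp (K : Mesh d) (s : Finset (Sp d)) (a : ℝ) (b : Sp d → Sp d)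
    (c : Sp d → ℝ) (w : Sp d → ℝ) (y : Sp d) : ℝ :=
  a * (volume.real (simplex s) * inner ℝ (grd K s w) (grd K s (nhat K y))) +
    ∫ x in interior (simplex s), (-inner ℝ (b x) (grd K s w) + c x * w x) * nhat K y x

variable {a : ℝ} {b : Sp d → Sp d} {c : Sp d → ℝ}

theorem pwCont_lowerOrder (hK : IsMeshOf K D) (hb : ContinuousOn b D) (hc : ContinuousOn c D)
    (hw : w ∈ P1 K) : PwCont K fun x => -inner ℝ (b x) (gradient w x) + c x * w x :=
  ((PwCont.of_continuousOn hK hb).inner (PwCont.gradient hw)).neg.add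
    ((PwCont.of_continuousOn hK hc).mul (PwCont.of_mem_P1 hw))

/-- The angle and diffusion conditions are stated element by element, and gradients are constant on
each element; the sign analysis is therefore done on each summand separately. -/
theorem weakOp_eq_sum (hK : IsMeshOf K D) (hb : ContinuousOn b D) (hc : ContinuousOn c D)
    (hw : w ∈ P1 K) (y : Sp d) :
    weakOp K D a b c w y = ∑ s ∈ hK.finite_elements.toFinset, elementOp K s a b c w y := by
  have hn := nhat_mem_P1 hK y
  rw [weakOp, ((PwCont.gradient hw).inner (PwCont.gradient hn)).integral_eq_sum hK,
    ((pwCont_lowerOrder hK hb hc hw).mul (pwCont_nhat hK y)).integral_eq_sum hK,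
    Finset.mul_sum, ← Finset.sum_add_distrib]
  refine Finset.sum_congr rfl fun s hs => ?_
  have hs := hK.finite_elements.mem_toFinset.1 hs
  have hm : MeasurableSet (interior (simplex s)) := isOpen_interior.measurableSet
  rw [elementOp]
  congr 1
  · congr 1
    rw [setIntegral_congr_fun hm (g := fun _ => inner ℝ (grd K s w) (grd K s (nhat K y)))
      fun x hx => by simp only [P1.gradient_eq hw hs hx, P1.gradient_eq hn hs hx],
      setIntegral_const, volume_real_interior_simplex, smul_eq_mul]
  · exact setIntegral_congr_fun hm fun x hx => by simp only [P1.gradient_eq hw hs hx]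

theorem elementOp_eq_zero (hK : IsMeshOf K D) (hs : s ∈ elements K) (hy : y ∉ s) :
    elementOp K s a b c w y = 0 := by
  have h : ∫ x in interior (simplex s),
      (-inner ℝ (b x) (grd K s w) + c x * w x) * nhat K y x = 0 := by
    rw [setIntegral_congr_fun isOpen_interior.measurableSet (g := fun _ => (0 : ℝ)) fun x hx => by
      simp only [nhat_eq_zero_of_notMem hs.1 (interior_subset hx) hy, mul_zero]]
    simp
  rw [elementOp, h, grd_nhat hK hs, grd_hat_eq_zero hK hs hy]
  simp

theorem integrable_inner_gradient (hK : IsMeshOf K D) (hu : u ∈ P1 K) (hv : v ∈ P1 K) :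
    IntegrableOn (fun x => inner ℝ (gradient u x) (gradient v x)) D :=
  ((PwCont.gradient hu).inner (PwCont.gradient hv)).integrableOn hK

theorem IsMeshOf.ae_mem_interior (hK : IsMeshOf K D) :
    ∀ᵐ x ∂volume.restrict D, ∃ s ∈ elements K, x ∈ interior (simplex s) := by
  rw [← Measure.restrict_congr_set hK.ae_eq_biUnion]
  filter_upwards [ae_restrict_mem (Finset.measurableSet_biUnion _
    fun s _ => isOpen_interior.measurableSet)] with x hx
  simpa using hx

/-- Additivity of gradients is only available inside elements, hence almost everywhere, which is
enough under the integral. -/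
theorem weakOp_add (hK : IsMeshOf K D) (hb : ContinuousOn b D) (hc : ContinuousOn c D)
    (hu : u ∈ P1 K) (hv : v ∈ P1 K) (y : Sp d) :
    weakOp K D a b c (u + v) y = weakOp K D a b c u y + weakOp K D a b c v y := by
  have hn := nhat_mem_P1 hK y
  have hg : ∀ᵐ x ∂volume.restrict D, gradient (u + v) x = gradient u x + gradient v x := by
    filter_upwards [hK.ae_mem_interior] with x ⟨s, hs, hx⟩
    rw [P1.gradient_eq hu hs hx, P1.gradient_eq hv hs hx,
      P1.gradient_eq ((P1 K).add_mem hu hv) hs hx, grd_add hu hv hs]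
  have h1 : ∫ x in D, inner ℝ (gradient (u + v) x) (gradient (nhat K y) x) =
      (∫ x in D, inner ℝ (gradient u x) (gradient (nhat K y) x)) +
        ∫ x in D, inner ℝ (gradient v x) (gradient (nhat K y) x) := by
    rw [← integral_add (integrable_inner_gradient hK hu hn) (integrable_inner_gradient hK hv hn)]
    refine integral_congr_ae ?_
    filter_upwards [hg] with x hx
    rw [hx, inner_add_left]
  have h2 : ∫ x in D, (-inner ℝ (b x) (gradient (u + v) x) + c x * (u + v) x) * nhat K y x =
      (∫ x in D, (-inner ℝ (b x) (gradient u x) + c x * u x) * nhat K y x) +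
        ∫ x in D, (-inner ℝ (b x) (gradient v x) + c x * v x) * nhat K y x := by
    rw [← integral_add (((pwCont_lowerOrder hK hb hc hu).mul (pwCont_nhat hK y)).integrableOn hK)
      (((pwCont_lowerOrder hK hb hc hv).mul (pwCont_nhat hK y)).integrableOn hK)]
    refine integral_congr_ae ?_
    filter_upwards [hg] with x hx
    rw [hx, inner_add_right, Pi.add_apply]
    ring
  rw [weakOp, h1, h2, weakOp, weakOp]
  ring

theorem weakOp_smul (hK : IsMeshOf K D) (hu : u ∈ P1 K) (r : ℝ) (y : Sp d) :
    weakOp K D a b c (r • u) y = r * weakOp K D a b c u y := by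
  have hg : ∀ᵐ x ∂volume.restrict D, gradient (r • u) x = r • gradient u x := by
    filter_upwards [hK.ae_mem_interior] with x ⟨s, hs, hx⟩
    rw [P1.gradient_eq hu hs hx, P1.gradient_eq ((P1 K).smul_mem r hu) hs hx, grd_smul hu hs]
  have h1 : ∫ x in D, inner ℝ (gradient (r • u) x) (gradient (nhat K y) x) =
      r * ∫ x in D, inner ℝ (gradient u x) (gradient (nhat K y) x) := by
    rw [← integral_const_mul]
    refine integral_congr_ae ?_
    filter_upwards [hg] with x hx
    rw [hx, real_inner_smul_left]
  have h2 : ∫ x in D, (-inner ℝ (b x) (gradient (r • u) x) + c x * (r • u) x) * nhat K y x =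
      r * ∫ x in D, (-inner ℝ (b x) (gradient u x) + c x * u x) * nhat K y x := by
    rw [← integral_const_mul]
    refine integral_congr_ae ?_
    filter_upwards [hg] with x hx
    rw [hx, real_inner_smul_right, Pi.smul_apply, smul_eq_mul]
    ring
  rw [weakOp, h1, h2, weakOp]
  ring

theorem weakOp_unit_nonneg (hK : IsMeshOf K D) (hc0 : ∀ x ∈ D, 0 ≤ c x) (y : Sp d) :
    0 ≤ weakOp K D a b c (unit K) y := by
  have hg : ∀ᵐ x ∂volume.restrict D, gradient (unit K) x = 0 ∧ x ∈ D := by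
    filter_upwards [hK.ae_mem_interior] with x ⟨s, hs, hx⟩
    exact ⟨by rw [P1.gradient_eq (unit_mem_P1 K) hs hx, grd_unit hK hs],
      hK.simplex_subset hs (interior_subset hx)⟩
  have h1 : ∫ x in D, inner ℝ (gradient (unit K) x) (gradient (nhat K y) x) = 0 := by
    rw [integral_congr_ae (g := fun _ => (0 : ℝ)) (by
      filter_upwards [hg] with x hx
      rw [hx.1, inner_zero_left])]
    simp
  rw [weakOp, h1, mul_zero, zero_add]
  refine integral_nonneg_of_ae ?_
  filter_upwards [hg] with x hx
  rw [hx.1, inner_zero_right, hK.unit_apply hx.2, neg_zero, zero_add, mul_one]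
  exact mul_nonneg (hc0 x hx.2) (nhat_nonneg K y x)

end BellmanFEM

namespace BellmanFEM

variable {d : ℕ} {K : Mesh d} {s t : Finset (Sp d)} {x y z : Sp d} {D : Set (Sp d)}
  {u v w : Sp d → ℝ} {a : ℝ} {b : Sp d → Sp d} {c : Sp d → ℝ} {p : Sp d} {ν σ : ℝ}

/-! ### Suprema over elements -/

/-- Compactness and continuity bound the range; for an unbounded range the real supremum would be
the default value `0` and the estimate would fail. -/
theorem abs_le_supOn {S : Set (Sp d)} (hS : IsCompact S) (hc : ContinuousOn c S) (hx : x ∈ S) :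
    |c x| ≤ supOn S c := by
  have hb : BddAbove (range fun x : S => |c x|) := by
    obtain ⟨M, hM⟩ := hS.bddAbove_image hc.abs
    refine ⟨M, ?_⟩
    rintro _ ⟨z, rfl⟩
    exact hM (mem_image_of_mem (fun x => |c x|) z.2)
  exact le_ciSup hb ⟨x, hx⟩

theorem norm_le_vecSupOn {S : Set (Sp d)} (hS : IsCompact S) (hb : ContinuousOn b S)
    (hx : x ∈ S) : ‖b x‖ ≤ vecSupOn S b := by
  rw [EuclideanSpace.norm_eq, vecSupOn]
  refine Real.sqrt_le_sqrt (Finset.sum_le_sum fun j _ => ?_)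
  rw [Real.norm_eq_abs]
  refine pow_le_pow_left₀ (abs_nonneg _) (abs_le_supOn (c := fun x => b x j) hS ?_ hx) 2
  exact (EuclideanSpace.proj (𝕜 := ℝ) j).continuous.comp_continuousOn hb

theorem supOn_nonneg (S : Set (Sp d)) (c : Sp d → ℝ) : 0 ≤ supOn S c :=
  Real.iSup_nonneg fun _ => abs_nonneg _

theorem vecSupOn_nonneg (S : Set (Sp d)) (b : Sp d → Sp d) : 0 ≤ vecSupOn S b := Real.sqrt_nonneg _

/-! ### Monotonicity of the interior operator -/

theorem StrictlyAcute.inner_grd_le (hK : IsMeshOf K D) {θ : ℝ} (h : StrictlyAcute K θ)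
    (hs : s ∈ elements K) (hy : y ∈ s) (hz : z ∈ s) (hyz : y ≠ z) :
    inner ℝ (grd K s (hat K y)) (grd K s (hat K z)) ≤
      -Real.sin θ * ‖grd K s (hat K y)‖ * ‖grd K s (hat K z)‖ := by
  obtain ⟨x, hx⟩ := interior_simplex_nonempty hs
  simpa only [P1.gradient_eq (hat_mem_P1 hK _) hs hx] using
    h y (mem_vertices_of_mem hs.1 hy) z (mem_vertices_of_mem hs.1 hz) hyz s hs x hx

theorem grd_hat_ne_zero (hK : IsMeshOf K D) (hd : 1 ≤ d) (hs : s ∈ elements K) (hy : y ∈ s) :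
    0 < ‖grd K s (hat K y)‖ := by
  have h := one_le_norm_grd_hat_mul_diam hK hd hs hy
  by_contra h0
  rw [le_antisymm (not_lt.1 h0) (norm_nonneg _), zero_mul] at h
  linarith

/-- In dimension at least two, the acuteness angle satisfies `sin θ ≤ 1 / 2`. -/
theorem StrictlyAcute.sin_le_half (hK : IsMeshOf K D) (hd : 2 ≤ d) {θ : ℝ}
    (h : StrictlyAcute K θ) (hθ : 0 ≤ Real.sin θ) (hs : s ∈ elements K) : Real.sin θ ≤ 1 / 2 := by
  classical
  -- At the vertex with the shortest gradient, each of the `d` inner products with the other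
  -- gradients is at most `-sin θ ‖g y‖²`. As all gradients sum to zero, `d sin θ ‖g y‖² ≤ ‖g y‖²`.
  obtain ⟨y, hy, hmin⟩ := s.exists_min_image (fun y => ‖grd K s (hat K y)‖)
    (K.nonempty_of_mem_faces hs.1)
  set g := fun z => grd K s (hat K z) with hg
  have hpos : 0 < ‖g y‖ := grd_hat_ne_zero hK (by lia) hs hy
  have h0 : inner ℝ (g y) (∑ z ∈ s, g z) = 0 := by rw [hg, sum_grd_hat hK hs, inner_zero_right]
  rw [← Finset.add_sum_erase s g hy, inner_add_right, real_inner_self_eq_norm_sq, inner_sum] at h0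
  have hle : ∑ z ∈ s.erase y, inner ℝ (g y) (g z) ≤
      ∑ _z ∈ s.erase y, -(Real.sin θ * ‖g y‖ ^ 2) := by
    refine Finset.sum_le_sum fun z hz => ?_
    have hz' := Finset.mem_erase.1 hz
    refine (h.inner_grd_le hK hs hy hz'.2 hz'.1.symm).trans ?_
    have := mul_le_mul_of_nonneg_left (hmin z hz'.2) (mul_nonneg hθ (norm_nonneg (g y)))
    simp only [hg] at this ⊢
    nlinarith
  rw [Finset.sum_const, Finset.card_erase_of_mem hy, hs.2, Nat.add_sub_cancel, nsmul_eq_mul] at hle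
  have hd' : (2 : ℝ) ≤ d := by exact_mod_cast hd
  have hq : 0 ≤ Real.sin θ * ‖g y‖ ^ 2 := by positivity
  have h3 : 2 * (Real.sin θ * ‖g y‖ ^ 2) ≤ ‖g y‖ ^ 2 := by nlinarith
  have h4 : 0 < ‖g y‖ ^ 2 := by positivity
  nlinarith

/-- The lower order terms of an element operator are controlled by the suprema of the
coefficients. -/
theorem setIntegral_lowerOrder_le (hK : IsMeshOf K D) (hy : y ∈ K.vertices)
    (hs : s ∈ elements K) (hb : ContinuousOn b D) (hc : ContinuousOn c D) {g : Sp d} {q : Sp d → ℝ}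
    (hq : PwCont K q) {B : ℝ} (hB : 0 ≤ B)
    (h : ∀ x ∈ interior (simplex s), -inner ℝ (b x) g + c x * q x ≤ B) :
    ∫ x in interior (simplex s), (-inner ℝ (b x) g + c x * q x) * nhat K y x ≤ B := by
  have hn := pwCont_nhat hK y
  have hp : PwCont K fun x => -inner ℝ (b x) g + c x * q x :=
    ((PwCont.of_continuousOn hK hb).inner (PwCont.const g)).neg.add
      ((PwCont.of_continuousOn hK hc).mul hq)
  calc ∫ x in interior (simplex s), (-inner ℝ (b x) g + c x * q x) * nhat K y x
      ≤ ∫ x in interior (simplex s), B * nhat K y x :=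
        setIntegral_mono_on ((hp.mul hn).integrableOn_interior hs)
          (((PwCont.const B).mul hn).integrableOn_interior hs) isOpen_interior.measurableSet
          fun x hx => mul_le_mul_of_nonneg_right (h x hx) (nhat_nonneg K y x)
    _ = B * ∫ x in interior (simplex s), nhat K y x := integral_const_mul _ _
    _ ≤ B := mul_le_of_le_one_right hB (setIntegral_nhat_le_one hK hy hs)

/-- Diffusion beats the lower order terms. Acuteness gives `⟨∇u, ∇φ̂_y⟩ ≤ -σ m |∇φ̂_y|` with the
weighted sum `m` of gradient lengths below, while `|∇u| ≤ m` and `u y = 0` bound the lower order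
integrand by `m (|b| + diam |c|)`. The same factor `m` appears in both, so `hdiff` settles the sign.
-/
theorem elementOp_nonpos (hK : IsMeshOf K D) (hs : s ∈ elements K) (hy : y ∈ s)
    (hσ : 0 ≤ σ) (hacute : ∀ z ∈ s, z ≠ y → inner ℝ (grd K s (hat K z)) (grd K s (hat K y)) ≤
      -σ * ‖grd K s (hat K z)‖ * ‖grd K s (hat K y)‖)
    (hb : ContinuousOn b D) (hc : ContinuousOn c D) (hν0 : 0 ≤ ν) (hν : ν ≤ a)
    (hdiff : vecSupOn (simplex s) b + Metric.diam (simplex s) * supOn (simplex s) c ≤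
      ν * σ * ‖grd K s (nhat K y)‖ * volume.real (simplex s))
    (hu : u ∈ P1 K) (hu0 : ∀ z ∈ s, 0 ≤ u z) (huy : u y = 0) :
    elementOp K s a b c u y ≤ 0 := by
  -- This sum replaces `|∇u|`: it dominates the gradient and is also what acuteness produces, since
  -- there is no cancellation between nonnegative nodal values.
  set m := ∑ z ∈ s, u z * ‖grd K s (hat K z)‖ with hm
  have hm0 : 0 ≤ m := Finset.sum_nonneg fun z hz => mul_nonneg (hu0 z hz) (norm_nonneg _)
  have hyv := mem_vertices_of_mem hs.1 hy
  have hI := integral_abs_hat_pos hK hyv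
  have hgu := grd_eq_sum hK hu hs
  have hgm : ‖grd K s u‖ ≤ m := by
    rw [hgu]
    refine (norm_sum_le _ _).trans (Finset.sum_le_sum fun z hz => ?_)
    rw [norm_smul, Real.norm_eq_abs, abs_of_nonneg (hu0 z hz)]
  have hinner : inner ℝ (grd K s u) (grd K s (nhat K y)) ≤ -(σ * m * ‖grd K s (nhat K y)‖) := by
    have h1 : inner ℝ (grd K s u) (grd K s (hat K y)) ≤ -(σ * m * ‖grd K s (hat K y)‖) := by
      rw [hgu, sum_inner, hm, Finset.mul_sum, Finset.sum_mul, ← Finset.sum_neg_distrib]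
      refine Finset.sum_le_sum fun z hz => ?_
      by_cases hzy : z = y
      · subst hzy; simp [huy]
      · rw [real_inner_smul_left]
        nlinarith [mul_le_mul_of_nonneg_left (hacute z hz hzy) (hu0 z hz)]
    rw [grd_nhat hK hs, real_inner_smul_right, norm_smul, Real.norm_eq_abs,
      abs_of_pos (inv_pos.2 hI)]
    nlinarith [mul_le_mul_of_nonneg_left h1 (inv_pos.2 hI).le]
  have hsub := hK.simplex_subset hs
  set B := vecSupOn (simplex s) b
  set Cs := supOn (simplex s) c
  set δ := Metric.diam (simplex s)
  have hB : 0 ≤ B := vecSupOn_nonneg _ _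
  have hC : 0 ≤ Cs := supOn_nonneg _ _
  have hδ : 0 ≤ δ := Metric.diam_nonneg
  have hint := setIntegral_lowerOrder_le (g := grd K s u) (B := m * (B + δ * Cs)) hK hyv hs hb hc
    (PwCont.of_mem_P1 hu) (by positivity) fun x hx => by
      have hx := interior_subset hx
      have h1 : -inner ℝ (b x) (grd K s u) ≤ B * m :=
        (neg_le_abs _).trans ((abs_real_inner_le_norm _ _).trans
          (mul_le_mul (norm_le_vecSupOn (isCompact_simplex s) (hb.mono hsub) hx) hgm
            (norm_nonneg _) hB))
      -- Since `u` vanishes at the vertex `y`, its size on the element is slope times diameter.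
      have h2 : |u x| ≤ m * δ := by
        have := P1.sub_eq_inner hu hs hx (mem_simplex_of_mem hy)
        rw [huy, sub_zero] at this
        rw [this]
        refine (abs_real_inner_le_norm _ _).trans (mul_le_mul hgm ?_ (norm_nonneg _) hm0)
        rw [← dist_eq_norm]
        exact Metric.dist_le_diam_of_mem (isCompact_simplex s).isBounded hx (mem_simplex_of_mem hy)
      have h3 : c x * u x ≤ Cs * (m * δ) := by
        refine (le_abs_self _).trans ?_
        rw [abs_mul]
        exact mul_le_mul (abs_le_supOn (isCompact_simplex s) (hc.mono hsub) hx) h2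
          (abs_nonneg _) hC
      linarith
  rw [elementOp]
  have hV := (volume_real_simplex_pos hs).le
  set V := volume.real (simplex s)
  set G := ‖grd K s (nhat K y)‖
  have hG : 0 ≤ G := norm_nonneg _
  have h1 : m * (B + δ * Cs) ≤ m * (a * σ * G * V) :=
    mul_le_mul_of_nonneg_left (hdiff.trans (by gcongr)) hm0
  have ha : 0 ≤ a := hν0.trans hν
  have h2 : a * (V * inner ℝ (grd K s u) (grd K s (nhat K y))) ≤ a * (V * -(σ * m * G)) := by
    gcongr
  linarith

/-- Lower bound for the diagonal entries of the element operators. -/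
theorem le_elementOp_hat (hK : IsMeshOf K D) (hs : s ∈ elements K) (hy : y ∈ s)
    (hσ : 0 ≤ σ) (hb : ContinuousOn b D) (hc : ContinuousOn c D) (hc0 : ∀ x ∈ D, 0 ≤ c x)
    (hν : ν ≤ a)
    (hdiff : vecSupOn (simplex s) b + Metric.diam (simplex s) * supOn (simplex s) c ≤
      ν * σ * ‖grd K s (nhat K y)‖ * volume.real (simplex s)) :
    (1 - σ) * (a * ‖grd K s (hat K y)‖ * ‖grd K s (nhat K y)‖ * volume.real (simplex s)) ≤
      elementOp K s a b c (hat K y) y := by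
  have hyv := mem_vertices_of_mem hs.1 hy
  have hI := integral_abs_hat_pos hK hyv
  have hsub := hK.simplex_subset hs
  have hinner : inner ℝ (grd K s (hat K y)) (grd K s (nhat K y)) =
      ‖grd K s (hat K y)‖ * ‖grd K s (nhat K y)‖ := by
    rw [grd_nhat hK hs, real_inner_smul_right, norm_smul, Real.norm_eq_abs,
      abs_of_pos (inv_pos.2 hI), real_inner_self_eq_norm_sq]
    ring
  have hB : vecSupOn (simplex s) b ≤
      a * σ * ‖grd K s (nhat K y)‖ * volume.real (simplex s) := by
    have := mul_nonneg (Metric.diam_nonneg (s := simplex s)) (supOn_nonneg (simplex s) c)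
    have h2 : ν * σ * ‖grd K s (nhat K y)‖ * volume.real (simplex s) ≤
        a * σ * ‖grd K s (nhat K y)‖ * volume.real (simplex s) := by gcongr
    linarith
  -- An upper bound for the integral with coefficients `-b` and `-c` is a lower bound for the
  -- original one. The reaction term has a favourable sign and is dropped, so only the drift enters
  -- `B`.
  have hint := setIntegral_lowerOrder_le (b := fun x => -b x) (c := fun x => -c x)
    (g := grd K s (hat K y)) (B := vecSupOn (simplex s) b * ‖grd K s (hat K y)‖) hK hyv hs hb.neg
    hc.neg (PwCont.of_mem_P1 (hat_mem_P1 hK y))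
    (mul_nonneg (vecSupOn_nonneg _ _) (norm_nonneg _)) fun x hx => by
      have hx := interior_subset hx
      have h1 : inner ℝ (b x) (grd K s (hat K y)) ≤
          vecSupOn (simplex s) b * ‖grd K s (hat K y)‖ :=
        (real_inner_le_norm _ _).trans (mul_le_mul_of_nonneg_right
          (norm_le_vecSupOn (isCompact_simplex s) (hb.mono hsub) hx) (norm_nonneg _))
      have h2 := mul_nonneg (hc0 x (hsub hx)) (hat_nonneg K y x)
      rw [inner_neg_left, neg_neg, neg_mul]
      linarith
  have hneg : ∫ x in interior (simplex s), (-inner ℝ (-b x) (grd K s (hat K y)) +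
      -c x * hat K y x) * nhat K y x = -∫ x in interior (simplex s),
        (-inner ℝ (b x) (grd K s (hat K y)) + c x * hat K y x) * nhat K y x := by
    rw [← integral_neg]
    congr 1
    funext x
    rw [inner_neg_left]
    ring
  rw [hneg] at hint
  rw [elementOp, hinner]
  have := mul_le_mul_of_nonneg_right hB (norm_nonneg (grd K s (hat K y)))
  linarith

end BellmanFEM

namespace BellmanFEM

variable {d : ℕ} {K : Mesh d} {s t : Finset (Sp d)} {x y z : Sp d} {D : Set (Sp d)}
  {u v w : Sp d → ℝ} {p : Sp d}

/-! ### One-sided derivatives of finite element functions -/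

/-- A segment which starts at `y` and stays in the domain initially runs in one element. -/
theorem IsMeshOf.exists_element_segment (hK : IsMeshOf K D) (hp : p ∈ tangentDirections D y) :
    ∃ s ∈ elements K, y ∈ simplex s ∧ ∃ Λ : ℝ, 0 < Λ ∧ ∀ r ∈ Icc 0 Λ, y + r • p ∈ simplex s := by
  obtain ⟨Λ, hΛ, h⟩ := hp
  -- Among finitely many elements, one contains points of the segment for arbitrarily small `r`.
  -- Closedness then puts `y` into it, and convexity the whole initial piece.
  have hex : ∃ s ∈ elements K, ∃ᶠ r in 𝓝[>] (0 : ℝ), y + r • p ∈ simplex s := by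
    by_contra! hcon
    have h1 : ∀ᶠ r in 𝓝[>] (0 : ℝ), ∀ s ∈ elements K, y + r • p ∉ simplex s :=
      (eventually_all_finite hK.finite_elements).2 hcon
    have h2 : ∀ᶠ r in 𝓝[>] (0 : ℝ), r ∈ Ioc 0 Λ := Ioc_mem_nhdsGT hΛ
    obtain ⟨r, hr1, hr2⟩ := (h1.and h2).exists
    obtain ⟨s, hs, hrs⟩ := hK.exists_element (h r ⟨hr2.1.le, hr2.2⟩)
    exact hr1 s hs hrs
  obtain ⟨s, hs, hfr⟩ := hex
  have hys : y ∈ simplex s := by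
    have ht : Tendsto (fun r : ℝ => y + r • p) (𝓝[>] 0) (𝓝 y) := by
      have : Tendsto (fun r : ℝ => y + r • p) (𝓝 0) (𝓝 (y + (0 : ℝ) • p)) :=
        (by fun_prop : Continuous fun r : ℝ => y + r • p).tendsto 0
      rw [zero_smul, add_zero] at this
      exact this.mono_left nhdsWithin_le_nhds
    rw [← (isCompact_simplex s).isClosed.closure_eq]
    exact mem_closure_iff_frequently.2 (ht.frequently hfr)
  obtain ⟨r₀, hr₀, hpos⟩ := (hfr.and_eventually self_mem_nhdsWithin).exists
  refine ⟨s, hs, hys, r₀, hpos, fun r hr => ?_⟩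
  have hpos : 0 < r₀ := hpos
  have := (convex_simplex s).add_smul_mem hys hr₀ (t := r / r₀)
    ⟨div_nonneg hr.1 hpos.le, (div_le_one hpos).2 hr.2⟩
  rwa [smul_smul, div_mul_cancel₀ _ hpos.ne'] at this

/-- The difference quotients are constant for small `r`, so the limit in `diniDeriv` exists and
`limUnder` is not a default value. -/
theorem diniDeriv_eq (hv : v ∈ P1 K) (hs : s ∈ elements K) (hy : y ∈ simplex s) {Λ : ℝ}
    (hΛ : 0 < Λ) (h : ∀ r ∈ Icc 0 Λ, y + r • p ∈ simplex s) :
    diniDeriv p v y = -inner ℝ (grd K s v) p := by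
  refine Tendsto.limUnder_eq (Tendsto.congr' ?_ tendsto_const_nhds)
  filter_upwards [Ioc_mem_nhdsGT hΛ] with r hr
  have hr0 : r ≠ 0 := hr.1.ne'
  rw [P1.sub_eq_inner hv hs hy (h r ⟨hr.1.le, hr.2⟩), sub_add_cancel_left, inner_neg_right,
    real_inner_smul_right]
  field_simp

theorem diniDeriv_add (hK : IsMeshOf K D) (hp : p ∈ tangentDirections D y) (hu : u ∈ P1 K)
    (hv : v ∈ P1 K) : diniDeriv p (u + v) y = diniDeriv p u y + diniDeriv p v y := by
  obtain ⟨s, hs, hy, Λ, hΛ, h⟩ := hK.exists_element_segment hp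
  rw [diniDeriv_eq hu hs hy hΛ h, diniDeriv_eq hv hs hy hΛ h,
    diniDeriv_eq ((P1 K).add_mem hu hv) hs hy hΛ h, grd_add hu hv hs, inner_add_left]
  ring

theorem diniDeriv_smul (hK : IsMeshOf K D) (hp : p ∈ tangentDirections D y) (hu : u ∈ P1 K)
    (r : ℝ) : diniDeriv p (r • u) y = r * diniDeriv p u y := by
  obtain ⟨s, hs, hy, Λ, hΛ, h⟩ := hK.exists_element_segment hp
  rw [diniDeriv_eq hu hs hy hΛ h, diniDeriv_eq ((P1 K).smul_mem r hu) hs hy hΛ h,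
    grd_smul hu hs, real_inner_smul_left]
  ring

theorem diniDeriv_unit (hK : IsMeshOf K D) (hp : p ∈ tangentDirections D y) :
    diniDeriv p (unit K) y = 0 := by
  obtain ⟨s, hs, hy, Λ, hΛ, h⟩ := hK.exists_element_segment hp
  rw [diniDeriv_eq (unit_mem_P1 K) hs hy hΛ h, grd_unit hK hs, inner_zero_left, neg_zero]

theorem diniDeriv_zero_left (v : Sp d → ℝ) (y : Sp d) : diniDeriv 0 v y = 0 := by
  refine Tendsto.limUnder_eq ?_
  simp

/-- Along the segment `u` is linear, starts at zero and stays nonnegative, so its slope in direction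
`p` is nonnegative. This is the boundary counterpart of the acuteness argument. -/
theorem diniDeriv_nonpos (hK : IsMeshOf K D) (hp : p ∈ tangentDirections D y) (hu : u ∈ P1 K)
    (hu0 : ∀ x ∈ D, 0 ≤ u x) (huy : u y = 0) : diniDeriv p u y ≤ 0 := by
  obtain ⟨s, hs, hy, Λ, hΛ, h⟩ := hK.exists_element_segment hp
  rw [diniDeriv_eq hu hs hy hΛ h]
  have hΛs := h Λ (right_mem_Icc.2 hΛ.le)
  have h1 := P1.sub_eq_inner hu hs hΛs hy
  rw [huy, sub_zero, add_sub_cancel_left, real_inner_smul_right] at h1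
  have h2 := hu0 _ (hK.simplex_subset hs hΛs)
  rw [h1] at h2
  linarith [nonneg_of_mul_nonneg_right h2 hΛ]

/-! ### Nodal operators -/

open Classical in
/-- The common form of the explicit operators (`δ = 0`) and the implicit operators (`δ = 1`). -/
noncomputable def nodeOp (G : MixedDomain d) (K : Mesh d) (a : Sp d → ℝ) (b : Sp d → Sp d)
    (c : Sp d → ℝ) (bB : Sp d → Sp d) (cB : Sp d → ℝ) (δ : ℝ) (w : Sp d → ℝ) (y : Sp d) : ℝ :=
  if y ∈ interior G.cl then weakOp K G.cl (a y) b c w y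
  else if y ∈ G.bdD then δ * w y
  else diniDeriv (bB y) w y + cB y * w y

/-- Coefficients for which the nodal operators are monotone. -/
structure MonotoneCoefficients (G : MixedDomain d) (K : Mesh d) (σ : ℝ) (a : Sp d → ℝ)
    (b : Sp d → Sp d) (c : Sp d → ℝ) (bB : Sp d → Sp d) (cB : Sp d → ℝ) : Prop where
  isMesh : IsMeshOf K G.cl
  σ_nonneg : 0 ≤ σ
  acute : ∀ s ∈ elements K, ∀ y ∈ s, ∀ z ∈ s, z ≠ y →
    inner ℝ (grd K s (hat K z)) (grd K s (hat K y)) ≤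
      -σ * ‖grd K s (hat K z)‖ * ‖grd K s (hat K y)‖
  b_cont : ContinuousOn b G.cl
  c_cont : ContinuousOn c G.cl
  c_nonneg : ∀ x ∈ G.cl, 0 ≤ c x
  cB_nonneg : ∀ x ∈ frontier G.cl, 0 ≤ cB x
  cone : ∀ y ∈ K.vertices, y ∈ G.bdT ∪ G.bdR → bB y ∈ tangentDirections G.cl y
  diffusion : ∀ y ∈ K.vertices, y ∈ interior G.cl → ∃ ν, 0 ≤ ν ∧ ν ≤ a y ∧
    ∀ s ∈ elements K, y ∈ s →
      vecSupOn (simplex s) b + Metric.diam (simplex s) * supOn (simplex s) c ≤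
        ν * σ * ‖grd K s (nhat K y)‖ * volume.real (simplex s)

theorem MixedDomain.mem_cases (G : MixedDomain d) (hy : y ∈ G.cl) :
    y ∈ interior G.cl ∨ (y ∉ interior G.cl ∧ y ∈ G.bdD) ∨
      (y ∉ interior G.cl ∧ y ∉ G.bdD ∧ y ∈ G.bdT ∪ G.bdR ∧ y ∈ frontier G.cl) := by
  by_cases h : y ∈ interior G.cl
  · exact Or.inl h
  · have hf : y ∈ frontier G.cl := ⟨subset_closure hy, h⟩
    by_cases hD : y ∈ G.bdD
    · exact Or.inr (Or.inl ⟨h, hD⟩)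
    · refine Or.inr (Or.inr ⟨h, hD, ?_, hf⟩)
      rw [← G.union_eq] at hf
      exact hf.resolve_right hD

theorem MixedDomain.notMem_interior (G : MixedDomain d) (hy : y ∈ G.bdT ∪ G.bdR ∪ G.bdD) :
    y ∉ interior G.cl := by
  rw [G.union_eq] at hy
  exact hy.2

theorem MixedDomain.notMem_bdD (G : MixedDomain d) (hy : y ∈ G.bdT ∪ G.bdR) : y ∉ G.bdD := by
  rcases hy with hy | hy
  · exact Set.disjoint_left.1 G.disjoint_TD hy
  · exact Set.disjoint_left.1 G.disjoint_RD hy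

variable {G : MixedDomain d} {a : Sp d → ℝ} {b : Sp d → Sp d} {c : Sp d → ℝ} {bB : Sp d → Sp d}
  {cB : Sp d → ℝ} {δ σ : ℝ}

theorem nodeOp_of_interior (hy : y ∈ interior G.cl) :
    nodeOp G K a b c bB cB δ w y = weakOp K G.cl (a y) b c w y := if_pos hy

theorem nodeOp_of_dirichlet (hy : y ∉ interior G.cl) (hD : y ∈ G.bdD) :
    nodeOp G K a b c bB cB δ w y = δ * w y := by
  rw [nodeOp, if_neg hy, if_pos hD]

theorem nodeOp_of_boundary (hy : y ∉ interior G.cl) (hD : y ∉ G.bdD) :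
    nodeOp G K a b c bB cB δ w y = diniDeriv (bB y) w y + cB y * w y := by
  rw [nodeOp, if_neg hy, if_neg hD]

namespace MonotoneCoefficients

theorem add (H : MonotoneCoefficients G K σ a b c bB cB) (hy : y ∈ K.vertices) (hu : u ∈ P1 K)
    (hv : v ∈ P1 K) : nodeOp G K a b c bB cB δ (u + v) y =
      nodeOp G K a b c bB cB δ u y + nodeOp G K a b c bB cB δ v y := by
  rcases G.mem_cases (H.isMesh.vertices_subset hy) with h | ⟨h, hD⟩ | ⟨h, hD, hTR, -⟩
  · simp only [nodeOp_of_interior h, weakOp_add H.isMesh H.b_cont H.c_cont hu hv]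
  · simp only [nodeOp_of_dirichlet h hD, Pi.add_apply]
    ring
  · simp only [nodeOp_of_boundary h hD, diniDeriv_add H.isMesh (H.cone y hy hTR) hu hv,
      Pi.add_apply]
    ring

theorem smul (H : MonotoneCoefficients G K σ a b c bB cB) (hy : y ∈ K.vertices) (hu : u ∈ P1 K)
    (r : ℝ) : nodeOp G K a b c bB cB δ (r • u) y = r * nodeOp G K a b c bB cB δ u y := by
  rcases G.mem_cases (H.isMesh.vertices_subset hy) with h | ⟨h, hD⟩ | ⟨h, hD, hTR, -⟩
  · simp only [nodeOp_of_interior h, weakOp_smul H.isMesh hu]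
  · simp only [nodeOp_of_dirichlet h hD, Pi.smul_apply, smul_eq_mul]
    ring
  · simp only [nodeOp_of_boundary h hD, diniDeriv_smul H.isMesh (H.cone y hy hTR) hu,
      Pi.smul_apply, smul_eq_mul]
    ring

theorem sub (H : MonotoneCoefficients G K σ a b c bB cB) (hy : y ∈ K.vertices) (hu : u ∈ P1 K)
    (hv : v ∈ P1 K) : nodeOp G K a b c bB cB δ (u - v) y =
      nodeOp G K a b c bB cB δ u y - nodeOp G K a b c bB cB δ v y := by
  have : u - v = u + (-1 : ℝ) • v := by
    rw [neg_one_smul, sub_eq_add_neg]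
  rw [this, H.add hy hu ((P1 K).smul_mem _ hv), H.smul hy hv]
  ring

theorem unit_nonneg (H : MonotoneCoefficients G K σ a b c bB cB) (hy : y ∈ K.vertices)
    (hδ : 0 ≤ δ) : 0 ≤ nodeOp G K a b c bB cB δ (unit K) y := by
  have hyc := H.isMesh.vertices_subset hy
  rcases G.mem_cases hyc with h | ⟨h, hD⟩ | ⟨h, hD, hTR, hf⟩
  · rw [nodeOp_of_interior h]
    exact weakOp_unit_nonneg H.isMesh H.c_nonneg y
  · rw [nodeOp_of_dirichlet h hD, H.isMesh.unit_apply hyc, mul_one]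
    exact hδ
  · rw [nodeOp_of_boundary h hD, diniDeriv_unit H.isMesh (H.cone y hy hTR),
      H.isMesh.unit_apply hyc, zero_add, mul_one]
    exact H.cB_nonneg y hf

/-- Off-diagonal entries are nonpositive. -/
theorem nonpos (H : MonotoneCoefficients G K σ a b c bB cB) (hy : y ∈ K.vertices)
    (hu : u ∈ P1 K) (hu0 : ∀ z ∈ K.vertices, 0 ≤ u z) (huy : u y = 0) :
    nodeOp G K a b c bB cB δ u y ≤ 0 := by
  have hyc := H.isMesh.vertices_subset hy
  rcases G.mem_cases hyc with h | ⟨h, hD⟩ | ⟨h, hD, hTR, hf⟩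
  · rw [nodeOp_of_interior h, weakOp_eq_sum H.isMesh H.b_cont H.c_cont hu]
    obtain ⟨ν, hν0, hν, hdiff⟩ := H.diffusion y hy h
    refine Finset.sum_nonpos fun s hs => ?_
    have hs := H.isMesh.finite_elements.mem_toFinset.1 hs
    by_cases hys : y ∈ s
    · exact elementOp_nonpos H.isMesh hs hys H.σ_nonneg (H.acute s hs y hys) H.b_cont H.c_cont
        hν0 hν (hdiff s hs hys) hu (fun z hz => hu0 z (mem_vertices_of_mem hs.1 hz)) huy
    · exact (elementOp_eq_zero H.isMesh hs hys).le
  · rw [nodeOp_of_dirichlet h hD, huy, mul_zero]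
  · rw [nodeOp_of_boundary h hD, huy, mul_zero, add_zero]
    exact diniDeriv_nonpos H.isMesh (H.cone y hy hTR) hu
      (fun x hx => P1.nonneg H.isMesh hu hu0 hx) huy

/-- Subtracting the constant `w y` leaves a nonnegative function that vanishes at `y`. Keeping the
value on `unit` explicit retains the zeroth order coefficient, which is needed on `bdR`. -/
theorem le_of_min (H : MonotoneCoefficients G K σ a b c bB cB) (hy : y ∈ K.vertices)
    (hw : w ∈ P1 K) (hmin : ∀ z ∈ K.vertices, w y ≤ w z) :
    nodeOp G K a b c bB cB δ w y ≤ w y * nodeOp G K a b c bB cB δ (unit K) y := by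
  have hm : w - w y • unit K ∈ P1 K := (P1 K).sub_mem hw ((P1 K).smul_mem _ (unit_mem_P1 K))
  have hval : ∀ z ∈ K.vertices, (w - w y • unit K) z = w z - w y := fun z hz => by
    simp [H.isMesh.unit_apply (H.isMesh.vertices_subset hz)]
  have h := H.nonpos (δ := δ) hy hm (fun z hz => by rw [hval z hz]; linarith [hmin z hz])
    (by rw [hval y hy, sub_self])
  rw [H.sub hy hw ((P1 K).smul_mem _ (unit_mem_P1 K)), H.smul hy (unit_mem_P1 K)] at h
  linarith

/-- A nonpositive minimum is mapped to a nonpositive value. -/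
theorem nonpos_of_min (H : MonotoneCoefficients G K σ a b c bB cB) (hy : y ∈ K.vertices)
    (hw : w ∈ P1 K) (hmin : ∀ z ∈ K.vertices, w y ≤ w z) (hwy : w y ≤ 0) (hδ : 0 ≤ δ) :
    nodeOp G K a b c bB cB δ w y ≤ 0 :=
  (H.le_of_min hy hw hmin).trans (mul_nonpos_of_nonpos_of_nonneg hwy (H.unit_nonneg hy hδ))

/-- Nonnegative functions are only multiplied by the diagonal entry. -/
theorem le_diagonal_mul (H : MonotoneCoefficients G K σ a b c bB cB) (hy : y ∈ K.vertices)
    (hw : w ∈ P1 K) (hw0 : ∀ z ∈ K.vertices, 0 ≤ w z) :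
    nodeOp G K a b c bB cB δ w y ≤ w y * nodeOp G K a b c bB cB δ (hat K y) y := by
  have hh := hat_mem_P1 H.isMesh y
  -- Removing `w y` times the hat function makes the value at `y` zero and leaves the nonnegative
  -- values at the other nodes untouched.
  have h := H.nonpos (δ := δ) hy ((P1 K).sub_mem hw ((P1 K).smul_mem (w y) hh))
    (fun z hz => by
      by_cases hzy : z = y
      · subst hzy; simp [hat_self_of_mem_vertices hz]
      · simpa [hat_of_ne hz (Finset.mem_singleton_self z) (Ne.symm hzy)] using hw0 z hz)
    (by simp [hat_self_of_mem_vertices hy])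
  rw [H.sub hy hw ((P1 K).smul_mem _ hh), H.smul hy hh] at h
  linarith

end MonotoneCoefficients

/-! ### The operators of the scheme -/

theorem MixedDomain.CFamily.continuousOn {A F : Type*} [TopologicalSpace A] [TopologicalSpace F]
    {q : A → Sp d → F} (h : G.CFamily q) (α : A) : ContinuousOn (q α) G.cl :=
  ContinuousOn.comp (g := fun p : A × Sp d => q p.1 p.2) h
    (f := fun x => (α, x)) (by fun_prop) fun _ hx => ⟨mem_univ _, hx⟩

namespace Discretisation

variable {A : Type*} [TopologicalSpace A] {pb : BellmanProblem d A} {S : Discretisation pb}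

theorem opE_eq (S : Discretisation pb) (i : ℕ) (α : A) (w : Sp d → ℝ) (y : Sp d) :
    S.opE i α w y = nodeOp pb.toMixedDomain (S.mesh i) (S.aE i α) (S.bE i α) (S.cE i α)
      (S.bBE i α) (S.cBE i α) 0 w y := by
  rw [opE, nodeOp, zero_mul]
  rfl

theorem opI_eq (S : Discretisation pb) (i : ℕ) (α : A) (w : Sp d → ℝ) (y : Sp d) :
    S.opI i α w y = nodeOp pb.toMixedDomain (S.mesh i) (S.aI i α) (S.bI i α) (S.cI i α)
      (S.bBI i α) (S.cBI i α) 1 w y := by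
  rw [opI, nodeOp, one_mul]
  rfl

/-- Gradients are constant inside elements, so testing the hypotheses at one interior point gives
the elementwise form with `σ = sin θ`. The explicit and implicit operators thereby share one set of
monotonicity lemmas. -/
theorem monotoneCoefficients (hcons : S.ConsistentCoefficients) (hmono : S.ArtificialDiffusion)
    (i : ℕ) : ∃ θ ∈ Ioo (0 : ℝ) (Real.pi / 2), StrictlyAcute (S.mesh i) θ ∧ ∀ α,
      MonotoneCoefficients pb.toMixedDomain (S.mesh i) (Real.sin θ) (S.aE i α) (S.bE i α)
        (S.cE i α) (S.bBE i α) (S.cBE i α) ∧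
      MonotoneCoefficients pb.toMixedDomain (S.mesh i) (Real.sin θ) (S.aI i α) (S.bI i α)
        (S.cI i α) (S.bBI i α) (S.cBI i α) := by
  obtain ⟨θ, hθ, hac, h⟩ := hmono i
  have hK := S.isMesh i
  have hsin : 0 ≤ Real.sin θ :=
    Real.sin_nonneg_of_nonneg_of_le_pi hθ.1.le (by linarith [hθ.2, Real.pi_pos])
  have hacute : ∀ s ∈ elements (S.mesh i), ∀ y ∈ s, ∀ z ∈ s, z ≠ y →
      inner ℝ (grd (S.mesh i) s (hat (S.mesh i) z)) (grd (S.mesh i) s (hat (S.mesh i) y)) ≤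
        -Real.sin θ * ‖grd (S.mesh i) s (hat (S.mesh i) z)‖ *
          ‖grd (S.mesh i) s (hat (S.mesh i) y)‖ :=
    fun s hs y hy z hz hzy => hac.inner_grd_le hK hs hz hy hzy
  refine ⟨θ, hθ, hac, fun α => ⟨⟨hK, hsin, hacute, (hcons.bE_cont i).continuousOn α,
    (hcons.cE_cont i).continuousOn α, hcons.cE_nonneg i α, hcons.cBE_nonneg i α,
    fun y hy hTR => (hcons.cone i α y hy hTR).1, fun y hy hyi => ?_⟩,
    ⟨hK, hsin, hacute, (hcons.bI_cont i).continuousOn α,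
    (hcons.cI_cont i).continuousOn α, hcons.cI_nonneg i α, hcons.cBI_nonneg i α,
    fun y hy hTR => (hcons.cone i α y hy hTR).2, fun y hy hyi => ?_⟩⟩⟩
  · obtain ⟨νE, νI, hE0, hI0, hE, hI, hd⟩ := h α y hy hyi
    refine ⟨νE, hE0, hE, fun s hs hys => ?_⟩
    obtain ⟨x, hx⟩ := interior_simplex_nonempty hs
    simpa only [P1.gradient_eq (nhat_mem_P1 hK y) hs hx] using (hd s hs hys x hx).1
  · obtain ⟨νE, νI, hE0, hI0, hE, hI, hd⟩ := h α y hy hyi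
    refine ⟨νI, hI0, hI, fun s hs hys => ?_⟩
    obtain ⟨x, hx⟩ := interior_simplex_nonempty hs
    simpa only [P1.gradient_eq (nhat_mem_P1 hK y) hs hx] using (hd s hs hys x hx).2

theorem h_pos (S : Discretisation pb) (i : ℕ) : 0 < S.h i :=
  div_pos pb.T_pos (by exact_mod_cast S.n_pos i)

/-- Monotonicity of the explicit step. -/
theorem h_mul_opE_le (hcons : S.ConsistentCoefficients) (hmono : S.ArtificialDiffusion)
    (htime : S.TimeStepRestriction) (i : ℕ) (α : A) (hy : y ∈ (S.mesh i).vertices)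
    (hyi : y ∈ interior pb.cl ∪ pb.bdT) (hw : w ∈ P1 (S.mesh i))
    (hw0 : ∀ z ∈ (S.mesh i).vertices, 0 ≤ w z) : S.h i * S.opE i α w y ≤ w y := by
  obtain ⟨θ, -, -, hM⟩ := monotoneCoefficients hcons hmono i
  have h1 := (hM α).1.le_diagonal_mul (δ := 0) hy hw hw0
  have h2 := htime i α y hy hyi
  rw [opE_eq] at h2 ⊢
  have h3 := hw0 y hy
  have h4 := S.h_pos i
  calc _ ≤ S.h i * (w y * _) := mul_le_mul_of_nonneg_left h1 h4.le
    _ = w y * (S.h i * _) := by ring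
    _ ≤ w y := mul_le_of_le_one_right h3 h2

/-- On this part of the boundary the scheme is fully implicit, so the equation there does not
involve the later time level. -/
theorem opE_of_bdR (hcons : S.ConsistentCoefficients) (i : ℕ) (α : A) (hy : y ∈ pb.bdR)
    (w : Sp d → ℝ) : S.opE i α w y = 0 := by
  obtain ⟨-, -, -, hb, hc, -⟩ := hcons.implicit_R i α y hy
  rw [opE_eq, nodeOp_of_boundary (pb.notMem_interior (Or.inl (Or.inr hy)))
    (pb.notMem_bdD (Or.inr hy)), hb, hc, diniDeriv_zero_left, zero_mul, add_zero]

theorem rhs_nonneg (hcons : S.ConsistentCoefficients) (i : ℕ) (α : A)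
    (hy : y ∈ (S.mesh i).vertices) : 0 ≤ S.rhs i α y := by
  have hyc := (S.isMesh i).vertices_subset hy
  rcases pb.mem_cases hyc with h | ⟨h, hD⟩ | ⟨h, hD, hTR, hf⟩
  · rw [rhs, if_pos h]
    refine setIntegral_nonneg pb.isCompact_cl.measurableSet fun x hx => ?_
    exact mul_nonneg (hcons.fh_nonneg i α x hx) (nhat_nonneg _ _ _)
  · rw [rhs, if_neg h, if_pos hD]
    exact pb.g_nonneg y ⟨subset_closure hyc, h⟩
  · rw [rhs, if_neg h, if_neg hD]
    exact hcons.gh_nonneg i α y hf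

/-- At a Dirichlet node the expression under the supremum does not depend on the control; `Nonempty
A` makes its range a singleton, whose least upper bound must be the zero time difference. -/
theorem eq_g_of_bdD [Nonempty A] {i : ℕ} {v : ℕ → Sp d → ℝ} (hv : S.IsNumericalSolution i v)
    {k : ℕ} (hk : k < S.n i) (hy : y ∈ (S.mesh i).vertices) (hD : y ∈ pb.bdD) :
    v k y = pb.g y := by
  have hni := pb.notMem_interior (Or.inr hD)
  have h := hv.step k hk y hy
  have ht : S.timeDiff i v k y = 0 := by
    rw [timeDiff, if_neg]
    rintro (h' | h')
    · exact hni h'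
    · exact Set.disjoint_left.1 pb.disjoint_TD h' hD
  have hr : (fun α : A => S.opE i α (v (k + 1)) y + S.opI i α (v k) y - S.rhs i α y) =
      fun _ => v k y - pb.g y := by
    funext α
    rw [opE_eq, opI_eq, nodeOp_of_dirichlet hni hD, nodeOp_of_dirichlet hni hD, rhs, if_neg hni,
      if_pos hD]
    ring
  rw [ht, hr, range_const] at h
  have := h.unique isLUB_singleton
  linarith

theorem timeDiff_of_mem {i : ℕ} (hy : y ∈ interior pb.cl ∪ pb.bdT) (v : ℕ → Sp d → ℝ) (k : ℕ) :
    S.timeDiff i v k y = (v (k + 1) y - v k y) / S.h i := if_pos hy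

theorem timeDiff_of_bdR {i : ℕ} (hy : y ∈ pb.bdR) (v : ℕ → Sp d → ℝ) (k : ℕ) :
    S.timeDiff i v k y = 0 := by
  rw [timeDiff, if_neg]
  rintro (h' | h')
  · exact pb.notMem_interior (Or.inl (Or.inr hy)) h'
  · exact Set.disjoint_left.1 pb.disjoint_TR h' hy

theorem mem_node_cases (S : Discretisation pb) (i : ℕ) (hy : y ∈ (S.mesh i).vertices) :
    y ∈ interior pb.cl ∪ pb.bdT ∨ y ∈ pb.bdR ∨ y ∈ pb.bdD := by
  rcases pb.mem_cases ((S.isMesh i).vertices_subset hy) with h | ⟨h, hD⟩ | ⟨h, hD, hTR, hf⟩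
  · exact Or.inl (Or.inl h)
  · exact Or.inr (Or.inr hD)
  · rcases hTR with h | h
    · exact Or.inl (Or.inr h)
    · exact Or.inr (Or.inl h)

/-! ### Discrete minimum principle: nonnegativity and comparison -/

theorem vertices_nonempty (S : Discretisation pb) (i : ℕ) : (S.mesh i).vertices.Nonempty := by
  obtain ⟨x, hx⟩ := pb.nonempty_interior
  obtain ⟨s, hs, -⟩ := (S.isMesh i).exists_element (interior_subset hx)
  obtain ⟨y, hy⟩ := (S.mesh i).nonempty_of_mem_faces hs.1
  exact ⟨y, mem_vertices_of_mem hs.1 hy⟩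

/-- If the minimum of a finite element function over the nodes is nonnegative, so is the
function at the nodes. -/
theorem nonneg_of_min (S : Discretisation pb) (i : ℕ) {e : Sp d → ℝ}
    (h : ∀ y ∈ (S.mesh i).vertices, (∀ z ∈ (S.mesh i).vertices, e y ≤ e z) → 0 ≤ e y) :
    ∀ y ∈ (S.mesh i).vertices, 0 ≤ e y := by
  obtain ⟨y₀, hy₀, hmin⟩ := exists_min_image _ e (S.isMesh i).finite_vertices
    (S.vertices_nonempty i)
  exact fun y hy => (h y₀ hy₀ hmin).trans (hmin y hy)

/-- Numerical solutions are nonnegative. -/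
theorem IsNumericalSolution.nonneg {A : Type*} [MetricSpace A] [CompactSpace A] [Nonempty A]
    {pb : BellmanProblem d A} {S : Discretisation pb} (hcons : S.ConsistentCoefficients)
    (hmono : S.ArtificialDiffusion) (htime : S.TimeStepRestriction) {i : ℕ} {v : ℕ → Sp d → ℝ}
    (hv : S.IsNumericalSolution i v) {k : ℕ} (hk : k ≤ S.n i) :
    ∀ y ∈ (S.mesh i).vertices, 0 ≤ v k y := by
  induction hk using Nat.decreasingInduction with
  | self =>
    intro y hy
    rw [hv.final y hy]
    exact pb.vT_nonneg y ((S.isMesh i).vertices_subset hy)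
  | of_succ k hk ih =>
    refine S.nonneg_of_min i fun y hy hmin => ?_
    by_contra! hneg
    obtain ⟨θ, -, -, hM⟩ := monotoneCoefficients hcons hmono i
    have hstep := hv.step k hk y hy
    have hmem := hv.mem k hk.le
    have hmem' := hv.mem (k + 1) hk
    rcases S.mem_node_cases i hy with h | h | h
    · rw [timeDiff_of_mem h] at hstep
      -- At a negative minimum the implicit part is nonpositive, and the explicit part is at most `v
      -- (k + 1) y / h` by the time step restriction. This bound holds for every control, hence for
      -- the supremum, and it forces `v k y ≥ 0`.
      have hle : (v (k + 1) y - v k y) / S.h i ≤ v (k + 1) y / S.h i := by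
        refine hstep.2 ?_
        rintro _ ⟨α, rfl⟩
        have h1 := h_mul_opE_le hcons hmono htime i α hy h hmem' ih
        have h2 := (hM α).2.nonpos_of_min (δ := 1) hy hmem hmin hneg.le zero_le_one
        rw [← opI_eq] at h2
        have h3 := rhs_nonneg hcons i α hy
        have h4 : S.opE i α (v (k + 1)) y ≤ v (k + 1) y / S.h i := by
          rwa [le_div_iff₀ (S.h_pos i), mul_comm]
        simp only
        linarith
      rw [div_le_div_iff_of_pos_right (S.h_pos i)] at hle
      linarith
    · have hf : y ∈ frontier pb.cl := by rw [← pb.union_eq]; exact Or.inl (Or.inr h)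
      have hcont : Continuous fun α => S.cBI i α y :=
        continuous_iff_continuousAt.2 fun α =>
          ((hcons.cBI_pc i).continuous_control α).tendsto_at hf
      -- The Robin coefficient attains its minimum over the compact control set, so it is positive
      -- uniformly in the control. Without a uniform bound, negative expressions for all controls
      -- could still have supremum zero.
      obtain ⟨α₀, -, hα₀⟩ := isCompact_univ.exists_isMinOn univ_nonempty hcont.continuousOn
      have hc0 := (hcons.implicit_R i α₀ y h).2.2.2.2.2
      rw [timeDiff_of_bdR h] at hstep
      have hle : 0 ≤ S.cBI i α₀ y * v k y := by
        refine hstep.2 ?_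
        rintro _ ⟨α, rfl⟩
        have hni := pb.notMem_interior (Or.inl (Or.inr h))
        have hnD := pb.notMem_bdD (Or.inr h)
        have h2 := (hM α).2.le_of_min (δ := 1) hy hmem hmin
        rw [← opI_eq, nodeOp_of_boundary hni hnD,
          diniDeriv_unit (S.isMesh i) (hcons.cone i α y hy (Or.inr h)).2,
          (S.isMesh i).unit_apply ((S.isMesh i).vertices_subset hy), zero_add, mul_one] at h2
        have h3 := rhs_nonneg hcons i α hy
        have h4 := mul_le_mul_of_nonpos_left (hα₀ (mem_univ α)) hneg.le
        simp only [opE_of_bdR hcons i α h]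
        linarith
      nlinarith
    · rw [eq_g_of_bdD hv hk hy h] at hneg
      refine hneg.not_ge (pb.g_nonneg y ?_)
      rw [← pb.union_eq]; exact Or.inr h

/-- One backward step of the comparison of a numerical solution with a discrete strict
supersolution for one control. -/
theorem IsNumericalSolution.le_of_supersolution [Nonempty A] (hcons : S.ConsistentCoefficients)
    (hmono : S.ArtificialDiffusion) (htime : S.TimeStepRestriction) {i : ℕ} {v : ℕ → Sp d → ℝ}
    (hv : S.IsNumericalSolution i v) {k : ℕ} (hk : k < S.n i) (α : A) {W W' : Sp d → ℝ}
    (hW : W ∈ P1 (S.mesh i)) (hW' : W' ∈ P1 (S.mesh i))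
    (hnext : ∀ y ∈ (S.mesh i).vertices, v (k + 1) y ≤ W' y)
    (hD : ∀ y ∈ (S.mesh i).vertices, y ∈ pb.bdD → pb.g y ≤ W y)
    (hT : ∀ y ∈ (S.mesh i).vertices, y ∈ interior pb.cl ∪ pb.bdT →
      0 < -((W' y - W y) / S.h i) + (S.opE i α W' y + S.opI i α W y) - S.rhs i α y)
    (hR : ∀ y ∈ (S.mesh i).vertices, y ∈ pb.bdR → 0 < S.opI i α W y - S.rhs i α y) :
    ∀ y ∈ (S.mesh i).vertices, v k y ≤ W y := by
  suffices h : ∀ y ∈ (S.mesh i).vertices, 0 ≤ (W - v k) y by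
    exact fun y hy => sub_nonneg.1 (h y hy)
  refine S.nonneg_of_min i fun y hy hmin => ?_
  by_contra! hneg
  obtain ⟨θ, -, -, hM⟩ := monotoneCoefficients hcons hmono i
  have hmem := hv.mem k hk.le
  have hmem' := hv.mem (k + 1) hk
  -- The supremum dominates its value at the single control `α`, so a supersolution for that control
  -- suffices.
  have hstep := (hv.step k hk y hy).1 (mem_range_self α)
  -- At a negative minimum of `W - v k` the implicit operator of the difference is nonpositive,
  -- against which the strict inequality for `W` is played off.
  have h2 := (hM α).2.nonpos_of_min (δ := 1) hy ((P1 _).sub_mem hW hmem) hmin hneg.le zero_le_one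
  rw [(hM α).2.sub hy hW hmem, ← opI_eq, ← opI_eq] at h2
  rcases S.mem_node_cases i hy with h | h | h
  · rw [timeDiff_of_mem h, le_div_iff₀ (S.h_pos i)] at hstep
    have h1 := h_mul_opE_le hcons hmono htime i α hy h ((P1 _).sub_mem hW' hmem')
      (fun z hz => sub_nonneg.2 (hnext z hz))
    rw [opE_eq, (hM α).1.sub hy hW' hmem', ← opE_eq, ← opE_eq] at h1
    have h3 := mul_pos (S.h_pos i) (hT y hy h)
    have h4 : S.h i * (-((W' y - W y) / S.h i) + (S.opE i α W' y + S.opI i α W y) - S.rhs i α y) =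
        -(W' y - W y) + S.h i * (S.opE i α W' y + S.opI i α W y - S.rhs i α y) := by
      have := (S.h_pos i).ne'
      field_simp
      ring
    rw [h4] at h3
    have h5 := mul_nonpos_of_nonneg_of_nonpos (S.h_pos i).le h2
    simp only [Pi.sub_apply] at h1 hneg
    nlinarith
  · rw [timeDiff_of_bdR h, opE_of_bdR hcons i α h] at hstep
    have := hR y hy h
    linarith
  · have := hD y hy h
    rw [← eq_g_of_bdD hv hk hy h] at this
    simp only [Pi.sub_apply] at hneg
    linarith

end Discretisation

end BellmanFEM

namespace BellmanFEM

variable {d : ℕ} {K : Mesh d} {s t : Finset (Sp d)} {x y z : Sp d} {D : Set (Sp d)}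
  {u v w : Sp d → ℝ}

/-! ### Green's formula for hat functions of interior nodes -/

/-- Hat functions of interior nodes are supported in the interior. -/
theorem mem_interior_of_hat_ne_zero (hK : IsMeshOf K D) (hy : y ∈ K.vertices)
    (hyi : y ∈ interior D) (hx : hat K y x ≠ 0) : x ∈ interior D := by
  have hxD : x ∈ D := by
    rw [← hK.space_eq]
    by_contra h
    exact hx (hat_eq_zero_of_notMem_space h y)
  have hpos : 0 < hat K y x := lt_of_le_of_ne (hat_nonneg K y x) hx.symm
  obtain ⟨s, hs, hxs⟩ := hK.exists_element hxD
  have hys : y ∈ s := by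
    by_contra h
    exact hx (hat_eq_zero_of_notMem hs.1 hxs h)
  -- The homothety with centre `y` and ratio `τ` moves `x` close to the interior node `y`. Points
  -- `q` near `x` are then moved into `D`, and the star structure around `y` carries the conclusion
  -- back to `q`.
  obtain ⟨τ, hτD, hτ0, hτ1⟩ : ∃ τ : ℝ, AffineMap.lineMap y x τ ∈ interior D ∧ 0 < τ ∧ τ < 1 := by
    have hc : Tendsto (fun τ : ℝ => AffineMap.lineMap y x τ) (𝓝[>] 0) (𝓝 y) := by
      have h : Continuous fun τ : ℝ => AffineMap.lineMap y x τ := AffineMap.lineMap_continuous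
      have := h.tendsto 0
      rw [AffineMap.lineMap_apply_zero] at this
      exact this.mono_left nhdsWithin_le_nhds
    obtain ⟨τ, h1, h2⟩ := ((hc.eventually (isOpen_interior.mem_nhds hyi)).and
      (Ioo_mem_nhdsGT zero_lt_one)).exists
    exact ⟨τ, h1, h2.1, h2.2⟩
  have hcont : Continuous fun q : Sp d => AffineMap.lineMap y q τ := by
    simp only [AffineMap.lineMap_apply, vsub_eq_sub, vadd_eq_add]
    fun_prop
  have heval : ∀ (L : Sp d →ᵃ[ℝ] ℝ) (q : Sp d),
      L (AffineMap.lineMap y q τ) = τ * (L q - L y) + L y := fun L q => by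
    rw [AffineMap.apply_lineMap, AffineMap.lineMap_apply_ring']
  have hxτs : AffineMap.lineMap y x τ ∈ simplex s :=
    (convex_simplex s).lineMap_mem (mem_simplex_of_mem hys) hxs ⟨hτ0.le, hτ1.le⟩
  have hval : hat K y (AffineMap.lineMap y x τ) = τ * (hat K y x - 1) + 1 := by
    have h1 := hat_eq_coord hs (mem_simplex_of_mem hys) hys
    rw [hat_self hs.1 hys] at h1
    rw [hat_eq_coord hs hxτs hys, heval, ← hat_eq_coord hs hxs hys, ← h1]
  -- An element containing the contracted point of `x` has `y` as a vertex, since the hat function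
  -- is positive there. If it also contains the contracted point of `q`, the coordinates of `q`
  -- belonging to the other vertices are nonnegative by scaling, and the one belonging to `y` is
  -- positive by continuity. So `q` itself is in the element. Other elements are avoided near `x` by
  -- closedness.
  have hel : ∀ e ∈ elements K, ∀ᶠ q in 𝓝 x, AffineMap.lineMap y q τ ∈ simplex e → q ∈ D := by
    intro e he
    by_cases hxe : AffineMap.lineMap y x τ ∈ simplex e
    · have hye : y ∈ e := by
        by_contra h
        rw [hat_eq_zero_of_notMem he.1 hxe h] at hval
        nlinarith
      set L := (elementBasis he).coord ⟨y, hye⟩ with hL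
      have hLy : L y = 1 := by
        rw [hL, ← hat_eq_coord he (mem_simplex_of_mem hye) hye, hat_self he.1 hye]
      have hLx : 0 < L x := by
        rw [hat_eq_coord he hxe hye, ← hL, heval, hLy] at hval
        have : τ * L x = τ * hat K y x := by linarith
        rw [mul_left_cancel₀ hτ0.ne' this]
        exact hpos
      have hLc : Continuous L := L.continuous_of_finiteDimensional
      filter_upwards [hLc.continuousAt.eventually (lt_mem_nhds hLx)] with q hq hqe
      refine hK.simplex_subset he ?_
      rw [simplex_eq_coord_nonneg he] at hqe ⊢
      rintro ⟨z, hz⟩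
      by_cases hzy : z = y
      · subst hzy; exact hq.le
      · have h1 := hqe ⟨z, hz⟩
        have h2 : (elementBasis he).coord ⟨z, hz⟩ y = 0 := by
          rw [← hat_eq_coord he (mem_simplex_of_mem hye) hz, hat_of_ne he.1 hye hzy]
        rw [heval, h2, sub_zero, add_zero] at h1
        exact nonneg_of_mul_nonneg_right h1 hτ0
    · filter_upwards [hcont.continuousAt.eventually
        ((isCompact_simplex e).isClosed.isOpen_compl.mem_nhds hxe)] with q hq hqe
      exact absurd hqe hq
  rw [mem_interior_iff_mem_nhds]
  filter_upwards [(eventually_all_finite hK.finite_elements).2 hel,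
    hcont.continuousAt.eventually (isOpen_interior.mem_nhds hτD)] with q h1 h2
  obtain ⟨e, he, hqe⟩ := hK.exists_element (interior_subset h2)
  exact h1 e he hqe

/-- A function whose pointwise Lipschitz constants are bounded by `L` is Lipschitz. -/
theorem lipschitzWith_of_eventually_abs_sub_le {E : Type*} [NormedAddCommGroup E]
    [NormedSpace ℝ E] {f : E → ℝ} {L : NNReal}
    (h : ∀ x, ∀ᶠ q in 𝓝 x, |f q - f x| ≤ L * ‖q - x‖) : LipschitzWith L f := by
  have hf : Continuous f := by
    refine continuous_iff_continuousAt.2 fun x => ?_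
    rw [ContinuousAt, tendsto_iff_dist_tendsto_zero]
    have h0 : Tendsto (fun q : E => L * ‖q - x‖) (𝓝 x) (𝓝 0) := by
      have : Continuous fun q : E => L * ‖q - x‖ := by fun_prop
      simpa using this.tendsto x
    refine squeeze_zero' (Eventually.of_forall fun _ => dist_nonneg) ?_ h0
    filter_upwards [h x] with q hq
    rwa [Real.dist_eq]
  have key : ∀ p q : E, f q - f p ≤ L * ‖q - p‖ := by
    intro p q
    have hline : Continuous fun τ : ℝ => p + τ • (q - p) := by fun_prop
    -- The growth of `f` along the segment is compared with the linear function of slope `L * ‖q -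
    -- p‖`; the local hypothesis bounds the right slopes.
    have := image_le_of_liminf_slope_right_le_deriv_boundary
      (f := fun τ : ℝ => f (p + τ • (q - p)) - f p) (a := 0) (b := 1)
      (B := fun τ => L * ‖q - p‖ * τ) (B' := fun _ => L * ‖q - p‖)
      ((hf.comp hline).sub continuous_const).continuousOn (by simp) (by fun_prop)
      (fun τ _ => by simpa using ((hasDerivAt_id τ).const_mul (L * ‖q - p‖)).hasDerivWithinAt)
      (fun τ _ r hr => by
        refine Eventually.frequently ?_
        filter_upwards [nhdsWithin_le_nhds (hline.continuousAt.eventually (h _)),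
          self_mem_nhdsWithin] with τ' h1 h2
        have h2 : 0 < τ' - τ := sub_pos.2 h2
        refine lt_of_le_of_lt ?_ hr
        rw [slope_def_field, div_le_iff₀ h2]
        have h3 : p + τ' • (q - p) - (p + τ • (q - p)) = (τ' - τ) • (q - p) := by
          rw [sub_smul]; abel
        rw [h3, norm_smul, Real.norm_eq_abs, abs_of_pos h2] at h1
        have := (le_abs_self _).trans h1
        linarith)
      (right_mem_Icc.2 zero_le_one)
    simpa using this
  refine LipschitzWith.of_dist_le_mul fun p q => ?_
  rw [Real.dist_eq, dist_eq_norm, abs_le]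
  have h1 := key q p
  have h2 := key p q
  rw [norm_sub_rev] at h2
  exact ⟨by linarith, h1⟩

/-- On `D` the elementwise slopes, summed over all elements, bound the local variation. Across the
frontier the zero extension creates no jump, because hat functions of interior nodes vanish outside
the interior of `D`. -/
theorem exists_lipschitzWith_hat (hK : IsMeshOf K D) (hD : IsClosed D) (hy : y ∈ K.vertices)
    (hyi : y ∈ interior D) : ∃ L : NNReal, LipschitzWith L (hat K y) := by
  set E := hK.finite_elements.toFinset
  refine ⟨∑ s ∈ E, ‖grd K s (hat K y)‖₊, lipschitzWith_of_eventually_abs_sub_le fun x => ?_⟩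
  have hL : ∀ e ∈ elements K, ‖grd K e (hat K y)‖ ≤
      ((∑ s ∈ E, ‖grd K s (hat K y)‖₊ : NNReal) : ℝ) := fun e he => by
    push_cast
    exact Finset.single_le_sum (f := fun s => ‖grd K s (hat K y)‖) (fun s _ => norm_nonneg _)
      (hK.finite_elements.mem_toFinset.2 he)
  by_cases hx : x ∈ D
  · have h1 : ∀ᶠ q in 𝓝 x, ∀ e ∈ elements K, q ∈ simplex e → x ∈ simplex e := by
      refine (eventually_all_finite hK.finite_elements).2 fun e he => ?_
      by_cases hxe : x ∈ simplex e
      · exact Eventually.of_forall fun _ _ => hxe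
      · filter_upwards [(isCompact_simplex e).isClosed.isOpen_compl.mem_nhds hxe] with q hq hqe
        exact absurd hqe hq
    have h2 : hat K y x ≠ 0 → ∀ᶠ q in 𝓝 x, q ∈ D := fun h =>
      mem_interior_iff_mem_nhds.1 (mem_interior_of_hat_ne_zero hK hy hyi h)
    have h3 : ∀ᶠ q in 𝓝 x, hat K y x ≠ 0 → q ∈ D := by
      by_cases h : hat K y x = 0
      · exact Eventually.of_forall fun _ h' => absurd h h'
      · filter_upwards [h2 h] with q hq _ using hq
    filter_upwards [h1, h3] with q hq1 hq3
    by_cases hq : q ∈ D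
    · obtain ⟨e, he, hqe⟩ := hK.exists_element hq
      rw [P1.sub_eq_inner (hat_mem_P1 hK y) he hqe (hq1 e he hqe)]
      exact (abs_real_inner_le_norm _ _).trans
        (mul_le_mul_of_nonneg_right (hL e he) (norm_nonneg _))
    · have h0 : hat K y x = 0 := by
        by_contra h
        exact hq (hq3 h)
      rw [h0, hat_eq_zero_of_notMem_space (by rwa [hK.space_eq]), sub_zero, abs_zero]
      positivity
  · filter_upwards [hD.isOpen_compl.mem_nhds hx] with q hq
    rw [hat_eq_zero_of_notMem_space (by rwa [hK.space_eq]),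
      hat_eq_zero_of_notMem_space (by rwa [hK.space_eq]), sub_zero, abs_zero]
    positivity

/-! ### Smooth functions in coordinates and Green's formula -/

theorem laplacian_eq_sum_fderiv (u : Sp d → ℝ) (x : Sp d) : Laplacian.laplacian u x =
    ∑ j, fderiv ℝ (fderiv ℝ u) x (EuclideanSpace.basisFun (Fin d) ℝ j)
      (EuclideanSpace.basisFun (Fin d) ℝ j) := by
  rw [InnerProductSpace.laplacian_eq_iteratedFDeriv_orthonormalBasis u
    (EuclideanSpace.basisFun (Fin d) ℝ)]
  simp [iteratedFDeriv_two_apply]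

theorem inner_gradient_left (u : Sp d → ℝ) (x p : Sp d) :
    inner ℝ (gradient u x) p = fderiv ℝ u x p := by
  rw [gradient, InnerProductSpace.toDual_symm_apply]

theorem continuous_gradient {n : WithTop ℕ∞} (hu : ContDiff ℝ n u) (hn : 1 ≤ n) :
    Continuous (gradient u) :=
  (InnerProductSpace.toDual ℝ (Sp d)).symm.continuous.comp
    (hu.continuous_fderiv (fun h => by simp [h] at hn))

theorem continuous_laplacian (hu : ContDiff ℝ 2 u) :
    Continuous (Laplacian.laplacian u : Sp d → ℝ) := by
  have h1 : ContDiff ℝ 1 (fderiv ℝ u) := hu.fderiv_right (by norm_num)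
  have h2 : Continuous (fderiv ℝ (fderiv ℝ u)) := h1.continuous_fderiv (by norm_num)
  have : (Laplacian.laplacian u : Sp d → ℝ) = fun x => _ := funext (laplacian_eq_sum_fderiv u)
  rw [this]
  fun_prop

/-- Green's formula: for an interior node there is no boundary term. -/
theorem integral_inner_gradient_nhat (hK : IsMeshOf K D) (hD : IsClosed D) (hy : y ∈ K.vertices)
    (hyi : y ∈ interior D) (hu : ContDiff ℝ 2 u) (hsupp : HasCompactSupport u) :
    ∫ x in D, inner ℝ (gradient u x) (gradient (nhat K y) x) =
      ∫ x in D, -Laplacian.laplacian u x * nhat K y x := by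
  set e := EuclideanSpace.basisFun (Fin d) ℝ
  have hn := nhat_mem_P1 hK y
  have hu1 : ContDiff ℝ 1 (fderiv ℝ u) := hu.fderiv_right (by norm_num)
  have hnout : ∀ x ∉ D, nhat K y x = 0 := fun x hx => by
    rw [nhat, hat_eq_zero_of_notMem_space (by rwa [hK.space_eq]), zero_div]
  obtain ⟨L, hL⟩ : ∃ L : NNReal, LipschitzWith L (nhat K y) := by
    obtain ⟨L, hL⟩ := exists_lipschitzWith_hat hK hD hy hyi
    refine ⟨‖(∫ z in K.space, |hat K y z|)⁻¹‖₊ * L, ?_⟩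
    rw [nhat_eq_smul]
    exact (lipschitzWith_smul _).comp hL
  have hj : ∀ j, ∫ x in D, fderiv ℝ u x (e j) * inner ℝ (e j) (gradient (nhat K y) x) =
      ∫ x in D, -(fderiv ℝ (fderiv ℝ u) x (e j) (e j)) * nhat K y x := by
    intro j
    have hc1 : ContDiff ℝ 1 fun x => fderiv ℝ u x (e j) := hu1.clm_apply contDiff_const
    have hcs : HasCompactSupport fun x => fderiv ℝ u x (e j) := hsupp.fderiv_apply ℝ (e j)
    obtain ⟨C, hC⟩ := hc1.lipschitzWith_of_hasCompactSupport hcs (by norm_num)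
    -- Integration by parts takes place on the whole space between a Lipschitz function and a
    -- compactly supported Lipschitz function, so there is no boundary term. The support of `nhat`
    -- restricts both sides to `D`.
    have hibp := hL.integral_lineDeriv_mul_eq (μ := volume) hC hcs (e j)
    have hl : ∫ x, lineDeriv ℝ (nhat K y) x (e j) * fderiv ℝ u x (e j) =
        ∫ x in D, fderiv ℝ u x (e j) * inner ℝ (e j) (gradient (nhat K y) x) := by
      rw [← setIntegral_eq_integral_of_forall_compl_eq_zero (s := D)]
      · refine integral_congr_ae ?_
        filter_upwards [hK.ae_mem_interior] with x ⟨s, hs, hx⟩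
        have hg := P1.hasGradientAt hn hs hx
        rw [hg.gradient, hg.differentiableAt.lineDeriv_eq_fderiv, hg.hasFDerivAt.fderiv,
          InnerProductSpace.toDual_apply_apply, real_inner_comm, mul_comm]
      · intro x hx
        have : nhat K y =ᶠ[𝓝 x] fun _ => 0 := by
          filter_upwards [hD.isOpen_compl.mem_nhds hx] with q hq using hnout q hq
        rw [this.lineDeriv_eq]
        simp [lineDeriv]
    have hr : ∫ x, lineDeriv ℝ (fun x => fderiv ℝ u x (e j)) x (-e j) * nhat K y x =
        ∫ x in D, -(fderiv ℝ (fderiv ℝ u) x (e j) (e j)) * nhat K y x := by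
      rw [← setIntegral_eq_integral_of_forall_compl_eq_zero (s := D)]
      · congr 1
        funext x
        have hd := (hu1.differentiable (by norm_num) x).hasFDerivAt.clm_apply
          (hasFDerivAt_const (e j) x)
        rw [hd.differentiableAt.lineDeriv_eq_fderiv, hd.fderiv]
        simp
      · exact fun x hx => by rw [hnout x hx, mul_zero]
    rw [← hl, ← hr, hibp]
  have hfc : ∀ j, ContinuousOn (fun x => fderiv ℝ u x (e j)) D := fun j =>
    (hu1.continuous.clm_apply continuous_const).continuousOn
  have hffc : ∀ j, ContinuousOn (fun x => fderiv ℝ (fderiv ℝ u) x (e j) (e j)) D := fun j =>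
    (((hu1.continuous_fderiv (by norm_num)).clm_apply continuous_const).clm_apply
      continuous_const).continuousOn
  calc ∫ x in D, inner ℝ (gradient u x) (gradient (nhat K y) x)
      = ∫ x in D, ∑ j, fderiv ℝ u x (e j) * inner ℝ (e j) (gradient (nhat K y) x) := by
        congr 1
        funext x
        rw [← e.sum_inner_mul_inner]
        exact Finset.sum_congr rfl fun j _ => by rw [inner_gradient_left]
    _ = ∑ j, ∫ x in D, fderiv ℝ u x (e j) * inner ℝ (e j) (gradient (nhat K y) x) :=
        integral_finsetSum _ fun j _ => ((PwCont.of_continuousOn hK (hfc j)).mul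
          ((PwCont.const (e j)).inner (PwCont.gradient hn))).integrableOn hK
    _ = ∑ j, ∫ x in D, -(fderiv ℝ (fderiv ℝ u) x (e j) (e j)) * nhat K y x :=
        Finset.sum_congr rfl fun j _ => hj j
    _ = ∫ x in D, ∑ j, -(fderiv ℝ (fderiv ℝ u) x (e j) (e j)) * nhat K y x :=
        (integral_finsetSum _ fun j _ => ((PwCont.of_continuousOn hK (hffc j)).neg.mul
          (pwCont_nhat hK y)).integrableOn hK).symm
    _ = ∫ x in D, -Laplacian.laplacian u x * nhat K y x := by
        congr 1
        funext x
        rw [laplacian_eq_sum_fderiv, ← Finset.sum_mul, Finset.sum_neg_distrib]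

end BellmanFEM

namespace BellmanFEM

variable {E : Type*} [NormedAddCommGroup E] [InnerProductSpace ℝ E] [FiniteDimensional ℝ E]

/-! ### Approximation by smooth functions -/

open scoped Convolution ContDiff

theorem exists_bump_rOut_le (E : Type*) [NormedAddCommGroup E] {η : ℝ} (hη : 0 < η) :
    ∃ φ : ContDiffBump (0 : E), φ.rOut ≤ η :=
  ⟨⟨η / 2, η, by positivity, by linarith⟩, le_rfl⟩

/-- Multiplication with a cut-off function. -/
theorem exists_compactSupport_eventuallyEq {n : ℕ∞} {f : E → ℝ} (hf : ContDiff ℝ n f)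
    {C : Set (E)} (hC : IsCompact C) :
    ∃ f' : E → ℝ, ContDiff ℝ n f' ∧ HasCompactSupport f' ∧ ∀ x ∈ C, f' =ᶠ[𝓝 x] f := by
  obtain ⟨R, hR⟩ := hC.isBounded.subset_ball 0
  set ρ := max R 1
  let χ : ContDiffBump (0 : E) := ⟨ρ, ρ + 1, by positivity, by linarith⟩
  refine ⟨fun x => χ x * f x, χ.contDiff.mul hf, χ.hasCompactSupport.mul_right, fun x hx => ?_⟩
  have hx' : x ∈ Metric.ball (0 : E) ρ := Metric.ball_subset_ball (le_max_left _ _) (hR hx)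
  filter_upwards [Metric.isOpen_ball.mem_nhds hx'] with z hz
  rw [χ.one_of_mem_closedBall (Metric.ball_subset_closedBall hz), one_mul]

variable [MeasurableSpace E] [BorelSpace E]

/-- A continuous compactly supported function is uniformly continuous, and a normalised mollifier
averages values at distance at most `rOut`. The threshold does not depend on the bump, so several
such estimates can share one. -/
theorem eventually_dist_normed_convolution_le {F : Type*} [NormedAddCommGroup F] [NormedSpace ℝ F]
    [CompleteSpace F] {f : E → F} (hf : Continuous f) (hc : HasCompactSupport f) {δ : ℝ}
    (hδ : 0 < δ) : ∃ η > 0, ∀ φ : ContDiffBump (0 : E), φ.rOut ≤ η → ∀ x,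
      dist ((φ.normed volume ⋆[ContinuousLinearMap.lsmul ℝ ℝ, volume] f) x) (f x) ≤ δ := by
  obtain ⟨η, hη, h⟩ := Metric.uniformContinuous_iff.1 (hf.uniformContinuous_of_tendsto_cocompact
    hc.is_zero_at_infty) δ hδ
  refine ⟨η, hη, fun φ hφ x => φ.dist_normed_convolution_le hf.aestronglyMeasurable fun z hz => ?_⟩
  exact (h (lt_of_lt_of_le hz hφ)).le

/-- Mollification commutes with differentiation. Applied to a function and then to its derivative,
this reduces closeness of first and second derivatives to the uniform estimate for mollified
functions. -/
theorem fderiv_normed_convolution {F : Type*} [NormedAddCommGroup F] [NormedSpace ℝ F]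
    [CompleteSpace F] {f : E → F} (hf : ContDiff ℝ 1 f) (hc : HasCompactSupport f)
    (φ : ContDiffBump (0 : E)) :
    fderiv ℝ (φ.normed volume ⋆[ContinuousLinearMap.lsmul ℝ ℝ, volume] f) =
      φ.normed volume ⋆[ContinuousLinearMap.lsmul ℝ ℝ, volume] (fderiv ℝ f) := by
  have hL : (ContinuousLinearMap.lsmul ℝ ℝ : ℝ →L[ℝ] F →L[ℝ] F).precompR (E) =
      ContinuousLinearMap.lsmul ℝ ℝ := by
    ext; simp
  funext x
  rw [(hc.hasFDerivAt_convolution_right (ContinuousLinearMap.lsmul ℝ ℝ)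
    φ.continuous_normed.locallyIntegrable hf x).fderiv, hL]

theorem contDiff_normed_convolution {f : E → ℝ} (hf : Continuous f) (hc : HasCompactSupport f)
    (φ : ContDiffBump (0 : E)) :
    ContDiff ℝ ∞ (φ.normed volume ⋆[ContinuousLinearMap.lsmul ℝ ℝ, volume] f) ∧
      HasCompactSupport (φ.normed volume ⋆[ContinuousLinearMap.lsmul ℝ ℝ, volume] f) :=
  ⟨φ.hasCompactSupport_normed.contDiff_convolution_left _ φ.contDiff_normed hf.locallyIntegrable,
    φ.hasCompactSupport_normed.convolution _ hc⟩

theorem exists_smooth_approx {f : E → ℝ} (hf : Continuous f) {C : Set (E)}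
    (hC : IsCompact C) {δ : ℝ} (hδ : 0 < δ) :
    ∃ u : E → ℝ, ContDiff ℝ ∞ u ∧ HasCompactSupport u ∧ ∀ x ∈ C, |u x - f x| ≤ δ := by
  obtain ⟨f', h1, h2, h3⟩ := exists_compactSupport_eventuallyEq (n := 0)
    (by exact_mod_cast (contDiff_zero (𝕜 := ℝ)).2 hf) hC
  have h1 : Continuous f' := h1.continuous
  obtain ⟨η, hη, h⟩ := eventually_dist_normed_convolution_le h1 h2 hδ
  obtain ⟨φ, hφ⟩ := exists_bump_rOut_le E hη
  obtain ⟨h4, h5⟩ := contDiff_normed_convolution h1 h2 φ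
  refine ⟨_, h4, h5, fun x hx => ?_⟩
  rw [← (h3 x hx).eq_of_nhds, ← Real.dist_eq]
  exact h φ hφ x

theorem eventually_norm_fderiv_normed_convolution_sub_le {F : Type*} [NormedAddCommGroup F]
    [NormedSpace ℝ F] [CompleteSpace F] {f : E → F} (hf : ContDiff ℝ 1 f)
    (hc : HasCompactSupport f) {δ : ℝ} (hδ : 0 < δ) :
    ∃ η > 0, ∀ φ : ContDiffBump (0 : E), φ.rOut ≤ η → ∀ x p, ‖p‖ = 1 →
      ‖fderiv ℝ (φ.normed volume ⋆[ContinuousLinearMap.lsmul ℝ ℝ, volume] f) x p -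
        fderiv ℝ f x p‖ ≤ δ := by
  obtain ⟨η, hη, h⟩ := eventually_dist_normed_convolution_le
    (hf.continuous_fderiv (by norm_num)) (hc.fderiv ℝ) hδ
  refine ⟨η, hη, fun φ hφ x p hp => ?_⟩
  have h1 := h φ hφ x
  rw [← fderiv_normed_convolution hf hc, dist_eq_norm] at h1
  have h2 := (fderiv ℝ (φ.normed volume ⋆[ContinuousLinearMap.lsmul ℝ ℝ, volume] f) x -
    fderiv ℝ f x).le_opNorm p
  rw [hp, mul_one] at h2
  exact h2.trans h1

theorem exists_smooth_approx_fderiv {f : E → ℝ} (hf : ContDiff ℝ 2 f) {C : Set E}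
    (hC : IsCompact C) {δ : ℝ} (hδ : 0 < δ) :
    ∃ u : E → ℝ, ContDiff ℝ ∞ u ∧ HasCompactSupport u ∧ ∀ x ∈ C, |u x - f x| ≤ δ ∧
      ‖fderiv ℝ u x - fderiv ℝ f x‖ ≤ δ ∧ ∀ p, ‖p‖ = 1 →
        |fderiv ℝ (fderiv ℝ u) x p p - fderiv ℝ (fderiv ℝ f) x p p| ≤ δ := by
  obtain ⟨f', h1, h2, h3⟩ := exists_compactSupport_eventuallyEq (n := 2) (by exact_mod_cast hf) hC
  have h1 : ContDiff ℝ 2 f' := by exact_mod_cast h1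
  have hf1 : ContDiff ℝ 1 (fderiv ℝ f') := h1.fderiv_right (by norm_num)
  have hc1 : HasCompactSupport (fderiv ℝ f') := h2.fderiv ℝ
  obtain ⟨η0, hη0, H0⟩ := eventually_dist_normed_convolution_le h1.continuous h2 hδ
  obtain ⟨η1, hη1, H1⟩ := eventually_dist_normed_convolution_le hf1.continuous hc1 hδ
  obtain ⟨η2, hη2, H2⟩ := eventually_norm_fderiv_normed_convolution_sub_le hf1 hc1 hδ
  obtain ⟨φ, hφ⟩ := exists_bump_rOut_le E (lt_min hη0 (lt_min hη1 hη2))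
  obtain ⟨h4, h5⟩ := contDiff_normed_convolution h1.continuous h2 φ
  have H0 := H0 φ (hφ.trans (min_le_left _ _))
  have H1 := H1 φ (hφ.trans ((min_le_right _ _).trans (min_le_left _ _)))
  have H2 := H2 φ (hφ.trans ((min_le_right _ _).trans (min_le_right _ _)))
  -- The mollified derivative is the derivative of the mollification, so the estimates for `fderiv ℝ
  -- f'` become estimates for the first and second derivatives of one and the same smooth function.
  rw [← fderiv_normed_convolution (h1.of_le (by norm_num)) h2] at H2
  rw [← fderiv_normed_convolution (h1.of_le (by norm_num)) h2] at H1
  generalize (φ.normed volume ⋆[ContinuousLinearMap.lsmul ℝ ℝ, volume] f') = u at *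
  refine ⟨u, h4, h5, fun x hx => ⟨?_, ?_, ?_⟩⟩
  · rw [← (h3 x hx).eq_of_nhds, ← Real.dist_eq]
    exact H0 x
  · rw [← (h3 x hx).fderiv_eq, ← dist_eq_norm]
    exact H1 x
  · intro p hp
    -- The cut-off function agrees with `f` on a neighbourhood of `x`, hence so do all derivatives
    -- at `x`.
    rw [← (h3 x hx).fderiv.fderiv_eq]
    have h := (fderiv ℝ (fderiv ℝ u) x p - fderiv ℝ (fderiv ℝ f') x p).le_opNorm p
    rw [hp, mul_one] at h
    exact h.trans (H2 x p hp)

variable {d : ℕ}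

theorem norm_gradient_sub (u f : Sp d → ℝ) (x : Sp d) :
    ‖gradient u x - gradient f x‖ = ‖fderiv ℝ u x - fderiv ℝ f x‖ := by
  rw [gradient, gradient, ← map_sub, LinearIsometryEquiv.norm_map]

theorem exists_smooth_approx_C2 {f : Sp d → ℝ} (hf : ContDiff ℝ 2 f) {C : Set (Sp d)}
    (hC : IsCompact C) {δ : ℝ} (hδ : 0 < δ) :
    ∃ u : Sp d → ℝ, ContDiff ℝ ∞ u ∧ HasCompactSupport u ∧ ∀ x ∈ C, |u x - f x| ≤ δ ∧
      ‖gradient u x - gradient f x‖ ≤ δ ∧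
      |Laplacian.laplacian u x - Laplacian.laplacian f x| ≤ δ := by
  -- The Laplacian is a sum of `d` second derivatives; using `d + 1` also covers dimension zero.
  have hδ' : 0 < δ / (d + 1) := by positivity
  have hle : δ / (d + 1) ≤ δ := div_le_self hδ.le (by simp)
  obtain ⟨u, h1, h2, h3⟩ := exists_smooth_approx_fderiv hf hC hδ'
  refine ⟨u, h1, h2, fun x hx => ?_⟩
  obtain ⟨h4, h5, h6⟩ := h3 x hx
  refine ⟨h4.trans hle, (norm_gradient_sub u f x).trans_le (h5.trans hle), ?_⟩
  rw [laplacian_eq_sum_fderiv, laplacian_eq_sum_fderiv, ← Finset.sum_sub_distrib]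
  refine (Finset.abs_sum_le_sum_abs _ _).trans ((Finset.sum_le_sum fun j _ =>
    h6 _ ((EuclideanSpace.basisFun (Fin d) ℝ).norm_eq_one j)).trans ?_)
  rw [Finset.sum_const, Finset.card_univ, Fintype.card_fin, nsmul_eq_mul]
  calc (d : ℝ) * (δ / (d + 1)) = δ * (d / (d + 1)) := by ring
    _ ≤ δ := mul_le_of_le_one_right hδ.le ((div_le_one (by positivity)).2 (by linarith))

end BellmanFEM

namespace BellmanFEM

open scoped ContDiff

variable {d : ℕ} {K : Mesh d} {s t : Finset (Sp d)} {x y : Sp d} {D : Set (Sp d)}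
  {u v w z Z : Sp d → ℝ}

/-! ### Approximation in `W^{1,∞}` -/

/-- `Z` is a finite element function which is `δ`-close to `z`, with elementwise gradients. -/
structure IsApprox (K : Mesh d) (D : Set (Sp d)) (Z z : Sp d → ℝ) (δ : ℝ) : Prop where
  mem : Z ∈ P1 K
  abs_sub_le : ∀ x ∈ D, |Z x - z x| ≤ δ
  norm_grd_sub_le : ∀ s ∈ elements K, ∀ x ∈ simplex s, ‖grd K s Z - gradient z x‖ ≤ δ

/-- The inequality is the almost everywhere identity `max f δ = δ` between continuous functions,
which holds everywhere on an open set. -/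
theorem le_of_ae_le_of_isOpen {U : Set (Sp d)} (hU : IsOpen U) {f : Sp d → ℝ}
    (hf : ContinuousOn f U) {δ : ℝ} (h : ∀ᵐ x ∂volume.restrict U, f x ≤ δ) :
    ∀ x ∈ U, f x ≤ δ := by
  have h1 : (fun x => max (f x) δ) =ᵐ[volume.restrict U] fun _ => δ := by
    filter_upwards [h] with x hx using max_eq_right hx
  have h2 := Measure.eqOn_open_of_ae_eq h1 hU (hf.sup continuousOn_const) continuousOn_const
  exact fun x hx => max_eq_right_iff.1 (h2 hx)

theorem le_on_simplex_of_ae_le (hK : IsMeshOf K D) (hs : s ∈ elements K) {f : Sp d → ℝ}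
    (hf : ContinuousOn f (simplex s)) {δ : ℝ}
    (h : ∀ᵐ x ∂volume.restrict D, x ∈ interior (simplex s) → f x ≤ δ) :
    ∀ x ∈ simplex s, f x ≤ δ := by
  have h1 : ∀ x ∈ interior (simplex s), f x ≤ δ := by
    refine le_of_ae_le_of_isOpen isOpen_interior (hf.mono interior_subset) ?_
    filter_upwards [ae_restrict_of_ae_restrict_of_subset
      (interior_subset.trans (hK.simplex_subset hs)) h,
      ae_restrict_mem isOpen_interior.measurableSet] with x hx1 hx2 using hx1 hx2
  intro x hx
  rw [← closure_interior_simplex hs] at hx hf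
  exact le_on_closure h1 hf continuousOn_const hx

theorem ae_norm_le_of_eLpNorm_top_le {F : Type*} [NormedAddCommGroup F] {f : Sp d → F}
    {μ : Measure (Sp d)} {δ : ℝ} (hδ : 0 ≤ δ) (h : eLpNorm f ∞ μ ≤ ENNReal.ofReal δ) :
    ∀ᵐ x ∂μ, ‖f x‖ ≤ δ := by
  rw [eLpNorm_exponent_top] at h
  filter_upwards [ae_le_eLpNormEssSup (f := f) (μ := μ)] with x hx
  have := hx.trans h
  rwa [← ofReal_norm, ENNReal.ofReal_le_ofReal_iff hδ] at this

/-- On each element the finite element gradient is constant and `z` is smooth, so the almost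
everywhere bounds hold inside by continuity and extend to the closed element. This makes the
gradient bound usable at boundary nodes. -/
theorem isApprox_of_w1infNorm_le (hK : IsMeshOf K D) (hZ : Z ∈ P1 K) (hz : ContDiff ℝ ∞ z)
    {δ : ℝ} (hδ : 0 ≤ δ) (h : w1infNorm D (Z - z) ≤ ENNReal.ofReal δ) : IsApprox K D Z z δ := by
  have h0 := ae_norm_le_of_eLpNorm_top_le hδ (le_self_add.trans h)
  have h1 := ae_norm_le_of_eLpNorm_top_le hδ (le_add_self.trans h)
  refine ⟨hZ, fun x hx => ?_, fun s hs => ?_⟩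
  · obtain ⟨s, hs, hxs⟩ := hK.exists_element hx
    refine le_on_simplex_of_ae_le hK hs (f := fun x => |Z x - z x|)
      ((P1.continuousOn_simplex hZ hs).sub hz.continuous.continuousOn).abs ?_ x hxs
    filter_upwards [h0] with x hx _ using hx
  · refine le_on_simplex_of_ae_le hK hs
      (continuousOn_const.sub (continuous_gradient hz (by simp)).continuousOn).norm ?_
    filter_upwards [h1] with x hx hxs
    have h2 : HasGradientAt (Z - z) (grd K s Z - gradient z x) x := by
      have := (P1.hasGradientAt hZ hs hxs).hasFDerivAt.sub
        ((hz.differentiable (by simp)) x).hasGradientAt.hasFDerivAt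
      rwa [← map_sub] at this
    rwa [h2.gradient] at hx

/-- The one-sided derivative only sees the gradient of the element in which the segment starts, and
that gradient is close to the one of `z` up to the vertex. -/
theorem IsApprox.abs_diniDeriv_add_le {δ : ℝ} (hK : IsMeshOf K D) (h : IsApprox K D Z z δ)
    {p : Sp d} (hp : p ∈ tangentDirections D y) :
    |diniDeriv p Z y + inner ℝ (gradient z y) p| ≤ δ * ‖p‖ := by
  obtain ⟨s, hs, hy, Λ, hΛ, hseg⟩ := hK.exists_element_segment hp
  have h1 : diniDeriv p Z y + inner ℝ (gradient z y) p =
      -inner ℝ (grd K s Z - gradient z y) p := by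
    rw [diniDeriv_eq h.mem hs hy hΛ hseg, inner_sub_left]
    ring
  rw [h1, abs_neg]
  exact (abs_real_inner_le_norm _ _).trans
    (mul_le_mul_of_nonneg_right (h.norm_grd_sub_le s hs y hy) (norm_nonneg p))

namespace Discretisation

variable {A : Type*} [TopologicalSpace A] {pb : BellmanProblem d A} {S : Discretisation pb}

/-- A sequence of elliptic projections of `z`. -/
structure IsProjSeq (S : Discretisation pb) (z : Sp d → ℝ) (Z : ℕ → Sp d → ℝ) : Prop where
  smooth : ContDiff ℝ ∞ z
  compact : HasCompactSupport z
  mem : ∀ i, Z i ∈ P1 (S.mesh i)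
  orth : ∀ i, ∀ y ∈ (S.mesh i).vertices, y ∈ interior pb.cl →
    ∫ x in pb.cl, inner ℝ (gradient (Z i) x) (gradient (nhat (S.mesh i) y) x) =
      ∫ x in pb.cl, inner ℝ (gradient z x) (gradient (nhat (S.mesh i) y) x)
  approx : ∀ δ > 0, ∀ᶠ i in atTop, IsApprox (S.mesh i) pb.cl (Z i) z δ

theorem HasEllipticProjections.exists_isProjSeq (h : S.HasEllipticProjections)
    (hz : ContDiff ℝ ∞ z) (hc : HasCompactSupport z) : ∃ Z, S.IsProjSeq z Z := by
  obtain ⟨P, horth, -, hconv⟩ := h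
  refine ⟨fun i => P i ⟨z, hz⟩, hz, hc, fun i => (P i ⟨z, hz⟩).2,
    fun i y hy hyi => horth i ⟨z, hz⟩ y hy hyi, fun δ hδ => ?_⟩
  filter_upwards [(hconv ⟨z, hz⟩).eventually
    (eventually_le_nhds (ENNReal.ofReal_pos.2 hδ))] with i hi
  exact isApprox_of_w1infNorm_le (S.isMesh i) (P i ⟨z, hz⟩).2 hz hδ.le hi

/-! ### Consistency at interior nodes -/

theorem mem_tsupport_nhat (hK : IsMeshOf K D) (hs : s ∈ elements K) (hy : y ∈ s)
    (hx : x ∈ interior (simplex s)) : x ∈ tsupport (nhat K y) := by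
  refine subset_tsupport _ ?_
  rw [Function.mem_support, nhat]
  exact (div_pos (hat_pos_of_mem_interior hs hx hy)
    (integral_abs_hat_pos hK (mem_vertices_of_mem hs.1 hy))).ne'

theorem self_mem_tsupport_nhat (hK : IsMeshOf K D) (hy : y ∈ K.vertices) :
    y ∈ tsupport (nhat K y) := by
  refine subset_tsupport _ ?_
  rw [Function.mem_support, nhat, hat_self_of_mem_vertices hy]
  exact (div_pos one_pos (integral_abs_hat_pos hK hy)).ne'

/-- For elliptic projections the weak operators are averages of second order operators. -/
theorem IsProjSeq.weakOp_eq {Z : ℕ → Sp d → ℝ} (h : S.IsProjSeq z Z) (i : ℕ)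
    (hy : y ∈ (S.mesh i).vertices) (hyi : y ∈ interior pb.cl) {a : ℝ} {b : Sp d → Sp d}
    {c : Sp d → ℝ} (hb : ContinuousOn b pb.cl) (hc : ContinuousOn c pb.cl) :
    weakOp (S.mesh i) pb.cl a b c (Z i) y = ∫ x in pb.cl, (-(a * Laplacian.laplacian z x) +
      (-inner ℝ (b x) (gradient (Z i) x) + c x * Z i x)) * nhat (S.mesh i) y x := by
  have hK := S.isMesh i
  have hz2 : ContDiff ℝ 2 z := contDiff_infty.1 h.smooth 2
  have hl : PwCont (S.mesh i) (Laplacian.laplacian z : Sp d → ℝ) :=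
    PwCont.of_continuousOn hK (continuous_laplacian hz2).continuousOn
  rw [weakOp, h.orth i y hy hyi, integral_inner_gradient_nhat hK pb.isCompact_cl.isClosed hy hyi
    hz2 h.compact, ← integral_const_mul, ← integral_add]
  · congr 1
    funext x
    ring
  · exact ((PwCont.const a).mul (hl.neg.mul (pwCont_nhat hK y))).integrableOn hK
  · exact ((pwCont_lowerOrder hK hb hc (h.mem i)).mul (pwCont_nhat hK y)).integrableOn hK

theorem IsProjSeq.pwCont {Z : ℕ → Sp d → ℝ} (h : S.IsProjSeq z Z) (i : ℕ) (a : ℝ)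
    {b : Sp d → Sp d} {c : Sp d → ℝ} (hb : ContinuousOn b pb.cl) (hc : ContinuousOn c pb.cl) :
    PwCont (S.mesh i) fun x => -(a * Laplacian.laplacian z x) +
      (-inner ℝ (b x) (gradient (Z i) x) + c x * Z i x) := by
  have hz2 : ContDiff ℝ 2 z := contDiff_infty.1 h.smooth 2
  have hl : PwCont (S.mesh i) (Laplacian.laplacian z : Sp d → ℝ) :=
    PwCont.of_continuousOn (S.isMesh i) (continuous_laplacian hz2).continuousOn
  exact ((PwCont.const a).mul hl).neg.add (pwCont_lowerOrder (S.isMesh i) hb hc (h.mem i))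

end Discretisation

/-- The linear operator `-aᵅ Δz - bᵅ·∇z + cᵅ z`. -/
noncomputable def BellmanProblem.lin {A : Type*} [TopologicalSpace A] (pb : BellmanProblem d A)
    (α : A) (z : Sp d → ℝ) (x : Sp d) : ℝ :=
  -(pb.a α x * Laplacian.laplacian z x) - inner ℝ (pb.b α x) (gradient z x) + pb.c α x * z x

/-- The linear boundary operator `-b·∇z + c z`. -/
noncomputable def BellmanProblem.linB {A : Type*} [TopologicalSpace A] (pb : BellmanProblem d A)
    (α : A) (z : Sp d → ℝ) (x : Sp d) : ℝ :=
  -inner ℝ (pb.bB α x) (gradient z x) + pb.cB α x * z x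

namespace Discretisation

variable {A : Type*} [TopologicalSpace A] {pb : BellmanProblem d A} {S : Discretisation pb}
  {α : A} {Z : ℕ → Sp d → ℝ}

theorem continuousOn_lin (hz : ContDiff ℝ 2 z) : ContinuousOn (pb.lin α z) pb.cl := by
  have h1 := pb.a_cont.continuousOn α
  have h2 := pb.b_cont.continuousOn α
  have h3 := pb.c_cont.continuousOn α
  have h4 : ContinuousOn (Laplacian.laplacian z : Sp d → ℝ) pb.cl :=
    (continuous_laplacian hz).continuousOn
  have h5 : ContinuousOn (gradient z) pb.cl := (continuous_gradient hz (by norm_num)).continuousOn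
  exact ((h1.mul h4).neg.sub (h2.inner (𝕜 := ℝ) h5)).add (h3.mul hz.continuous.continuousOn)

/-- A common bound for the coefficients and for `z`. -/
theorem exists_bound (pb : BellmanProblem d A) (α : A) (hz : ContDiff ℝ ∞ z) :
    ∃ M : ℝ, 0 ≤ M ∧ (∀ x ∈ pb.cl, |pb.a α x| ≤ M ∧ ‖pb.b α x‖ ≤ M ∧ |pb.c α x| ≤ M ∧
      |Laplacian.laplacian z x| ≤ M ∧ ‖gradient z x‖ ≤ M ∧ |z x| ≤ M ∧ |pb.lin α z x| ≤ M) ∧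
      ∀ x ∈ frontier pb.cl, ‖pb.bB α x‖ ≤ M ∧ |pb.cB α x| ≤ M := by
  have hz2 : ContDiff ℝ 2 z := contDiff_infty.1 hz 2
  have hc := pb.isCompact_cl
  obtain ⟨M1, h1⟩ := hc.exists_bound_of_continuousOn (pb.a_cont.continuousOn α)
  obtain ⟨M2, h2⟩ := hc.exists_bound_of_continuousOn (pb.b_cont.continuousOn α)
  obtain ⟨M3, h3⟩ := hc.exists_bound_of_continuousOn (pb.c_cont.continuousOn α)
  obtain ⟨M4, h4⟩ := hc.exists_bound_of_continuousOn (continuous_laplacian hz2).continuousOn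
  obtain ⟨M5, h5⟩ := hc.exists_bound_of_continuousOn
    (continuous_gradient hz2 (by norm_num)).continuousOn
  obtain ⟨M6, h6⟩ := hc.exists_bound_of_continuousOn hz2.continuous.continuousOn
  obtain ⟨M7, h7⟩ := hc.exists_bound_of_continuousOn (continuousOn_lin (pb := pb) (α := α) hz2)
  obtain ⟨M8, h8⟩ := pb.bB_pc.bounded α
  obtain ⟨M9, h9⟩ := pb.cB_pc.bounded α
  refine ⟨|M1| + |M2| + |M3| + |M4| + |M5| + |M6| + |M7| + |M8| + |M9|, by positivity,
    fun x hx => ?_, fun x hx => ?_⟩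
  · have h1 := h1 x hx
    have h2 := h2 x hx
    have h3 := h3 x hx
    have h4 := h4 x hx
    have h5 := h5 x hx
    have h6 := h6 x hx
    have h7 := h7 x hx
    rw [Real.norm_eq_abs] at h1 h3 h4 h6 h7
    refine ⟨?_, ?_, ?_, ?_, ?_, ?_, ?_⟩ <;>
    linarith [le_abs_self M1, le_abs_self M2, le_abs_self M3, le_abs_self M4, le_abs_self M5,
      le_abs_self M6, le_abs_self M7, abs_nonneg M1, abs_nonneg M2, abs_nonneg M3, abs_nonneg M4,
      abs_nonneg M5, abs_nonneg M6, abs_nonneg M7, abs_nonneg M8, abs_nonneg M9]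
  · have h8 := h8 x hx
    have h9 := h9 x hx
    rw [Real.norm_eq_abs] at h9
    refine ⟨?_, ?_⟩ <;>
    linarith [le_abs_self M8, le_abs_self M9, abs_nonneg M1, abs_nonneg M2, abs_nonneg M3,
      abs_nonneg M4, abs_nonneg M5, abs_nonneg M6, abs_nonneg M7, abs_nonneg M8, abs_nonneg M9]

/-! ### Perturbation estimates and interior consistency -/

theorem exists_pos_mul_le {C δ : ℝ} (hC : 0 ≤ C) (hδ : 0 < δ) :
    ∃ η > 0, η ≤ 1 ∧ η * C ≤ δ := by
  refine ⟨min 1 (δ / (C + 1)), lt_min one_pos (by positivity), min_le_left _ _, ?_⟩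
  calc min 1 (δ / (C + 1)) * C ≤ δ / (C + 1) * (C + 1) := by
        gcongr; exacts [min_le_right _ _, by linarith]
    _ = δ := div_mul_cancel₀ _ (by positivity)

theorem abs_inner_sub_inner_le {p q p' q' : Sp d} {η M : ℝ} (hp : ‖p‖ ≤ M) (hpp : ‖p - p'‖ ≤ η)
    (hqq : ‖q' - q‖ ≤ η) (hq : ‖q‖ ≤ M) (hη1 : η ≤ 1) :
    |inner ℝ p' q' - inner ℝ p q| ≤ η * (2 * M + 1) := by
  have h1 : inner ℝ p' q' - inner ℝ p q =
      -inner ℝ (p - p') q' + inner ℝ p (q' - q) := by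
    rw [inner_sub_left, inner_sub_right]; ring
  have hq' : ‖q'‖ ≤ M + 1 := by
    have := norm_add_le q (q' - q)
    rw [add_sub_cancel] at this
    linarith
  have hη0 : 0 ≤ η := (norm_nonneg _).trans hpp
  have hM : 0 ≤ M := (norm_nonneg _).trans hp
  rw [h1]
  refine (abs_add_le _ _).trans ?_
  rw [abs_neg]
  have h2 := (abs_real_inner_le_norm (p - p') q').trans
    (mul_le_mul hpp hq' (norm_nonneg _) hη0)
  have h3 := (abs_real_inner_le_norm p (q' - q)).trans (mul_le_mul hp hqq (norm_nonneg _) hM)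
  linarith

theorem abs_mul_sub_mul_le {p q p' q' η M : ℝ} (hp : |p| ≤ M) (hpp : |p - p'| ≤ η)
    (hqq : |q' - q| ≤ η) (hq : |q| ≤ M) (hη1 : η ≤ 1) :
    |p' * q' - p * q| ≤ η * (2 * M + 1) := by
  have h1 : p' * q' - p * q = -((p - p') * q') + p * (q' - q) := by ring
  have hq' : |q'| ≤ M + 1 := by
    have := abs_add_le q (q' - q)
    rw [add_sub_cancel] at this
    linarith
  have hη0 : 0 ≤ η := (abs_nonneg _).trans hpp
  have hM : 0 ≤ M := (abs_nonneg _).trans hp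
  rw [h1]
  refine (abs_add_le _ _).trans ?_
  rw [abs_neg, abs_mul, abs_mul]
  have h2 := mul_le_mul hpp hq' (abs_nonneg _) hη0
  have h3 := mul_le_mul hp hqq (abs_nonneg _) hM
  linarith

/-- After Green's formula both operators are averages against `nhat`, so it is enough to compare
integrands pointwise on the elements around `y`. Only the sums of explicit and implicit coefficients
enter. -/
theorem consistent_interior (hcons : S.ConsistentCoefficients) (h : S.IsProjSeq z Z) (α : A)
    {δ : ℝ} (hδ : 0 < δ) : ∀ᶠ i in atTop, ∀ y ∈ (S.mesh i).vertices, y ∈ interior pb.cl →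
      |S.opE i α (Z i) y + S.opI i α (Z i) y -
        ∫ x in pb.cl, pb.lin α z x * nhat (S.mesh i) y x| ≤ δ := by
  have hz2 : ContDiff ℝ 2 z := contDiff_infty.1 h.smooth 2
  obtain ⟨M, hM, hb, -⟩ := exists_bound pb α h.smooth
  -- The constant adds the diffusion error `M` and two product errors `2 * M + 1`, one for the drift
  -- and one for the reaction.
  obtain ⟨η, hη, hη1, hηδ⟩ := exists_pos_mul_le (C := 5 * M + 2) (by positivity) hδ
  filter_upwards [hcons.consistent_a η hη, hcons.consistent_interior η hη, h.approx η hη]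
    with i hia hii hap y hy hyi
  have hK := S.isMesh i
  have hcE := (hcons.cE_cont i).continuousOn α
  have hcI := (hcons.cI_cont i).continuousOn α
  have hbE := (hcons.bE_cont i).continuousOn α
  have hbI := (hcons.bI_cont i).continuousOn α
  have hnD : y ∉ pb.bdD := fun hD => pb.notMem_interior (Or.inr hD) hyi
  rw [opE_eq, opI_eq, nodeOp_of_interior hyi, nodeOp_of_interior hyi,
    h.weakOp_eq i hy hyi hbE hcE, h.weakOp_eq i hy hyi hbI hcI]
  have hpE := h.pwCont i (S.aE i α y) hbE hcE
  have hpI := h.pwCont i (S.aI i α y) hbI hcI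
  have hpL : PwCont (S.mesh i) (pb.lin α z) := PwCont.of_continuousOn hK (continuousOn_lin hz2)
  have hn := pwCont_nhat hK y
  rw [← integral_add ((hpE.mul hn).integrableOn hK) ((hpI.mul hn).integrableOn hK),
    ← integral_sub (((hpE.mul hn).add (hpI.mul hn)).integrableOn hK)
      ((hpL.mul hn).integrableOn hK)]
  simp only [← add_mul, ← sub_mul]
  refine abs_integral_mul_nhat_le hK hy ((hpE.add hpI).sub hpL) fun s hs hys x hx => ?_
  have hxs := interior_subset hx
  have hxc := hK.simplex_subset hs hxs
  obtain ⟨-, hb2, hb3, hb4, hb5, hb6, -⟩ := hb x hxc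
  obtain ⟨hi2, hi3, -⟩ := hii α x hxc
  have hi1 := hia α y hy hnD x (mem_tsupport_nhat hK hs hys hx)
  have hg := hap.norm_grd_sub_le s hs x hxs
  have e1 := abs_inner_sub_inner_le hb2 hi2 hg hb5 hη1
  have e2 := abs_mul_sub_mul_le hb3 hi3 (hap.abs_sub_le x hxc) hb6 hη1
  have e3 : |(pb.a α x - (S.aE i α y + S.aI i α y)) * Laplacian.laplacian z x| ≤ η * M := by
    rw [abs_mul]
    exact mul_le_mul hi1 hb4 (abs_nonneg _) hη.le
  rw [P1.gradient_eq (h.mem i) hs hx]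
  have e4 : -(S.aE i α y * Laplacian.laplacian z x) +
      (-inner ℝ (S.bE i α x) (grd (S.mesh i) s (Z i)) + S.cE i α x * Z i x) +
      (-(S.aI i α y * Laplacian.laplacian z x) +
      (-inner ℝ (S.bI i α x) (grd (S.mesh i) s (Z i)) + S.cI i α x * Z i x)) - pb.lin α z x =
      (pb.a α x - (S.aE i α y + S.aI i α y)) * Laplacian.laplacian z x -
      (inner ℝ (S.bE i α x + S.bI i α x) (grd (S.mesh i) s (Z i)) -
        inner ℝ (pb.b α x) (gradient z x)) +
      ((S.cE i α x + S.cI i α x) * Z i x - pb.c α x * z x) := by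
    rw [BellmanProblem.lin, inner_add_left]
    ring
  rw [e4]
  refine (abs_add_le _ _).trans ((add_le_add_left (abs_sub _ _) _).trans ?_)
  linarith

/-- The explicit drift is controlled by the mesh size and the time step restriction. -/
theorem h_mul_norm_bE_le (hd : 2 ≤ d) (hcons : S.ConsistentCoefficients)
    (hmono : S.ArtificialDiffusion) (htime : S.TimeStepRestriction) (i : ℕ) (α : A)
    (hyi : y ∈ interior pb.cl) (hs : s ∈ elements (S.mesh i)) (hys : y ∈ s) (hx : x ∈ simplex s) :
    S.h i * ‖S.bE i α x‖ ≤ 2 * Metric.diam (simplex s) := by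
  obtain ⟨θ, hθ, hac, hM⟩ := monotoneCoefficients hcons hmono i
  have H := (hM α).1
  have hK := S.isMesh i
  have hy := mem_vertices_of_mem hs.1 hys
  obtain ⟨ν, hν0, hν, hdiff⟩ := H.diffusion y hy hyi
  have hσ : Real.sin θ ≤ 1 / 2 := hac.sin_le_half hK hd H.σ_nonneg hs
  have ha : 0 ≤ S.aE i α y := hν0.trans hν
  have hlow : ∀ t ∈ elements (S.mesh i), y ∈ t →
      1 / 2 * (S.aE i α y * ‖grd (S.mesh i) t (hat (S.mesh i) y)‖ *
        ‖grd (S.mesh i) t (nhat (S.mesh i) y)‖ * volume.real (simplex t)) ≤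
      elementOp (S.mesh i) t (S.aE i α y) (S.bE i α) (S.cE i α) (hat (S.mesh i) y) y :=
    fun t ht hyt => (mul_le_mul_of_nonneg_right (by linarith) (by positivity)).trans
      (le_elementOp_hat hK ht hyt H.σ_nonneg H.b_cont H.c_cont H.c_nonneg hν (hdiff t ht hyt))
  -- The diagonal entry is a sum of nonnegative element contributions, so the time step restriction
  -- also controls each of them.
  have hsum : 1 / 2 * (S.aE i α y * ‖grd (S.mesh i) s (hat (S.mesh i) y)‖ *
        ‖grd (S.mesh i) s (nhat (S.mesh i) y)‖ * volume.real (simplex s)) ≤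
      S.opE i α (hat (S.mesh i) y) y := by
    rw [opE_eq, nodeOp_of_interior hyi, weakOp_eq_sum hK H.b_cont H.c_cont (hat_mem_P1 hK y)]
    refine (hlow s hs hys).trans (Finset.single_le_sum (f := fun t => elementOp (S.mesh i) t
      (S.aE i α y) (S.bE i α) (S.cE i α) (hat (S.mesh i) y) y) (fun t ht => ?_)
      (hK.finite_elements.mem_toFinset.2 hs))
    have ht := hK.finite_elements.mem_toFinset.1 ht
    by_cases hyt : y ∈ t
    · exact le_trans (by positivity) (hlow t ht hyt)
    · exact (elementOp_eq_zero hK ht hyt).ge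
  have ht := htime i α y hy (Or.inl hyi)
  have hpos := S.h_pos i
  have hsteep := one_le_norm_grd_hat_mul_diam hK (by lia) hs hys
  set g := ‖grd (S.mesh i) s (hat (S.mesh i) y)‖
  -- This quantity links the two bounds: the diffusion condition gives `h ‖b‖ ≤ q`, the diagonal
  -- bound gives `q * g ≤ 2`, and steepness of the hat function, `1 ≤ g * diam`, converts the latter
  -- into a bound by the diameter.
  set q := S.h i * (S.aE i α y * ‖grd (S.mesh i) s (nhat (S.mesh i) y)‖ *
    volume.real (simplex s)) with hq
  have hq0 : 0 ≤ q := by positivity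
  have hqg : q * g ≤ 2 := by
    have := (mul_le_mul_of_nonneg_left hsum hpos.le).trans ht
    rw [hq]
    linarith
  have hbq : S.h i * ‖S.bE i α x‖ ≤ q := by
    refine mul_le_mul_of_nonneg_left ?_ hpos.le
    have h1 := norm_le_vecSupOn (isCompact_simplex s) (H.b_cont.mono (hK.simplex_subset hs)) hx
    have h2 := hdiff s hs hys
    have h3 := mul_nonneg (Metric.diam_nonneg (s := simplex s))
      (supOn_nonneg (simplex s) (S.cE i α))
    have h4 : ν * Real.sin θ * ‖grd (S.mesh i) s (nhat (S.mesh i) y)‖ * volume.real (simplex s) ≤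
        S.aE i α y * 1 * ‖grd (S.mesh i) s (nhat (S.mesh i) y)‖ * volume.real (simplex s) := by
      have := H.σ_nonneg
      gcongr
      linarith
    linarith
  calc S.h i * ‖S.bE i α x‖ ≤ q := hbq
    _ ≤ q * (g * Metric.diam (simplex s)) := le_mul_of_one_le_right hq0 hsteep
    _ = q * g * Metric.diam (simplex s) := by ring
    _ ≤ 2 * Metric.diam (simplex s) := mul_le_mul_of_nonneg_right hqg Metric.diam_nonneg

theorem tendsto_h (S : Discretisation pb) : Tendsto S.h atTop (𝓝 0) := S.timeStep_tendsto

/-- Sign conditions and consistency of the sums bound the explicit diffusion and reaction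
coefficients, so those terms are of order `h`. The drift may be unbounded as `i` grows, but its
product with `h` is at most twice the mesh size. -/
theorem h_mul_opE_interior (hd : 2 ≤ d) (hcons : S.ConsistentCoefficients)
    (hmono : S.ArtificialDiffusion) (htime : S.TimeStepRestriction) (h : S.IsProjSeq z Z) (α : A)
    {δ : ℝ} (hδ : 0 < δ) : ∀ᶠ i in atTop, ∀ y ∈ (S.mesh i).vertices, y ∈ interior pb.cl →
      |S.h i * S.opE i α (Z i) y| ≤ δ := by
  obtain ⟨M, hM, hb, -⟩ := exists_bound pb α h.smooth
  obtain ⟨η, hη, hη1, hηδ⟩ := exists_pos_mul_le (C := (M + 1) * M + 2 * (M + 1) + (M + 1) * (M + 1))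
    (by positivity) hδ
  filter_upwards [hcons.consistent_a 1 one_pos, hcons.consistent_interior 1 one_pos,
    h.approx 1 one_pos, S.tendsto_h.eventually (eventually_le_nhds hη),
    S.meshSize_tendsto.eventually (eventually_le_nhds hη)] with i hia hii hap hh hms y hy hyi
  obtain ⟨θ, hθ, hac, hMon⟩ := monotoneCoefficients hcons hmono i
  have hK := S.isMesh i
  have hyc := hK.vertices_subset hy
  have hcE := (hcons.cE_cont i).continuousOn α
  have hbE := (hcons.bE_cont i).continuousOn α
  have hnD : y ∉ pb.bdD := fun hD => pb.notMem_interior (Or.inr hD) hyi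
  have hpos := S.h_pos i
  have ha0 : 0 ≤ S.aE i α y := by
    obtain ⟨ν, h1, h2, -⟩ := (hMon α).1.diffusion y hy hyi
    exact h1.trans h2
  have haI0 : 0 ≤ S.aI i α y := by
    obtain ⟨ν, h1, h2, -⟩ := (hMon α).2.diffusion y hy hyi
    exact h1.trans h2
  have haM : S.aE i α y ≤ M + 1 := by
    have h1 := (abs_le.1 (hia α y hy hnD y (self_mem_tsupport_nhat hK hy))).1
    have h2 := (abs_le.1 (hb y hyc).1).2
    linarith
  have hpE := h.pwCont i (S.aE i α y) hbE hcE
  rw [opE_eq, nodeOp_of_interior hyi, h.weakOp_eq i hy hyi hbE hcE, ← integral_const_mul]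
  simp only [← mul_assoc]
  refine abs_integral_mul_nhat_le hK hy ((PwCont.const (S.h i)).mul hpE) fun s hs hys x hx => ?_
  have hxs := interior_subset hx
  have hxc := hK.simplex_subset hs hxs
  obtain ⟨-, hb2, hb3, hb4, hb5, hb6, -⟩ := hb x hxc
  rw [P1.gradient_eq (h.mem i) hs hx]
  have hg : ‖grd (S.mesh i) s (Z i)‖ ≤ M + 1 := by
    have h1 := hap.norm_grd_sub_le s hs x hxs
    have h2 := norm_add_le (gradient z x) (grd (S.mesh i) s (Z i) - gradient z x)
    rw [add_sub_cancel] at h2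
    linarith
  have hZ : |Z i x| ≤ M + 1 := by
    have h1 := hap.abs_sub_le x hxc
    have h2 := abs_add_le (z x) (Z i x - z x)
    rw [add_sub_cancel] at h2
    linarith
  have hc : |S.cE i α x| ≤ M + 1 := by
    rw [abs_of_nonneg (hcons.cE_nonneg i α x hxc)]
    have h1 := (abs_le.1 (hii α x hxc).2.1).1
    have h2 := (abs_le.1 hb3).2
    have h3 := hcons.cI_nonneg i α x hxc
    linarith
  have hbE := h_mul_norm_bE_le hd hcons hmono htime i α hyi hs hys hxs
  have hdiam := diam_simplex_le_meshSize hK hs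
  have e1 : |S.h i * (S.aE i α y * Laplacian.laplacian z x)| ≤ η * ((M + 1) * M) := by
    rw [abs_mul, abs_mul, abs_of_pos hpos, abs_of_nonneg ha0]
    gcongr
  have e2 : |S.h i * inner ℝ (S.bE i α x) (grd (S.mesh i) s (Z i))| ≤ 2 * η * (M + 1) := by
    rw [abs_mul, abs_of_pos hpos]
    calc _ ≤ S.h i * (‖S.bE i α x‖ * ‖grd (S.mesh i) s (Z i)‖) :=
          mul_le_mul_of_nonneg_left (abs_real_inner_le_norm _ _) hpos.le
      _ = (S.h i * ‖S.bE i α x‖) * ‖grd (S.mesh i) s (Z i)‖ := by ring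
      _ ≤ 2 * η * (M + 1) := mul_le_mul (by linarith) hg (norm_nonneg _) (by positivity)
  have e3 : |S.h i * (S.cE i α x * Z i x)| ≤ η * ((M + 1) * (M + 1)) := by
    rw [abs_mul, abs_mul, abs_of_pos hpos]
    gcongr
  have e4 : S.h i * (-(S.aE i α y * Laplacian.laplacian z x) +
      (-inner ℝ (S.bE i α x) (grd (S.mesh i) s (Z i)) + S.cE i α x * Z i x)) =
      S.h i * (S.cE i α x * Z i x) - S.h i * (S.aE i α y * Laplacian.laplacian z x) -
        S.h i * inner ℝ (S.bE i α x) (grd (S.mesh i) s (Z i)) := by ring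
  rw [e4]
  refine (abs_sub _ _).trans ((add_le_add_left (abs_sub _ _) _).trans ?_)
  linarith

/-- The time derivative enters the scheme through a nodal value, whereas the supersolution
inequality is available only as an average. Uniform continuity makes the two agree as the mesh is
refined. -/
theorem consistent_value (h : S.IsProjSeq z Z) {δ : ℝ} (hδ : 0 < δ) :
    ∀ᶠ i in atTop, ∀ y ∈ (S.mesh i).vertices,
      |Z i y - ∫ x in pb.cl, z x * nhat (S.mesh i) y x| ≤ δ := by
  obtain ⟨η, hη, hu⟩ := Metric.uniformContinuous_iff.1
    (h.smooth.continuous.uniformContinuous_of_tendsto_cocompact h.compact.is_zero_at_infty)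
    (δ / 2) (half_pos hδ)
  filter_upwards [h.approx (δ / 2) (half_pos hδ),
    S.meshSize_tendsto.eventually (eventually_lt_nhds hη)] with i hap hms y hy
  have hK := S.isMesh i
  have hz : PwCont (S.mesh i) z := PwCont.of_continuousOn hK h.smooth.continuous.continuousOn
  have h1 := abs_integral_mul_nhat_le hK hy (hz.sub (PwCont.const (z y))) (c := δ / 2)
    fun s hs hys x hx => by
      rw [← Real.dist_eq]
      exact (hu ((dist_le_meshSize hK hs (interior_subset hx)
        (mem_simplex_of_mem hys)).trans_lt hms)).le
  have h2 : ∫ x in pb.cl, (z x - z y) * nhat (S.mesh i) y x =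
      (∫ x in pb.cl, z x * nhat (S.mesh i) y x) - z y := by
    simp only [sub_mul]
    rw [integral_sub ((hz.mul (pwCont_nhat hK y)).integrableOn hK)
      (((PwCont.const (z y)).mul (pwCont_nhat hK y)).integrableOn hK), integral_const_mul,
      integral_nhat hK hy, mul_one]
  rw [h2] at h1
  have h3 := hap.abs_sub_le y (hK.vertices_subset hy)
  rw [abs_le] at *
  constructor <;> linarith

theorem consistent_rhs (hcons : S.ConsistentCoefficients) (α : A) {δ : ℝ} (hδ : 0 < δ) :
    ∀ᶠ i in atTop, ∀ y ∈ (S.mesh i).vertices, y ∈ interior pb.cl →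
      |S.rhs i α y - ∫ x in pb.cl, pb.f α x * nhat (S.mesh i) y x| ≤ δ := by
  filter_upwards [hcons.consistent_interior δ hδ] with i hii y hy hyi
  have hK := S.isMesh i
  have h1 : PwCont (S.mesh i) (S.fh i α) :=
    PwCont.of_continuousOn hK ((hcons.fh_cont i).continuousOn α)
  have h2 : PwCont (S.mesh i) (pb.f α) := PwCont.of_continuousOn hK (pb.f_cont.continuousOn α)
  have hn := pwCont_nhat hK y
  rw [rhs, if_pos hyi, integ, ← integral_sub ((h1.mul hn).integrableOn hK)
    ((h2.mul hn).integrableOn hK)]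
  simp only [← sub_mul]
  refine abs_integral_mul_nhat_le hK hy (h1.sub h2) fun s hs hys x hx => ?_
  rw [abs_sub_comm]
  exact (hii α x (hK.simplex_subset hs (interior_subset hx))).2.2

/-! ### Consistency at boundary nodes -/

/-- The explicit and implicit derivatives may use different elements, but each has error at most `η`
times the length of its own drift. Separate bounds on the drifts are therefore needed, not only on
their sum. -/
theorem consistent_boundary (hcons : S.ConsistentCoefficients) (h : S.IsProjSeq z Z) (α : A)
    {δ : ℝ} (hδ : 0 < δ) : ∀ᶠ i in atTop, ∀ y ∈ (S.mesh i).vertices, y ∈ pb.bdT ∪ pb.bdR →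
      |S.opE i α (Z i) y + S.opI i α (Z i) y - pb.linB α z y| ≤ δ := by
  obtain ⟨M, hM, hb, hbB⟩ := exists_bound pb α h.smooth
  obtain ⟨B, hB⟩ := hcons.bB_bounded
  set B' := |B| + M + 1 with hB'
  have hB'0 : 0 ≤ B' := by positivity
  obtain ⟨η, hη, hη1, hηδ⟩ := exists_pos_mul_le (C := M + 2 * B' + (2 * M + 1)) (by positivity) hδ
  filter_upwards [hcons.consistent_boundary η hη, h.approx η hη] with i hib hap y hy hTR
  have hK := S.isMesh i
  have hyc := hK.vertices_subset hy
  have hni := pb.notMem_interior (Or.inl hTR)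
  have hnD := pb.notMem_bdD hTR
  have hf : y ∈ frontier pb.cl := by rw [← pb.union_eq]; exact Or.inl hTR
  obtain ⟨hi1, hi2, -⟩ := hib α y hf
  obtain ⟨hM1, hM2⟩ := hbB y hf
  obtain ⟨-, -, -, -, hb5, hb6, -⟩ := hb y hyc
  -- On `bdT` the drifts are bounded by assumption; on `bdR` the explicit drift vanishes and
  -- consistency bounds the implicit one.
  have hbnd : ‖S.bBE i α y‖ ≤ B' ∧ ‖S.bBI i α y‖ ≤ B' := by
    rcases hTR with hT | hR
    · have := hB i α y hT
      constructor <;> linarith [le_abs_self B]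
    · have h0 := (hcons.implicit_R i α y hR).2.2.2.1
      rw [h0, zero_add] at hi1
      rw [h0, norm_zero]
      have := norm_sub_le (pb.bB α y) (pb.bB α y - S.bBI i α y)
      rw [sub_sub_cancel] at this
      exact ⟨hB'0, by linarith [abs_nonneg B]⟩
  obtain ⟨hcE, hcI⟩ := hcons.cone i α y hy hTR
  have d1 := (hap.abs_diniDeriv_add_le hK hcE).trans (mul_le_mul_of_nonneg_left hbnd.1 hη.le)
  have d2 := (hap.abs_diniDeriv_add_le hK hcI).trans (mul_le_mul_of_nonneg_left hbnd.2 hη.le)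
  have d3 := abs_mul_sub_mul_le hM2 hi2 (hap.abs_sub_le y hyc) hb6 hη1
  have d4 : |inner ℝ (pb.bB α y - (S.bBE i α y + S.bBI i α y)) (gradient z y)| ≤ η * M :=
    (abs_real_inner_le_norm _ _).trans (mul_le_mul hi1 hb5 (norm_nonneg _) hη.le)
  rw [opE_eq, opI_eq, nodeOp_of_boundary hni hnD, nodeOp_of_boundary hni hnD, BellmanProblem.linB]
  rw [inner_sub_left, inner_add_left] at d4
  rw [real_inner_comm] at d1 d2
  rw [abs_le] at *
  constructor <;> linarith

/-- All explicit boundary coefficients are bounded uniformly in `i` here, so the operator applied to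
the projections is bounded and the factor `h` makes it small. -/
theorem h_mul_opE_boundary (hcons : S.ConsistentCoefficients) (h : S.IsProjSeq z Z) (α : A)
    {δ : ℝ} (hδ : 0 < δ) : ∀ᶠ i in atTop, ∀ y ∈ (S.mesh i).vertices, y ∈ pb.bdT →
      |S.h i * S.opE i α (Z i) y| ≤ δ := by
  obtain ⟨M, hM, hb, hbB⟩ := exists_bound pb α h.smooth
  obtain ⟨B, hB⟩ := hcons.bB_bounded
  obtain ⟨η, hη, hη1, hηδ⟩ := exists_pos_mul_le (C := |B| + M * |B| + (M + 1) * (M + 1))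
    (by positivity) hδ
  filter_upwards [hcons.consistent_boundary 1 one_pos, h.approx 1 one_pos,
    S.tendsto_h.eventually (eventually_le_nhds hη)] with i hib hap hh y hy hT
  have hK := S.isMesh i
  have hyc := hK.vertices_subset hy
  have hni := pb.notMem_interior (Or.inl (Or.inl hT))
  have hnD := pb.notMem_bdD (Or.inl hT)
  have hf : y ∈ frontier pb.cl := by rw [← pb.union_eq]; exact Or.inl (Or.inl hT)
  obtain ⟨-, hi2, -⟩ := hib α y hf
  obtain ⟨-, hM2⟩ := hbB y hf
  obtain ⟨-, -, -, -, hb5, hb6, -⟩ := hb y hyc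
  have hBE : ‖S.bBE i α y‖ ≤ |B| := (hB i α y hT).1.trans (le_abs_self B)
  have d1 := hap.abs_diniDeriv_add_le hK (hcons.cone i α y hy (Or.inl hT)).1
  have d2 : |inner ℝ (gradient z y) (S.bBE i α y)| ≤ M * |B| :=
    (abs_real_inner_le_norm _ _).trans (mul_le_mul hb5 hBE (norm_nonneg _) hM)
  have hZ : |Z i y| ≤ M + 1 := by
    have h1 := hap.abs_sub_le y hyc
    have h2 := abs_add_le (z y) (Z i y - z y)
    rw [add_sub_cancel] at h2
    linarith
  have hc : |S.cBE i α y| ≤ M + 1 := by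
    rw [abs_of_nonneg (hcons.cBE_nonneg i α y hf)]
    have h1 := (abs_le.1 hi2).1
    have h2 := (abs_le.1 hM2).2
    have h3 := hcons.cBI_nonneg i α y hf
    linarith
  have d3 : |S.cBE i α y * Z i y| ≤ (M + 1) * (M + 1) := by
    rw [abs_mul]; exact mul_le_mul hc hZ (abs_nonneg _) (by positivity)
  have d4 : |S.opE i α (Z i) y| ≤ |B| + M * |B| + (M + 1) * (M + 1) := by
    rw [opE_eq, nodeOp_of_boundary hni hnD]
    rw [abs_le] at *
    constructor <;> linarith
  rw [abs_mul, abs_of_pos (S.h_pos i)]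
  exact (mul_le_mul hh d4 (abs_nonneg _) hη.le).trans hηδ

end Discretisation

end BellmanFEM

namespace BellmanFEM

open scoped ContDiff

variable {d : ℕ} {x y : Sp d} {A : Type*} [TopologicalSpace A] {pb : BellmanProblem d A}
  {S : Discretisation pb}

/-! ### Time slices of the strict supersolution -/

section Slices

variable {w : ℝ × Sp d → ℝ}

theorem contDiff_slice {n : WithTop ℕ∞} (hw : ContDiff ℝ n w) (t : ℝ) :
    ContDiff ℝ n fun y => w (t, y) := hw.comp (contDiff_const.prodMk contDiff_id)

theorem fderiv_slice (hw : ContDiff ℝ 1 w) (t : ℝ) (x p : Sp d) :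
    fderiv ℝ (fun y => w (t, y)) x p = fderiv ℝ w (t, x) (0, p) := by
  have h1 : HasFDerivAt w (fderiv ℝ w (t, x)) (t, x) :=
    (hw.differentiable (by norm_num) _).hasFDerivAt
  have h2 : HasFDerivAt (fun y : Sp d => (t, y)) (ContinuousLinearMap.inr ℝ ℝ (Sp d)) x :=
    hasFDerivAt_prodMk_right t x
  have h3 : HasFDerivAt (fun y => w (t, y)) _ x := h1.comp x h2
  rw [h3.fderiv]
  simp

theorem deriv_slice (hw : ContDiff ℝ 1 w) (t : ℝ) (x : Sp d) :
    deriv (fun τ => w (τ, x)) t = fderiv ℝ w (t, x) (1, 0) := by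
  have h1 : HasFDerivAt w (fderiv ℝ w (t, x)) (t, x) :=
    (hw.differentiable (by norm_num) _).hasFDerivAt
  have h2 : HasFDerivAt (fun τ : ℝ => (τ, x)) (ContinuousLinearMap.inl ℝ ℝ (Sp d)) t :=
    hasFDerivAt_prodMk_left t x
  have h3 : HasFDerivAt (fun τ => w (τ, x)) _ t := h1.comp t h2
  rw [h3.hasDerivAt.deriv]
  simp

theorem continuous_fderiv_apply {V : Type*} [NormedAddCommGroup V] [NormedSpace ℝ V] {f : V → ℝ}
    (hf : ContDiff ℝ 1 f) (p : V) : Continuous fun q => fderiv ℝ f q p :=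
  (hf.continuous_fderiv (by norm_num)).clm_apply continuous_const

/-- The spatial second derivatives of a slice are derivatives of the full function in directions
`(0, p)`, and those are jointly continuous. -/
theorem continuous_laplacian_slice (hw : ContDiff ℝ 2 w) (x : Sp d) :
    Continuous fun t => Laplacian.laplacian (fun y => w (t, y)) x := by
  have key : ∀ (p : Sp d) (t : ℝ), fderiv ℝ (fderiv ℝ fun y => w (t, y)) x p p =
      fderiv ℝ (fun q => fderiv ℝ w q (0, p)) (t, x) (0, p) := by
    intro p t
    have hg : ContDiff ℝ 1 fun q => fderiv ℝ w q ((0 : ℝ), p) :=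
      (hw.fderiv_right (by norm_num)).clm_apply contDiff_const
    rw [← fderiv_slice hg]
    have h1 : ContDiff ℝ 1 (fderiv ℝ fun y => w (t, y)) :=
      (contDiff_slice hw t).fderiv_right (by norm_num)
    have h2 := (h1.differentiable (by norm_num) x).hasFDerivAt.clm_apply (hasFDerivAt_const p x)
    have h3 : (fun y => fderiv ℝ w (t, y) (0, p)) = fun y => fderiv ℝ (fun y => w (t, y)) y p :=
      funext fun y => (fderiv_slice (hw.of_le (by norm_num)) t y p).symm
    rw [h3, h2.fderiv]
    simp
  simp only [laplacian_eq_sum_fderiv, key]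
  refine continuous_finsetSum _ fun j _ => ?_
  have hg : ContDiff ℝ 1 fun q => fderiv ℝ w q ((0 : ℝ), EuclideanSpace.basisFun (Fin d) ℝ j) :=
    (hw.fderiv_right (by norm_num)).clm_apply contDiff_const
  exact (continuous_fderiv_apply hg _).comp (by fun_prop : Continuous fun t : ℝ => (t, x))

theorem continuous_inner_gradient_slice (hw : ContDiff ℝ 1 w) (x p : Sp d) :
    Continuous fun t => inner ℝ p (gradient (fun y => w (t, y)) x) := by
  have : (fun t => inner ℝ p (gradient (fun y => w (t, y)) x)) =
      fun t => fderiv ℝ w (t, x) (0, p) := by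
    funext t
    rw [real_inner_comm, inner_gradient_left, fderiv_slice hw]
  rw [this]
  exact (continuous_fderiv_apply hw _).comp (by fun_prop : Continuous fun t : ℝ => (t, x))

theorem continuous_deriv_slice_time (hw : ContDiff ℝ 1 w) (x : Sp d) :
    Continuous fun t => deriv (fun τ => w (τ, x)) t := by
  simp only [deriv_slice hw]
  exact (continuous_fderiv_apply hw _).comp (by fun_prop : Continuous fun t : ℝ => (t, x))

theorem continuous_deriv_slice_space (hw : ContDiff ℝ 1 w) (t : ℝ) :
    Continuous fun x => deriv (fun τ => w (τ, x)) t := by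
  simp only [deriv_slice hw]
  exact (continuous_fderiv_apply hw _).comp (by fun_prop : Continuous fun x : Sp d => (t, x))

theorem continuous_lin_slice (hw : ContDiff ℝ 2 w) (α : A) (x : Sp d) :
    Continuous fun t => pb.lin α (fun y => w (t, y)) x := by
  have h1 := continuous_laplacian_slice hw x
  have h2 := continuous_inner_gradient_slice (hw.of_le (by norm_num)) x (pb.b α x)
  have h3 : Continuous fun t : ℝ => w (t, x) := hw.continuous.comp (by fun_prop)
  exact ((continuous_const.mul h1).neg.sub h2).add (continuous_const.mul h3)

theorem continuous_linB_slice (hw : ContDiff ℝ 2 w) (α : A) (x : Sp d) :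
    Continuous fun t => pb.linB α (fun y => w (t, y)) x := by
  have h2 := continuous_inner_gradient_slice (hw.of_le (by norm_num)) x (pb.bB α x)
  have h3 : Continuous fun t : ℝ => w (t, x) := hw.continuous.comp (by fun_prop)
  exact h2.neg.add (continuous_const.mul h3)

theorem le_on_Icc_of_le_on_Ico {f : ℝ → ℝ} (hf : Continuous f) {T ε : ℝ} (hT : 0 < T)
    (h : ∀ t ∈ Ico 0 T, ε ≤ f t) : ∀ t ∈ Icc 0 T, ε ≤ f t := by
  intro t ht
  rw [← closure_Ico hT.ne] at ht
  exact le_on_closure h continuousOn_const hf.continuousOn ht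

/-- The strict inequalities hold up to the final time. -/
theorem supersolution_slice (hw : ContDiff ℝ 2 w) {α : A} {ε : ℝ}
    (h : ∀ t ∈ Icc (0 : ℝ) pb.T, ∀ x ∈ pb.cl,
      ε ≤ pb.linOp α t x (Laplacian.laplacian (fun y => w (t, y)) x)
        (gradient (fun y => w (t, y)) x) (deriv (fun τ => w (τ, x)) t) (w (t, x)))
    {t : ℝ} (ht : t ∈ Icc 0 pb.T) :
    (∀ x ∈ interior pb.cl,
      ε ≤ -deriv (fun τ => w (τ, x)) t + pb.lin α (fun y => w (t, y)) x - pb.f α x) ∧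
    (∀ x ∈ pb.bdT,
      ε ≤ -deriv (fun τ => w (τ, x)) t + pb.linB α (fun y => w (t, y)) x - pb.gB α x) ∧
    (∀ x ∈ pb.bdR, ε ≤ pb.linB α (fun y => w (t, y)) x - pb.gB α x) := by
  have hw1 : ContDiff ℝ 1 w := hw.of_le (by norm_num)
  have hcl : ∀ x ∈ frontier pb.cl, x ∈ pb.cl := fun x hx =>
    pb.isCompact_cl.isClosed.frontier_subset hx
  refine ⟨fun x hx => ?_, fun x hx => ?_, fun x hx => ?_⟩
  -- At `t = T` the operator `linOp` encodes the terminal condition instead of the equation, so the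
  -- differential inequality there is recovered by letting `t` increase to `T`.
  · refine le_on_Icc_of_le_on_Ico (((continuous_deriv_slice_time hw1 x).neg.add
      (continuous_lin_slice hw α x)).sub continuous_const) pb.T_pos (fun t ht => ?_) t ht
    have := h t ⟨ht.1, ht.2.le⟩ x (interior_subset hx)
    rw [BellmanProblem.linOp, if_neg ht.2.ne,
      if_neg fun hD => pb.notMem_interior (Or.inr hD) hx,
      if_neg fun hR => pb.notMem_interior (Or.inl (Or.inr hR)) hx,
      if_neg fun hT => pb.notMem_interior (Or.inl (Or.inl hT)) hx] at this
    exact this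
  · refine le_on_Icc_of_le_on_Ico (((continuous_deriv_slice_time hw1 x).neg.add
      (continuous_linB_slice hw α x)).sub continuous_const) pb.T_pos (fun t ht => ?_) t ht
    have := h t ⟨ht.1, ht.2.le⟩ x (hcl x (by rw [← pb.union_eq]; exact Or.inl (Or.inl hx)))
    rw [BellmanProblem.linOp, if_neg ht.2.ne, if_neg (Set.disjoint_left.1 pb.disjoint_TD hx),
      if_neg (Set.disjoint_left.1 pb.disjoint_TR hx), if_pos hx] at this
    exact this
  · refine le_on_Icc_of_le_on_Ico ((continuous_linB_slice hw α x).sub continuous_const)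
      pb.T_pos (fun t ht => ?_) t ht
    have := h t ⟨ht.1, ht.2.le⟩ x (hcl x (by rw [← pb.union_eq]; exact Or.inl (Or.inr hx)))
    rw [BellmanProblem.linOp, if_neg ht.2.ne, if_neg (Set.disjoint_left.1 pb.disjoint_RD hx),
      if_pos hx] at this
    exact this

end Slices

/-- Smooth spatial functions `u` and `r`, standing for the value and the time derivative of a
strict supersolution at a fixed time. -/
structure IsFrozenSupersolution (pb : BellmanProblem d A) (α : A) (η : ℝ) (u r : Sp d → ℝ) :
    Prop where
  interior_le : ∀ x ∈ interior pb.cl, η ≤ -r x + pb.lin α u x - pb.f α x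
  bdT_le : ∀ x ∈ pb.bdT, η ≤ -r x + pb.linB α u x - pb.gB α x
  bdR_le : ∀ x ∈ pb.bdR, η ≤ pb.linB α u x - pb.gB α x

/-- The projections require smooth functions, but a slice is only `C²` and its time derivative only
`C¹`. Mollification perturbs the inequalities by at most half of the strict margin. -/
theorem exists_isFrozenSupersolution {w : ℝ × Sp d → ℝ} (hw : ContDiff ℝ 2 w) {α : A} {ε : ℝ}
    (hε : 0 < ε) (h : ∀ t ∈ Icc (0 : ℝ) pb.T, ∀ x ∈ pb.cl,
      ε ≤ pb.linOp α t x (Laplacian.laplacian (fun y => w (t, y)) x)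
        (gradient (fun y => w (t, y)) x) (deriv (fun τ => w (τ, x)) t) (w (t, x)))
    {t : ℝ} (ht : t ∈ Icc 0 pb.T) :
    ∃ u r : Sp d → ℝ, (ContDiff ℝ ∞ u ∧ HasCompactSupport u) ∧
      (ContDiff ℝ ∞ r ∧ HasCompactSupport r) ∧ IsFrozenSupersolution pb α (ε / 2) u r := by
  obtain ⟨hi, hT, hR⟩ := supersolution_slice hw h ht
  obtain ⟨M, hM, hb, hbB⟩ := Discretisation.exists_bound pb α (z := fun _ => 0) contDiff_const
  -- Three coefficients bounded by `M` contribute `3 * M`; the time derivative contributes `1`.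
  obtain ⟨δ, hδ, -, hδM⟩ := Discretisation.exists_pos_mul_le (C := 3 * M + 1) (δ := ε / 2)
    (by positivity) (by positivity)
  obtain ⟨u, hu, huc, hua⟩ := exists_smooth_approx_C2 (contDiff_slice hw t) pb.isCompact_cl hδ
  obtain ⟨r, hr, hrc, hra⟩ := exists_smooth_approx
    (continuous_deriv_slice_space (hw.of_le (by norm_num)) t) pb.isCompact_cl hδ
  have hlin : ∀ x ∈ pb.cl,
      |pb.lin α u x - pb.lin α (fun y => w (t, y)) x| ≤ δ * (3 * M) := by
    intro x hx
    obtain ⟨h1, h2, h3, -⟩ := hb x hx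
    obtain ⟨e1, e2, e3⟩ := hua x hx
    have hsplit : pb.lin α u x - pb.lin α (fun y => w (t, y)) x =
        -(pb.a α x * (Laplacian.laplacian u x - Laplacian.laplacian (fun y => w (t, y)) x)) -
          inner ℝ (pb.b α x) (gradient u x - gradient (fun y => w (t, y)) x) +
          pb.c α x * (u x - w (t, x)) := by
      rw [BellmanProblem.lin, BellmanProblem.lin, inner_sub_right]
      ring
    have f1 : |pb.a α x * (Laplacian.laplacian u x - Laplacian.laplacian (fun y => w (t, y)) x)| ≤
        M * δ := by
      rw [abs_mul]; exact mul_le_mul h1 e3 (abs_nonneg _) hM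
    have f2 : |inner ℝ (pb.b α x) (gradient u x - gradient (fun y => w (t, y)) x)| ≤ M * δ :=
      (abs_real_inner_le_norm _ _).trans (mul_le_mul h2 e2 (norm_nonneg _) hM)
    have f3 : |pb.c α x * (u x - w (t, x))| ≤ M * δ := by
      rw [abs_mul]; exact mul_le_mul h3 e1 (abs_nonneg _) hM
    rw [hsplit]
    rw [abs_le] at *
    constructor <;> linarith
  have hlinB : ∀ x ∈ frontier pb.cl,
      |pb.linB α u x - pb.linB α (fun y => w (t, y)) x| ≤ δ * (3 * M) := by
    intro x hx
    obtain ⟨h1, h2⟩ := hbB x hx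
    obtain ⟨e1, e2, -⟩ := hua x (pb.isCompact_cl.isClosed.frontier_subset hx)
    have hsplit : pb.linB α u x - pb.linB α (fun y => w (t, y)) x =
        -inner ℝ (pb.bB α x) (gradient u x - gradient (fun y => w (t, y)) x) +
          pb.cB α x * (u x - w (t, x)) := by
      rw [BellmanProblem.linB, BellmanProblem.linB, inner_sub_right]
      ring
    have f2 : |inner ℝ (pb.bB α x) (gradient u x - gradient (fun y => w (t, y)) x)| ≤ M * δ :=
      (abs_real_inner_le_norm _ _).trans (mul_le_mul h1 e2 (norm_nonneg _) hM)
    have f3 : |pb.cB α x * (u x - w (t, x))| ≤ M * δ := by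
      rw [abs_mul]; exact mul_le_mul h2 e1 (abs_nonneg _) hM
    have f4 : 0 ≤ M * δ := by positivity
    rw [hsplit]
    rw [abs_le] at *
    constructor <;> linarith
  refine ⟨u, r, ⟨hu, huc⟩, ⟨hr, hrc⟩, fun x hx => ?_, fun x hx => ?_, fun x hx => ?_⟩
  · have h1 := (abs_le.1 (hlin x (interior_subset hx))).1
    have h2 := (abs_le.1 (hra x (interior_subset hx))).2
    linarith [hi x hx]
  · have hf : x ∈ frontier pb.cl := by rw [← pb.union_eq]; exact Or.inl (Or.inl hx)
    have h1 := (abs_le.1 (hlinB x hf)).1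
    have h2 := (abs_le.1 (hra x (pb.isCompact_cl.isClosed.frontier_subset hf))).2
    linarith [hT x hx]
  · have hf : x ∈ frontier pb.cl := by rw [← pb.union_eq]; exact Or.inl (Or.inr hx)
    have h1 := (abs_le.1 (hlinB x hf)).1
    linarith [hR x hx]

namespace Discretisation

/-! ### Discrete strict supersolutions -/

/-- The discrete supersolution `U + ρ R + C`. -/
noncomputable def barrier (S : Discretisation pb) (i : ℕ) (U R : Sp d → ℝ) (ρ C : ℝ) :
    Sp d → ℝ := U + ρ • R + C • unit (S.mesh i)

theorem barrier_mem {i : ℕ} {U R : Sp d → ℝ} (hU : U ∈ P1 (S.mesh i)) (hR : R ∈ P1 (S.mesh i))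
    (ρ C : ℝ) : S.barrier i U R ρ C ∈ P1 (S.mesh i) :=
  (P1 _).add_mem ((P1 _).add_mem hU ((P1 _).smul_mem _ hR)) ((P1 _).smul_mem _ (unit_mem_P1 _))

theorem barrier_apply {i : ℕ} {U R : Sp d → ℝ} (ρ C : ℝ) (hy : y ∈ (S.mesh i).vertices) :
    S.barrier i U R ρ C y = U y + ρ * R y + C := by
  simp [barrier, (S.isMesh i).unit_apply ((S.isMesh i).vertices_subset hy)]

theorem nodeOp_barrier {i : ℕ} {U R : Sp d → ℝ} {σ δ : ℝ} {a c cB : Sp d → ℝ}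
    {b bB : Sp d → Sp d}
    (H : MonotoneCoefficients pb.toMixedDomain (S.mesh i) σ a b c bB cB)
    (hy : y ∈ (S.mesh i).vertices) (hU : U ∈ P1 (S.mesh i)) (hR : R ∈ P1 (S.mesh i)) (ρ C : ℝ) :
    nodeOp pb.toMixedDomain (S.mesh i) a b c bB cB δ (S.barrier i U R ρ C) y =
      nodeOp pb.toMixedDomain (S.mesh i) a b c bB cB δ U y +
      ρ * nodeOp pb.toMixedDomain (S.mesh i) a b c bB cB δ R y +
      C * nodeOp pb.toMixedDomain (S.mesh i) a b c bB cB δ (unit (S.mesh i)) y := by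
  rw [barrier, H.add hy ((P1 _).add_mem hU ((P1 _).smul_mem _ hR))
    ((P1 _).smul_mem _ (unit_mem_P1 _)), H.add hy hU ((P1 _).smul_mem _ hR), H.smul hy hR,
    H.smul hy (unit_mem_P1 _)]

/-- By linearity the shift from `ρ` to `ρ + η` in the explicit part leaves the remainder `η * S.opE
i α R y`. The constant `C` contributes a nonnegative amount because the operators are nonnegative on
`unit`. -/
theorem opE_add_opI_barrier_ge (hcons : S.ConsistentCoefficients) (hmono : S.ArtificialDiffusion)
    (i : ℕ) (α : A) (hy : y ∈ (S.mesh i).vertices) {U R : Sp d → ℝ} (hU : U ∈ P1 (S.mesh i))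
    (hR : R ∈ P1 (S.mesh i)) (ρ η : ℝ) {C : ℝ} (hC : 0 ≤ C) :
    S.opE i α U y + S.opI i α U y + ρ * (S.opE i α R y + S.opI i α R y) + η * S.opE i α R y ≤
      S.opE i α (S.barrier i U R (ρ + η) C) y + S.opI i α (S.barrier i U R ρ C) y := by
  obtain ⟨θ, -, -, hM⟩ := monotoneCoefficients hcons hmono i
  simp only [opE_eq, opI_eq]
  rw [nodeOp_barrier (hM α).1 hy hU hR, nodeOp_barrier (hM α).2 hy hU hR]
  have h1 := mul_nonneg hC ((hM α).1.unit_nonneg (δ := 0) hy le_rfl)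
  have h2 := mul_nonneg hC ((hM α).2.unit_nonneg (δ := 1) hy zero_le_one)
  linarith

theorem abs_mul_le_of_abs_le {ρ q Δ M : ℝ} (hρ : |ρ| ≤ Δ) (hq : |q| ≤ M) : |ρ * q| ≤ Δ * M := by
  rw [abs_mul]
  exact mul_le_mul hρ hq (abs_nonneg _) ((abs_nonneg _).trans hρ)

/-- Near the freezing time, the projections of a frozen supersolution give a barrier. -/
theorem exists_barrier (hd : 2 ≤ d) (hcons : S.ConsistentCoefficients)
    (hmono : S.ArtificialDiffusion) (htime : S.TimeStepRestriction) {α : A} {η : ℝ} (hη : 0 < η)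
    {u r : Sp d → ℝ} (hfr : IsFrozenSupersolution pb α η u r) {U R : ℕ → Sp d → ℝ}
    (hU : S.IsProjSeq u U) (hR : S.IsProjSeq r R) :
    ∃ Δ > 0, ∀ᶠ i in atTop, ∀ ρ : ℝ, |ρ| ≤ Δ → ∀ C : ℝ, 0 ≤ C →
      (∀ y ∈ (S.mesh i).vertices, y ∈ interior pb.cl ∪ pb.bdT → 0 < -R i y +
        (S.opE i α (S.barrier i (U i) (R i) (ρ + S.h i) C) y +
          S.opI i α (S.barrier i (U i) (R i) ρ C) y) - S.rhs i α y) ∧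
      ∀ y ∈ (S.mesh i).vertices, y ∈ pb.bdR →
        0 < S.opI i α (S.barrier i (U i) (R i) ρ C) y - S.rhs i α y := by
  obtain ⟨M, hM, hb, hbB⟩ := exists_bound pb α hR.smooth
  have hlinB : ∀ x ∈ frontier pb.cl, |pb.linB α r x| ≤ 2 * (M * M) := by
    intro x hx
    obtain ⟨h1, h2⟩ := hbB x hx
    obtain ⟨-, -, -, -, h5, h6, -⟩ := hb x (pb.isCompact_cl.isClosed.frontier_subset hx)
    have f1 := (abs_real_inner_le_norm (pb.bB α x) (gradient r x)).trans
      (mul_le_mul h1 h5 (norm_nonneg _) hM)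
    have f2 := abs_mul_le_of_abs_le h2 h6
    rw [BellmanProblem.linB]
    rw [abs_le] at *
    constructor <;> linarith
  -- The constant `M + 2 * (M * M) + 1` bounds the operator on the projection of `r` at interior and
  -- boundary nodes alike, so the term linear in `ρ` costs at most `η / 2`.
  obtain ⟨Δ, hΔ, -, hΔη⟩ := exists_pos_mul_le (C := M + 2 * (M * M) + 1) (δ := η / 2)
    (by positivity) (by positivity)
  -- At most four consistency errors of this size occur at a node; with `η / 2` for the `ρ` term the
  -- total stays below `η`.
  have hδ : 0 < η / 10 := by positivity
  refine ⟨Δ, hΔ, ?_⟩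
  filter_upwards [consistent_interior hcons hU α hδ, consistent_interior hcons hR α one_pos,
    h_mul_opE_interior hd hcons hmono htime hR α hδ, consistent_value hR hδ,
    consistent_rhs hcons α hδ, consistent_boundary hcons hU α hδ,
    consistent_boundary hcons hR α one_pos, h_mul_opE_boundary hcons hR α hδ,
    hR.approx _ hδ, hcons.consistent_boundary _ hδ]
    with i cU cR cE cV cF bU bR bE bV bF ρ hρ C hC
  have hK := S.isMesh i
  refine ⟨fun y hy hyT => ?_, fun y hy hyR => ?_⟩
  · have hge := opE_add_opI_barrier_ge hcons hmono i α hy (hU.mem i) (hR.mem i) ρ (S.h i) hC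
    rcases hyT with hyi | hyT
    · have h1 := cU y hy hyi
      have h2 := cR y hy hyi
      have h3 := cE y hy hyi
      have h4 := cV y hy
      have h5 := cF y hy hyi
      have hL : PwCont (S.mesh i) (pb.lin α u) :=
        PwCont.of_continuousOn hK (continuousOn_lin (contDiff_infty.1 hU.smooth 2))
      have hL' : PwCont (S.mesh i) (pb.lin α r) :=
        PwCont.of_continuousOn hK (continuousOn_lin (contDiff_infty.1 hR.smooth 2))
      have hr : PwCont (S.mesh i) r :=
        PwCont.of_continuousOn hK hR.smooth.continuous.continuousOn
      have hf : PwCont (S.mesh i) (pb.f α) :=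
        PwCont.of_continuousOn hK (pb.f_cont.continuousOn α)
      have hn := pwCont_nhat hK y
      have h6 := le_integral_mul_nhat hK hy ((hr.neg.add hL).sub hf) (c := η)
        fun s hs _ x hx => hfr.interior_le x (interior_mono (hK.simplex_subset hs) hx)
      have h7 : ∫ x in pb.cl, (-r x + pb.lin α u x - pb.f α x) * nhat (S.mesh i) y x =
          -(∫ x in pb.cl, r x * nhat (S.mesh i) y x) +
            (∫ x in pb.cl, pb.lin α u x * nhat (S.mesh i) y x) -
            ∫ x in pb.cl, pb.f α x * nhat (S.mesh i) y x := by
        have i1 := (hr.mul hn).integrableOn hK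
        have i2 := (hL.mul hn).integrableOn hK
        have i3 := (hf.mul hn).integrableOn hK
        have i1n : IntegrableOn (fun x => -(r x * nhat (S.mesh i) y x)) pb.cl := i1.neg
        have i12 : IntegrableOn (fun x => -(r x * nhat (S.mesh i) y x) +
            pb.lin α u x * nhat (S.mesh i) y x) pb.cl := i1n.add i2
        rw [← integral_neg, ← integral_add i1n i2, ← integral_sub i12 i3]
        congr 1
        funext x
        ring
      have h8 := abs_integral_mul_nhat_le hK hy hL' (c := M) fun s hs _ x hx =>
        (hb x (hK.simplex_subset hs (interior_subset hx))).2.2.2.2.2.2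
      have h9 : |S.opE i α (R i) y + S.opI i α (R i) y| ≤ M + 2 * (M * M) + 1 := by
        have : 0 ≤ M * M := by positivity
        rw [abs_le] at *
        constructor <;> linarith
      have h10 := (abs_mul_le_of_abs_le hρ h9).trans hΔη
      rw [h7] at h6
      rw [abs_le] at *
      linarith
    · have hf : y ∈ frontier pb.cl := by rw [← pb.union_eq]; exact Or.inl (Or.inl hyT)
      have h1 := bU y hy (Or.inl hyT)
      have h2 := bR y hy (Or.inl hyT)
      have h3 := bE y hy hyT
      have h4 := bV.abs_sub_le y (hK.vertices_subset hy)
      have h5 := (bF α y hf).2.2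
      have h6 := hfr.bdT_le y hyT
      have h8 := hlinB y hf
      have h9 : |S.opE i α (R i) y + S.opI i α (R i) y| ≤ M + 2 * (M * M) + 1 := by
        rw [abs_le] at *
        constructor <;> linarith
      have h10 := (abs_mul_le_of_abs_le hρ h9).trans hΔη
      rw [rhs, if_neg (pb.notMem_interior (Or.inl (Or.inl hyT))), if_neg (pb.notMem_bdD (Or.inl hyT))]
      rw [abs_le] at *
      linarith
  -- The shift is taken to be zero because the explicit operator vanishes on `bdR`, so the later
  -- time level plays no role.
  · have hge := opE_add_opI_barrier_ge hcons hmono i α hy (hU.mem i) (hR.mem i) ρ 0 hC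
    have hf : y ∈ frontier pb.cl := by rw [← pb.union_eq]; exact Or.inl (Or.inr hyR)
    have h1 := bU y hy (Or.inr hyR)
    have h2 := bR y hy (Or.inr hyR)
    have h5 := (bF α y hf).2.2
    have h6 := hfr.bdR_le y hyR
    have h8 := hlinB y hf
    have h9 : |S.opE i α (R i) y + S.opI i α (R i) y| ≤ M + 2 * (M * M) + 1 := by
      rw [abs_le] at *
      constructor <;> linarith
    have h10 := (abs_mul_le_of_abs_le hρ h9).trans hΔη
    have h11 := opE_of_bdR hcons i α hyR (S.barrier i (U i) (R i) (ρ + 0) C)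
    rw [h11, zero_mul, add_zero, zero_add] at hge
    rw [rhs, if_neg (pb.notMem_interior (Or.inl (Or.inr hyR))), if_neg (pb.notMem_bdD (Or.inr hyR))]
    rw [abs_le] at *
    linarith

/-! ### The upper bound -/

/-- The numerical solutions `v i` are eventually bounded above on the time interval `[t, T]`. -/
def BoundedAfter (S : Discretisation pb) (v : ℕ → ℕ → Sp d → ℝ) (t : ℝ) : Prop :=
  ∃ C : ℝ, ∀ᶠ i in atTop, ∀ k ≤ S.n i, t ≤ k * S.h i → ∀ y ∈ (S.mesh i).vertices, v i k y ≤ C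

theorem n_mul_h (S : Discretisation pb) (i : ℕ) : S.n i * S.h i = pb.T :=
  mul_div_cancel₀ _ (by exact_mod_cast (S.n_pos i).ne')

variable {v : ℕ → ℕ → Sp d → ℝ}

theorem boundedAfter_final (hv : ∀ i, S.IsNumericalSolution i (v i)) : S.BoundedAfter v pb.T := by
  obtain ⟨M, hM⟩ := pb.isCompact_cl.exists_bound_of_continuousOn pb.vT_cont
  refine ⟨M, Eventually.of_forall fun i k hk hTk y hy => ?_⟩
  have hkn : k = S.n i := by
    refine le_antisymm hk ?_
    rw [← S.n_mul_h i] at hTk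
    exact_mod_cast le_of_mul_le_mul_right hTk (S.h_pos i)
  rw [hkn, (hv i).final y hy]
  exact (le_abs_self _).trans (hM y ((S.isMesh i).vertices_subset hy))

theorem IsProjSeq.exists_bound {z : Sp d → ℝ} {Z : ℕ → Sp d → ℝ} (h : S.IsProjSeq z Z) :
    ∃ M : ℝ, 0 ≤ M ∧ ∀ᶠ i in atTop, ∀ y ∈ (S.mesh i).vertices, |Z i y| ≤ M := by
  obtain ⟨M, hM⟩ := pb.isCompact_cl.exists_bound_of_continuousOn h.smooth.continuous.continuousOn
  refine ⟨|M| + 1, by positivity, ?_⟩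
  filter_upwards [h.approx 1 one_pos] with i hi y hy
  have hyc := (S.isMesh i).vertices_subset hy
  have h1 := hi.abs_sub_le y hyc
  have h2 := hM y hyc
  rw [Real.norm_eq_abs] at h2
  have h3 := abs_add_le (z y) (Z i y - z y)
  rw [add_sub_cancel] at h3
  linarith [le_abs_self M]

/-- Upper bounds propagate backwards over a time interval around the freezing time. -/
theorem exists_boundedAfter_step [Nonempty A] (hd : 2 ≤ d) (hcons : S.ConsistentCoefficients)
    (hmono : S.ArtificialDiffusion) (htime : S.TimeStepRestriction)
    (hproj : S.HasEllipticProjections) (hv : ∀ i, S.IsNumericalSolution i (v i))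
    {α : A} {η : ℝ} (hη : 0 < η) {u r : Sp d → ℝ} (hfr : IsFrozenSupersolution pb α η u r)
    (hu : ContDiff ℝ ∞ u ∧ HasCompactSupport u) (hr : ContDiff ℝ ∞ r ∧ HasCompactSupport r)
    (τ : ℝ) : ∃ Δ > 0, ∀ t ≤ pb.T, t ≤ τ + Δ → S.BoundedAfter v t → S.BoundedAfter v (τ - Δ) := by
  obtain ⟨U, hU⟩ := hproj.exists_isProjSeq hu.1 hu.2
  obtain ⟨R, hR⟩ := hproj.exists_isProjSeq hr.1 hr.2
  obtain ⟨Δ, hΔ, hbar⟩ := exists_barrier hd hcons hmono htime hη hfr hU hR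
  refine ⟨Δ, hΔ, fun t htT htτ ⟨C₁, hC₁⟩ => ?_⟩
  obtain ⟨MU, hMU, hUb⟩ := hU.exists_bound
  obtain ⟨MR, hMR, hRb⟩ := hR.exists_bound
  obtain ⟨Cg, hCg⟩ := (pb.isCompact_cl.of_isClosed_subset isClosed_frontier
    pb.isCompact_cl.isClosed.frontier_subset).exists_bound_of_continuousOn pb.g_cont
  -- Large enough that the barrier exceeds both the known later bound and the Dirichlet data
  -- whenever `|ρ| ≤ Δ + 1`. The extra `1` allows for one time step beyond `τ + Δ`, as `h ≤ 1`
  -- eventually. Since `Δ` was fixed before `C`, there is no circularity.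
  set C := |C₁| + |Cg| + MU + (Δ + 1) * MR with hC
  have hC0 : 0 ≤ C := by positivity
  refine ⟨|C₁| + (MU + (Δ + 1) * MR + C), ?_⟩
  filter_upwards [hbar, hC₁, hUb, hRb, S.tendsto_h.eventually (eventually_le_nhds one_pos)]
    with i hbar hC₁ hUb hRb hh
  have hpos := S.h_pos i
  have hval : ∀ ρ : ℝ, |ρ| ≤ Δ + 1 → ∀ y ∈ (S.mesh i).vertices,
      |C₁| + |Cg| ≤ S.barrier i (U i) (R i) ρ C y ∧
        S.barrier i (U i) (R i) ρ C y ≤ MU + (Δ + 1) * MR + C := by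
    intro ρ hρ y hy
    have h1 := hUb y hy
    have h2 := abs_mul_le_of_abs_le hρ (hRb y hy)
    rw [barrier_apply ρ C hy]
    rw [abs_le] at h1 h2
    constructor <;> linarith
  have key : ∀ k ≤ S.n i, τ - Δ ≤ k * S.h i → k * S.h i ≤ τ + Δ + 1 →
      ∀ y ∈ (S.mesh i).vertices, v i k y ≤ S.barrier i (U i) (R i) (k * S.h i - τ) C y := by
    intro k hk
    -- At times where a bound is already known the comparison is immediate from the size of `C`;
    -- this starts the backward induction.
    have hlate : ∀ k ≤ S.n i, t ≤ k * S.h i → τ - Δ ≤ k * S.h i → k * S.h i ≤ τ + Δ + 1 →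
        ∀ y ∈ (S.mesh i).vertices, v i k y ≤ S.barrier i (U i) (R i) (k * S.h i - τ) C y := by
      intro k hk htk h1 h2 y hy
      have h3 := hC₁ k hk htk y hy
      have h4 := (hval (k * S.h i - τ) (abs_le.2 ⟨by linarith, by linarith⟩) y hy).1
      linarith [le_abs_self C₁, abs_nonneg Cg]
    induction hk using Nat.decreasingInduction with
    | self => exact hlate _ le_rfl (by rw [S.n_mul_h]; exact htT)
    | of_succ k hk ih =>
      intro h1 h2
      by_cases htk : t ≤ k * S.h i
      · exact hlate k hk.le htk h1 h2
      · push Not at htk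
        have hsucc : ((k + 1 : ℕ) : ℝ) * S.h i = k * S.h i + S.h i := by push_cast; ring
        rw [hsucc] at ih
        have hnext := ih (by linarith) (by linarith)
        have hρ : |k * S.h i - τ| ≤ Δ := abs_le.2 ⟨by linarith, by linarith⟩
        have hs : k * S.h i + S.h i - τ = k * S.h i - τ + S.h i := by ring
        rw [hs] at hnext
        obtain ⟨hTb, hRb'⟩ := hbar (k * S.h i - τ) hρ C hC0
        refine (hv i).le_of_supersolution hcons hmono htime hk α
          (barrier_mem (hU.mem i) (hR.mem i) _ _) (barrier_mem (hU.mem i) (hR.mem i) _ _) hnext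
          (fun y hy hyD => ?_) (fun y hy hyT => ?_) hRb'
        · have hf : y ∈ frontier pb.cl := by rw [← pb.union_eq]; exact Or.inr hyD
          have h3 := (hval _ (hρ.trans (by linarith)) y hy).1
          have h4 := hCg y hf
          rw [Real.norm_eq_abs] at h4
          linarith [le_abs_self (pb.g y), le_abs_self Cg, abs_nonneg C₁]
        -- The barrier is affine in time, so its difference quotient equals `R` with no truncation
        -- error.
        · have hq : (S.barrier i (U i) (R i) (k * S.h i - τ + S.h i) C y -
              S.barrier i (U i) (R i) (k * S.h i - τ) C y) / S.h i = R i y := by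
            rw [barrier_apply _ _ hy, barrier_apply _ _ hy]
            field_simp
            ring
          rw [hq]
          exact hTb y hy hyT
  intro k hk hτk y hy
  by_cases htk : t ≤ k * S.h i
  · have := hC₁ k hk htk y hy
    have h0 : 0 ≤ MU + (Δ + 1) * MR + C := by positivity
    linarith [le_abs_self C₁]
  · push Not at htk
    have h1 := key k hk hτk (by linarith) y hy
    have h2 := (hval (k * S.h i - τ) (abs_le.2 ⟨by linarith, by linarith⟩) y hy).2
    linarith [abs_nonneg C₁]

/-! ### Reaching time zero -/

theorem BoundedAfter.mono {t t' : ℝ} (h : S.BoundedAfter v t) (htt : t ≤ t') :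
    S.BoundedAfter v t' := by
  obtain ⟨C, hC⟩ := h
  refine ⟨C, ?_⟩
  filter_upwards [hC] with i hi k hk hk' using hi k hk (htt.trans hk')

/-- The length `Δ` depends on the freezing time, so the steps cannot simply be iterated a prescribed
number of times. Freezing at the infimum of the good times avoids any uniformity: some good time
lies within `Δ` above the infimum, and the step from it lands below the infimum. -/
theorem boundedAfter_zero [Nonempty A] (hd : 2 ≤ d) (hcons : S.ConsistentCoefficients)
    (hmono : S.ArtificialDiffusion) (htime : S.TimeStepRestriction)
    (hproj : S.HasEllipticProjections) (hsuper : pb.HasStrictSupersolution)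
    (hv : ∀ i, S.IsNumericalSolution i (v i)) : S.BoundedAfter v 0 := by
  obtain ⟨α, w, ε, hw, hε, hsup⟩ := hsuper
  set B := {t | t ∈ Icc 0 pb.T ∧ S.BoundedAfter v t} with hB
  have hne : B.Nonempty := ⟨pb.T, ⟨pb.T_pos.le, le_rfl⟩, boundedAfter_final hv⟩
  have hbdd : BddBelow B := ⟨0, fun t ht => ht.1.1⟩
  have hτ : sInf B ∈ Icc 0 pb.T :=
    ⟨le_csInf hne fun t ht => ht.1.1, csInf_le hbdd ⟨⟨pb.T_pos.le, le_rfl⟩, boundedAfter_final hv⟩⟩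
  obtain ⟨u, r, hu, hr, hfr⟩ := exists_isFrozenSupersolution hw hε hsup hτ
  obtain ⟨Δ, hΔ, hstep⟩ := exists_boundedAfter_step hd hcons hmono htime hproj hv
    (half_pos hε) hfr hu hr (sInf B)
  obtain ⟨t, ht, htlt⟩ := exists_lt_of_csInf_lt hne (lt_add_of_pos_right (sInf B) hΔ)
  have h1 := hstep t ht.1.2 htlt.le ht.2
  by_contra h0
  have hpos : 0 < sInf B - Δ := by
    by_contra hle
    exact h0 (h1.mono (not_lt.1 hle))
  have hmem : sInf B - Δ ∈ B := ⟨⟨hpos.le, by linarith [hτ.2]⟩, h1⟩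
  linarith [csInf_le hbdd hmem]

/-- At a fixed level only finitely many pairs of time step and node occur, and nodal bounds control
the whole function. -/
theorem exists_bound_level {i : ℕ} {q : ℕ → Sp d → ℝ} (hq : S.IsNumericalSolution i q) :
    ∃ C : ℝ, ∀ k ≤ S.n i, ∀ x ∈ pb.cl, |q k x| ≤ C := by
  have hK := S.isMesh i
  obtain ⟨C, hC⟩ := (((finite_Iic (S.n i)).prod hK.finite_vertices).image
    fun p : ℕ × Sp d => |q p.1 p.2|).bddAbove
  exact ⟨C, fun k hk x hx => P1.abs_le hK (hq.mem k hk)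
    (fun y hy => hC ⟨(k, y), ⟨hk, hy⟩, rfl⟩) hx⟩

end Discretisation

end BellmanFEM

/-! ### The uniform bound -/

theorem theorem7p2 {d : ℕ} (hd : 2 ≤ d) {A : Type*} [MetricSpace A] [CompactSpace A]
    (pb : BellmanFEM.BellmanProblem d A) (S : BellmanFEM.Discretisation pb)
    (hcons : S.ConsistentCoefficients) (hmono : S.ArtificialDiffusion)
    (htime : S.TimeStepRestriction) (hproj : S.HasEllipticProjections)
    (hsuper : pb.HasStrictSupersolution)
    (v : ℕ → ℕ → BellmanFEM.Sp d → ℝ) (hv : ∀ i, S.IsNumericalSolution i (v i)) :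
    ∃ C : ℝ, 0 < C ∧ ∀ i, ∀ k ≤ S.n i, ∀ x ∈ pb.cl, |v i k x| ≤ C := by
  have hA : Nonempty A := ⟨hsuper.choose⟩
  obtain ⟨C, hC⟩ :=
    BellmanFEM.Discretisation.boundedAfter_zero hd hcons hmono htime hproj hsuper hv
  obtain ⟨N, hN⟩ := eventually_atTop.1 hC
  choose B hB using fun i => BellmanFEM.Discretisation.exists_bound_level (hv i)
  -- The upper bound holds from level `N` on, where nonnegativity turns it into a bound on the
  -- absolute value; the sum covers the finitely many earlier levels, and the final `1` makes the
  -- constant positive.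
  refine ⟨|C| + ∑ i ∈ Finset.range N, |B i| + 1, by positivity, fun i k hk x hx => ?_⟩
  have hsum : 0 ≤ ∑ i ∈ Finset.range N, |B i| := Finset.sum_nonneg fun _ _ => abs_nonneg _
  by_cases hi : N ≤ i
  · have h1 : |v i k x| ≤ |C| := by
      refine BellmanFEM.P1.abs_le (S.isMesh i) ((hv i).mem k hk) (fun y hy => ?_) hx
      rw [abs_of_nonneg ((hv i).nonneg hcons hmono htime hk y hy)]
      exact (hN i hi k hk (mul_nonneg (Nat.cast_nonneg k) (S.h_pos i).le) y hy).trans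
        (le_abs_self C)
    linarith
  · have h1 : |B i| ≤ ∑ i ∈ Finset.range N, |B i| :=
      Finset.single_le_sum (f := fun i => |B i|) (fun _ _ => abs_nonneg _)
        (Finset.mem_range.2 (not_le.1 hi))
    linarith [hB i k hk x hx, le_abs_self (B i), abs_nonneg C]
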